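/- Let $\alpha_1,\alpha_2\in\mathbb R$, $\alpha(x)=\alpha_1$ for $x<0$, $\alpha(x)=\alpha_2$ for $x>0$, and let $\psi_0:\mathbb R\to\mathbb C$ be differentiable with $\psi_0,\psi_0'\in L^1(\mathbb R)$ and both $\psi_0$ and $\psi_0'$ (locally) absolutely continuous. Let $\psi:\mathbb R\times[0,\infty)\to\mathbb C$ be a classical solution of $$ i\psi_t=-\psi_{xx}+\alpha(x)\psi\quad(x\neq0,\ t>0),\qquad \psi(x,0)=\psi_0(x)\quad(x\in\mathbb R), $$ with $\psi$ and $\psi_x$ continuous across $x=0$, in the following sense: $\psi$ is continuous on $\mathbb R\times[0,\infty)$; $\psi_x$ exists and is continuous on $\mathbb R\times(0,\infty)$; $\psi_t$ and $\psi_{xx}$ exist and are continuous for $x\ne0$, $t>0$ and satisfy the equation there; for every $t>0$, $\psi(x,t)\to0$ as $x\to\pm\infty$ and $\psi(\cdot,t),\psi_x(\cdot,t)\in L^1(\mathbb R)$; and for every $T>0$, $\psi,\psi_x\in L^1(\mathbb R\times(0,T))$ and $\psi_x(0,\cdot)\in L^1(0,T)$. Put $$\hat\psi^{(1)}_0(k)=\int_{-\infty}^0e^{-ikx}\psi_0(x)\,dx\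 (\Im k\ge0),\qquad \hat\psi^{(2)}_0(k)=\int_0^\infty e^{-ikx}\psi_0(x)\,dx\ (\Im k\le0),$$ $$\omega_j(k)=i(\alpha_j+k^2),\qquad \nu^{(j)}=\nu^{(j)}(\kappa)=i\kappa\sqrt{1+\alpha_j/\kappa^2},\qquad \Lambda=\max\{|\alpha_1|,|\alpha_2|\},$$ with principal square roots. For $R>0$ let $D_R^{(j)}$ be the set of all $k$ in the $j$-th open quadrant of $\mathbb C$ with $|k|>R$, and let $\partial D_R^{(j)}$ be its boundary, oriented so that $D_R^{(j)}$ lies to its left. Integrals over $\mathbb R$ and over $\partial D_R^{(j)}$ are improper integrals, the two ends being taken to infinity independently. Then for all $R>\sqrt{2\Lambda}$ and $t>0$ all the integrals below converge, the value of each is independent of $R$, and the following holds. For $x<0$, $$\psi(x,t)=\frac1{2\pi}\int_{-\infty}^\infty e^{ikx-\omega_1t}\hat\psi^{(1)}_0(k)\,dk-\int_{\partial D_R^{(4)}}\frac{\kappa(\nu^{(1)}-\nu^{(2)})}{2\pi\nu^{(1)}(\nu^{(1)}+\nu^{(2)})}e^{-i\nu^{(1)}x+i\kappa^2t}\hat\psi^{(1)}_0(\nu^{(1)})\,d\kappa-\int_{\partial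 D_R^{(4)}}\frac{\kappa}{\pi(\nu^{(1)}+\nu^{(2)})}e^{-i\nu^{(1)}x+i\kappa^2t}\hat\psi^{(2)}_0(-\nu^{(2)})\,d\kappa,$$ and, with $s_1(k)=\sqrt{1+\frac{\alpha_1-\alpha_2}{k^2}}$, the two contour integrals are equal, term by term, to those in $$\psi(x,t)=\frac1{2\pi}\int_{-\infty}^\infty e^{ikx-\omega_1t}\hat\psi^{(1)}_0(k)\,dk-\int_{\partial D_R^{(3)}}\frac{1-s_1(k)}{2\pi(1+s_1(k))}e^{ikx-\omega_1t}\hat\psi^{(1)}_0(-k)\,dk-\int_{\partial D_R^{(3)}}\frac{1}{\pi(1+s_1(k))}e^{ikx-\omega_1t}\hat\psi^{(2)}_0(k\,s_1(k))\,dk.$$ For $x>0$, $$\psi(x,t)=\frac1{2\pi}\int_{-\infty}^\infty e^{ikx-\omega_2t}\hat\psi^{(2)}_0(k)\,dk-\int_{\partial D_R^{(4)}}\frac{\kappa}{\pi(\nu^{(1)}+\nu^{(2)})}e^{i\nu^{(2)}x+i\kappa^2t}\hat\psi^{(1)}_0(\nu^{(1)})\,d\kappa+\int_{\partial D_R^{(4)}}\frac{\kappa(\nu^{(1)}-\nu^{(2)})}{2\pi\nu^{(2)}(\nu^{(1)}+\nu^{(2)})}e^{i\nu^{(2)}x+i\kappa^2t}\hat\psi^{(2)}_0(-\nu^{(2)})\,d\kappa,$$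 and, with $s_2(k)=\sqrt{1-\frac{\alpha_1-\alpha_2}{k^2}}$, the two contour terms (with their signs) are equal, term by term, to those in $$\psi(x,t)=\frac1{2\pi}\int_{-\infty}^\infty e^{ikx-\omega_2t}\hat\psi^{(2)}_0(k)\,dk+\int_{\partial D_R^{(1)}}\frac{1}{\pi(1+s_2(k))}e^{ikx-\omega_2t}\hat\psi^{(1)}_0(k\,s_2(k))\,dk+\int_{\partial D_R^{(1)}}\frac{1-s_2(k)}{2\pi(1+s_2(k))}e^{ikx-\omega_2t}\hat\psi^{(2)}_0(-k)\,dk.$$ -/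

import Mathlib

open MeasureTheory Filter Topology

namespace StepPotential

noncomputable section

/-- The step potential; its value at the single point `0` plays no role. -/
def potential (α₁ α₂ : ℝ) (x : ℝ) : ℝ := if x < 0 then α₁ else α₂

/-- The spatial derivative `ψ_x(x, t)`. -/
def dx (ψ : ℝ → ℝ → ℂ) (x t : ℝ) : ℂ := deriv (fun y => ψ y t) x

/-- The second spatial derivative `ψ_xx(x, t)`. -/
def dxx (ψ : ℝ → ℝ → ℂ) (x t : ℝ) : ℂ := deriv (fun y => dx ψ y t) x

/-- The time derivative `ψ_t(x, t)`. -/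
def dt (ψ : ℝ → ℝ → ℂ) (x t : ℝ) : ℂ := deriv (fun s => ψ x s) t

/-- Admissible initial data: `ψ₀` and `ψ₀'` are integrable on `ℝ` and absolutely continuous
(on every bounded interval). -/
structure IsInitialDatum (ψ₀ : ℝ → ℂ) : Prop where
  integrable : Integrable ψ₀
  absolutelyContinuous : ∀ a b : ℝ, AbsolutelyContinuousOnInterval ψ₀ a b
  differentiable : Differentiable ℝ ψ₀
  integrable_deriv : Integrable (deriv ψ₀)
  absolutelyContinuous_deriv : ∀ a b : ℝ, AbsolutelyContinuousOnInterval (deriv ψ₀) a b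

/-- `ψ x t` is a classical solution of `i ψ_t = -ψ_xx + α(x) ψ`, `ψ(x, 0) = ψ₀(x)`, with `ψ` and
`ψ_x` continuous across the interface `x = 0`. -/
structure IsSolution (α₁ α₂ : ℝ) (ψ₀ : ℝ → ℂ) (ψ : ℝ → ℝ → ℂ) : Prop where
  /-- `ψ` is continuous on `ℝ × [0, ∞)`, in particular across the interface. -/
  continuousOn : ContinuousOn (fun p : ℝ × ℝ => ψ p.1 p.2) {p | 0 ≤ p.2}
  initial : ∀ x : ℝ, ψ x 0 = ψ₀ x
  /-- `ψ_x` exists and is continuous on `ℝ × (0, ∞)`, in particular across the interface. -/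
  differentiableAt_x : ∀ x t : ℝ, 0 < t → DifferentiableAt ℝ (fun y => ψ y t) x
  continuousOn_dx : ContinuousOn (fun p : ℝ × ℝ => dx ψ p.1 p.2) {p | 0 < p.2}
  /-- Away from the interface, `ψ_xx` and `ψ_t` exist, are continuous, and satisfy the equation
  (so that continuity of `ψ_t` gives that of `ψ_xx`). -/
  differentiableAt_dx : ∀ x t : ℝ, x ≠ 0 → 0 < t → DifferentiableAt ℝ (fun y => dx ψ y t) x
  differentiableAt_t : ∀ x t : ℝ, x ≠ 0 → 0 < t → DifferentiableAt ℝ (fun s => ψ x s) t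
  continuousOn_dt : ContinuousOn (fun p : ℝ × ℝ => dt ψ p.1 p.2) {p | p.1 ≠ 0 ∧ 0 < p.2}
  equation : ∀ x t : ℝ, x ≠ 0 → 0 < t →
    Complex.I * dt ψ x t = -dxx ψ x t + (potential α₁ α₂ x : ℂ) * ψ x t
  /-- Decay at `± ∞`. -/
  tendsto_atTop : ∀ t : ℝ, 0 < t → Tendsto (fun x => ψ x t) atTop (𝓝 0)
  tendsto_atBot : ∀ t : ℝ, 0 < t → Tendsto (fun x => ψ x t) atBot (𝓝 0)
  /-- `ψ` and `ψ_x` are integrable in `x` at each time, and in `(x, t)` over each strip. -/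
  integrable : ∀ t : ℝ, 0 < t → Integrable (fun x => ψ x t)
  integrable_dx : ∀ t : ℝ, 0 < t → Integrable (fun x => dx ψ x t)
  integrableOn_strip : ∀ T : ℝ, 0 < T →
    IntegrableOn (fun p : ℝ × ℝ => ψ p.1 p.2) (Set.univ ×ˢ Set.Ioo 0 T)
  integrableOn_strip_dx : ∀ T : ℝ, 0 < T →
    IntegrableOn (fun p : ℝ × ℝ => dx ψ p.1 p.2) (Set.univ ×ˢ Set.Ioo 0 T)
  /-- The trace of `ψ_x` at the interface is integrable in time down to `t = 0`. -/
  integrableOn_trace_dx : ∀ T : ℝ, 0 < T → IntegrableOn (fun s => dx ψ 0 s) (Set.Ioo 0 T)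

/-- The half-line Fourier transform `∫_{-∞}^0 e^{-ikx} f(x) dx`, for `Im k ≥ 0`. -/
def fourierNeg (f : ℝ → ℂ) (k : ℂ) : ℂ := ∫ x in Set.Iio (0 : ℝ), Complex.exp (-Complex.I * k * x) * f x

/-- The half-line Fourier transform `∫_0^∞ e^{-ikx} f(x) dx`, for `Im k ≤ 0`. -/
def fourierPos (f : ℝ → ℂ) (k : ℂ) : ℂ := ∫ x in Set.Ioi (0 : ℝ), Complex.exp (-Complex.I * k * x) * f x

/-- `ω(k) = i (α + k²)`. -/
def omega (α : ℝ) (k : ℂ) : ℂ := Complex.I * (α + k ^ 2)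

/-- `ν(κ) = i κ √(1 + α / κ²)`, with the principal branch of the square root. -/
def nu (α : ℝ) (κ : ℂ) : ℂ := Complex.I * κ * Complex.sqrt (1 + α / κ ^ 2)

/-- `∫_{-∞}^∞ f(k) dk` exists as an improper integral, with value `l`; the two limits of
integration tend to `-∞` and `∞` independently of each other. -/
def HasLineIntegral (f : ℂ → ℂ) (l : ℂ) : Prop :=
  Tendsto (fun p : ℝ × ℝ => ∫ k in p.1..p.2, f k) (atBot ×ˢ atTop) (𝓝 l)

/-- The part of the integral of `f` along the positively oriented boundary of
`D_R^{(j)} = {k in the j-th open quadrant : |k| > R}` that lies within distance `A` of the origin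
on the first ray and within distance `B` on the last ray. The boundary comes in from infinity along
the ray of argument `j π / 2`, follows the circle of radius `R` clockwise, and goes out to infinity
along the ray of argument `(j - 1) π / 2`, so that `D_R^{(j)}` is to its left. -/
def truncatedContourIntegral (j : ℕ) (R : ℝ) (f : ℂ → ℂ) (A B : ℝ) : ℂ :=
  -(∫ r in R..A, f (circleMap 0 r (j * Real.pi / 2)) *
      Complex.exp (((j * Real.pi / 2 : ℝ) : ℂ) * Complex.I))
  + (∫ θ in (j * Real.pi / 2 : ℝ)..((j - 1) * Real.pi / 2 : ℝ),
      f (circleMap 0 R θ) * (circleMap 0 R θ * Complex.I))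
  + ∫ r in R..B, f (circleMap 0 r ((j - 1) * Real.pi / 2)) *
      Complex.exp ((((j - 1) * Real.pi / 2 : ℝ) : ℂ) * Complex.I)

/-- `∫_{∂D_R^{(j)}} f(k) dk` exists as an improper contour integral, with value `l`. -/
def HasContourIntegral (j : ℕ) (R : ℝ) (f : ℂ → ℂ) (l : ℂ) : Prop :=
  Tendsto (fun p : ℝ × ℝ => truncatedContourIntegral j R f p.1 p.2) (atTop ×ˢ atTop) (𝓝 l)

end

end StepPotential

/-!
The formulas come from the unified transform method. On each half-line the equation is a local
conservation law for `e^{-ikx + ω(k)t} ψ`. Integrated over a half-line, it gives the global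
relation (`IsSolution.global_relation`, `IsSolution.global_relation_right`): the half-line
transform of `ψ(·, t)` is the free evolution of the transform of `ψ₀`, plus a boundary term, which
is an integral over time of the traces `ψ(0, ·)` and `ψ_x(0, ·)`. Inverting the transform at a
point `x < 0` (`tendsto_integral_fourierNeg`) gives `ψ(x, t)` as the integral over the real line
of the free evolution and of `e^{ikx}` times the boundary term.

The traces are unknown, but common to the two half-lines, and they enter the global relations with
a time exponential that depends on `ω(k)` only. With the branch `k √(1 + δ / k²)` of `√(k² + δ)`
(`shiftedRoot`, `δ = α₁ - α₂`) the time exponents of the two global relations agree, so that these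
relations, on the left half-line at `-k` and on the right one at `shiftedRoot δ k`, form a linear
system for the two boundary values when `k` is large in the lower half-plane. Solving it expresses
the boundary term by the transforms of `ψ₀` and of `ψ(·, t)` (`IsSolution.boundaryTerm_eq`). The
boundary term is entire in `k`, so its integral over the real line is the limit of those over
large lower half-circles. There the transforms of `ψ(·, t)` contribute nothing, by Jordan's lemma
and the bound `O(1 / |k|)` for transforms of functions with an integrable derivative; nor do the
transforms of `ψ₀` on the fourth-quadrant part, where `e^{-ω t}` is bounded. On the third-quadrant
part the transforms of `ψ₀` remain, and Cauchy's theorem moves the arc to `∂D_R^{(3)}`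
(`IsSolution.tendsto_boundaryTerm`).

The contour integrals converge only conditionally. Each is an integral over the data `ψ₀(y) dy` of
contour integrals of explicit kernels, which converge and are bounded uniformly in `y`: on the
imaginary ray the kernels decay exponentially; on the real ray the kernel of the reflected wave is
`O(|k|⁻²)` (`reflected_kernel_convergence`), and that of the transmitted wave is treated by an
integration by parts against Fresnel integrals, which are bounded uniformly in the linear part of
the phase (`transmitted_real_ray`, `fresnel_bounded`). Dominated convergence then applies.

Independence of `R` and the passage to the variable `κ` need contour deformations and a
substitution that maps circles to other curves. Both become trivial in the coordinate `z = log k`: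
the exterior of a disc becomes a half-plane, where the integrand has a primitive, and a truncated
contour integral is the difference of this primitive at the two endpoints
(`IsLogPrimitive.truncatedContourIntegral_eq`, `truncatedContourIntegral_shiftedRoot`). With
`κ = i k` one has `ν⁽ʲ⁾(κ) = -shiftedRoot (-αⱼ) k`.

The right half-line follows from the left one by the reflection `x ↦ -x`, which exchanges `α₁` and
`α₂` (`IsSolution.reflect`).
-/

open MeasureTheory Filter Topology

namespace StepPotential

/-! ### Contour integrals in logarithmic coordinates -/

/-- In the coordinate `z = log k`, the form `f k dk` becomes `f (exp z) * exp z dz`. If `f` is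
holomorphic outside a disc, this is holomorphic on a half-plane, and so has a primitive on every
bounded part of a smaller half-plane. -/
lemma exists_log_primitive {f : ℂ → ℂ} {ρ ρ' : ℝ} (hρ : 0 < ρ) (hρ' : ρ < ρ')
    (hf : DifferentiableOn ℂ f {k | ρ < ‖k‖}) (M : ℝ) :
    ∃ H : ℂ → ℂ, ∀ z : ℂ, Real.log ρ' ≤ z.re → z.re ≤ M → |z.im| ≤ M →
      HasDerivAt H (f (Complex.exp z) * Complex.exp z) z := by
  set L := Real.log ρ with hL
  set ε := Real.log ρ' - L with hε
  have hε0 : 0 < ε := sub_pos.2 (Real.log_lt_log hρ hρ')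
  set N := ((M - L) ^ 2 + M ^ 2 + 1) / (2 * ε) with hN
  have hN0 : 0 < N := by positivity
  have hNε : 2 * N * ε = (M - L) ^ 2 + M ^ 2 + 1 := by rw [hN]; field_simp
  -- the half-plane `L < re z` is the union of the balls of radius `N` about `L + N`
  have hd : DifferentiableOn ℂ (fun z => f (Complex.exp z) * Complex.exp z)
      (Metric.ball ((L + N : ℝ) : ℂ) N) := by
    refine DifferentiableOn.mul ?_ Complex.differentiable_exp.differentiableOn
    refine hf.comp Complex.differentiable_exp.differentiableOn ?_
    intro z hz
    have h1 : |(z - ((L + N : ℝ) : ℂ)).re| < N :=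
      lt_of_le_of_lt (Complex.abs_re_le_norm _) (by simpa [dist_eq_norm] using hz)
    rw [Complex.sub_re, Complex.ofReal_re, abs_lt] at h1
    show ρ < ‖Complex.exp z‖
    rw [Complex.norm_exp, ← Real.log_lt_iff_lt_exp hρ]
    linarith [h1.1]
  obtain ⟨H, hH⟩ := hd.isExactOn_ball
  refine ⟨H, fun z h1 h2 h3 => hH z ?_⟩
  rw [Metric.mem_ball, Complex.dist_eq_re_im, Real.sqrt_lt' hN0]
  simp only [Complex.ofReal_re, Complex.ofReal_im, sub_zero]
  have h4 : ε ≤ z.re - L := by rw [hε]; linarith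
  have h5 : z.im ^ 2 ≤ M ^ 2 := sq_le_sq' (by linarith [(abs_le.1 h3).1]) (abs_le.1 h3).2
  have h6 : (z.re - L) ^ 2 ≤ (M - L) ^ 2 := pow_le_pow_left₀ (by linarith) (by linarith) 2
  nlinarith [mul_le_mul_of_nonneg_left h4 hN0.le]

lemma exp_log_add_mul_I {r : ℝ} (hr : 0 < r) (θ : ℝ) :
    Complex.exp ((Real.log r : ℂ) + θ * Complex.I) = circleMap 0 r θ := by
  rw [Complex.exp_add, ← Complex.ofReal_exp, Real.exp_log hr, circleMap, zero_add]

lemma norm_circleMap_zero' {r : ℝ} (hr : 0 ≤ r) (θ : ℝ) : ‖circleMap 0 r θ‖ = r := by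
  rw [norm_circleMap_zero, abs_of_nonneg hr]

/-- `H` is a primitive of `f (exp z) * exp z` for `log ρ ≤ re z ≤ M` and `|im z| ≤ M`. -/
def IsLogPrimitive (H f : ℂ → ℂ) (ρ M : ℝ) : Prop :=
  ∀ z : ℂ, Real.log ρ ≤ z.re → z.re ≤ M → |z.im| ≤ M →
    HasDerivAt H (f (Complex.exp z) * Complex.exp z) z

lemma continuous_circleMap_radius (θ : ℝ) : Continuous fun r : ℝ => circleMap 0 r θ := by
  unfold circleMap; fun_prop

lemma IsLogPrimitive.integral_ray {H f : ℂ → ℂ} {ρ M a b θ : ℝ} (hH : IsLogPrimitive H f ρ M)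
    (hf : ContinuousOn f {k | ρ ≤ ‖k‖}) (hρ : 0 < ρ) (ha : ρ ≤ a) (hb : ρ ≤ b)
    (haM : Real.log a ≤ M) (hbM : Real.log b ≤ M) (hθ : |θ| ≤ M) :
    ∫ r in a..b, f (circleMap 0 r θ) * Complex.exp (θ * Complex.I) =
      H (Real.log b + θ * Complex.I) - H (Real.log a + θ * Complex.I) := by
  have hmin : ∀ r ∈ Set.uIcc a b, ρ ≤ r := fun r hr => le_trans (le_min ha hb) hr.1
  have hmax : ∀ r ∈ Set.uIcc a b, Real.log r ≤ M := by
    intro r hr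
    have h0 : 0 < r := lt_of_lt_of_le hρ (hmin r hr)
    rcases max_choice a b with h | h
    · exact (Real.log_le_log h0 (hr.2.trans_eq h)).trans haM
    · exact (Real.log_le_log h0 (hr.2.trans_eq h)).trans hbM
  refine intervalIntegral.integral_eq_sub_of_hasDerivAt
    (f := fun r : ℝ => H (Real.log r + θ * Complex.I)) ?_ ?_
  · intro r hr
    have h0 : 0 < r := lt_of_lt_of_le hρ (hmin r hr)
    have h1 := hH (Real.log r + θ * Complex.I) (by simpa using Real.log_le_log hρ (hmin r hr))
      (by simpa using hmax r hr) (by simpa using hθ)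
    have h2 : HasDerivAt (fun r : ℝ => (Real.log r : ℂ) + θ * Complex.I) ((r⁻¹ : ℝ) : ℂ) r :=
      ((Real.hasDerivAt_log h0.ne').ofReal_comp).add_const _
    have h3 := h1.comp r h2
    rw [exp_log_add_mul_I h0] at h3
    have h4 : circleMap 0 r θ * ((r⁻¹ : ℝ) : ℂ) = Complex.exp (θ * Complex.I) := by
      have : (r : ℂ) ≠ 0 := by exact_mod_cast h0.ne'
      rw [circleMap, zero_add, Complex.ofReal_inv]
      field_simp
    rw [mul_assoc, h4] at h3
    exact h3
  · refine ContinuousOn.intervalIntegrable ?_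
    refine ContinuousOn.mul (hf.comp (continuous_circleMap_radius θ).continuousOn ?_)
      continuousOn_const
    intro r hr
    show ρ ≤ ‖circleMap 0 r θ‖
    rw [norm_circleMap_zero' (hρ.le.trans (hmin r hr))]
    exact hmin r hr

lemma IsLogPrimitive.integral_arc {H f : ℂ → ℂ} {ρ M R a b : ℝ} (hH : IsLogPrimitive H f ρ M)
    (hf : ContinuousOn f {k | ρ ≤ ‖k‖}) (hρ : 0 < ρ) (hR : ρ ≤ R)
    (hRM : Real.log R ≤ M) (ha : |a| ≤ M) (hb : |b| ≤ M) :
    ∫ θ in a..b, f (circleMap 0 R θ) * (circleMap 0 R θ * Complex.I) =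
      H (Real.log R + b * Complex.I) - H (Real.log R + a * Complex.I) := by
  have hR0 : 0 < R := lt_of_lt_of_le hρ hR
  refine intervalIntegral.integral_eq_sub_of_hasDerivAt
    (f := fun θ : ℝ => H (Real.log R + θ * Complex.I)) ?_ ?_
  · intro θ hθ
    have hθM : |θ| ≤ M := by
      rw [abs_le] at *
      rcases Set.mem_uIcc.1 hθ with h | h <;> constructor <;> linarith [h.1, h.2]
    have h1 := hH (Real.log R + θ * Complex.I) (by simpa using Real.log_le_log hρ hR)
      (by simpa using hRM) (by simpa using hθM)
    have h2 : HasDerivAt (fun θ : ℝ => (Real.log R : ℂ) + θ * Complex.I) Complex.I θ := by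
      simpa using ((hasDerivAt_id θ).ofReal_comp.mul_const Complex.I).const_add (Real.log R : ℂ)
    have h3 := h1.comp θ h2
    rw [exp_log_add_mul_I hR0] at h3
    rw [mul_assoc] at h3
    exact h3
  · refine ContinuousOn.intervalIntegrable ?_
    refine ContinuousOn.mul (hf.comp (continuous_circleMap 0 R).continuousOn ?_)
      (by fun_prop)
    intro θ _
    show ρ ≤ ‖circleMap 0 R θ‖
    rwa [norm_circleMap_zero' hR0.le]

/-- A truncated contour integral is the difference of a logarithmic primitive at the endpoints. -/
lemma IsLogPrimitive.truncatedContourIntegral_eq {H f : ℂ → ℂ} {ρ M R A B : ℝ} {j : ℕ}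
    (hH : IsLogPrimitive H f ρ M) (hf : ContinuousOn f {k | ρ ≤ ‖k‖}) (hρ : 0 < ρ) (hR : ρ ≤ R)
    (hA : ρ ≤ A) (hB : ρ ≤ B) (hRM : Real.log R ≤ M) (hAM : Real.log A ≤ M)
    (hBM : Real.log B ≤ M) (hj : (j + 1) * Real.pi ≤ M) :
    truncatedContourIntegral j R f A B =
      H (Real.log B + ((j - 1) * Real.pi / 2 : ℝ) * Complex.I) -
        H (Real.log A + (j * Real.pi / 2 : ℝ) * Complex.I) := by
  have hπ := Real.pi_pos
  have hj0 : (0 : ℝ) ≤ j := Nat.cast_nonneg j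
  have h1 : |(j * Real.pi / 2 : ℝ)| ≤ M := by
    rw [abs_of_nonneg (by positivity)]; nlinarith
  have h2 : |((j - 1) * Real.pi / 2 : ℝ)| ≤ M := by
    rw [abs_le]; constructor <;> nlinarith
  unfold truncatedContourIntegral
  rw [hH.integral_ray hf hρ hR hA hRM hAM h1, hH.integral_ray hf hρ hR hB hRM hBM h2,
    hH.integral_arc hf hρ hR hRM h1 h2]
  ring

/-- By Cauchy's theorem, a truncated contour integral does not depend on the inner radius. -/
lemma truncatedContourIntegral_radius {f : ℂ → ℂ} {ρ R R' A B : ℝ} (j : ℕ) (hρ : 0 < ρ)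
    (hf : DifferentiableOn ℂ f {k | ρ < ‖k‖}) (hR : ρ < R) (hR' : ρ < R') (hA : ρ < A)
    (hB : ρ < B) :
    truncatedContourIntegral j R f A B = truncatedContourIntegral j R' f A B := by
  obtain ⟨ρ', h1, h2⟩ := exists_between (lt_min (lt_min hR hR') (lt_min hA hB))
  simp only [lt_min_iff] at h2
  obtain ⟨⟨h3, h4⟩, h5, h6⟩ := h2
  set M := max (max (Real.log R) (Real.log R'))
    (max (max (Real.log A) (Real.log B)) ((j + 1) * Real.pi)) with hM
  obtain ⟨H, hH⟩ := exists_log_primitive hρ h1 hf M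
  have hH' : IsLogPrimitive H f ρ' M := hH
  have hc : ContinuousOn f {k | ρ' ≤ ‖k‖} :=
    hf.continuousOn.mono fun k hk => lt_of_lt_of_le h1 hk
  rw [hH'.truncatedContourIntegral_eq hc (hρ.trans h1) h3.le h5.le h6.le (by simp [hM])
      (by simp [hM]) (by simp [hM]) (by simp [hM]),
    hH'.truncatedContourIntegral_eq hc (hρ.trans h1) h4.le h5.le h6.le (by simp [hM])
      (by simp [hM]) (by simp [hM]) (by simp [hM])]

/-- When both rays are cut at the radius of the circle, only the arc is left. -/
lemma truncatedContourIntegral_self (j : ℕ) (f : ℂ → ℂ) (r : ℝ) :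
    truncatedContourIntegral j r f r r =
      ∫ θ in (j * Real.pi / 2 : ℝ)..((j - 1) * Real.pi / 2 : ℝ),
        f (circleMap 0 r θ) * (circleMap 0 r θ * Complex.I) := by
  simp [truncatedContourIntegral]

lemma circleMap_add_pi_div_two (r θ : ℝ) :
    circleMap 0 r (θ + Real.pi / 2) = Complex.I * circleMap 0 r θ := by
  rw [circleMap, circleMap, Complex.ofReal_add, add_mul, Complex.exp_add]
  push_cast
  rw [Complex.exp_pi_div_two_mul_I]; ring

/-- Multiplication by `i` carries the boundary of one quadrant to that of the next. -/
lemma truncatedContourIntegral_succ (j : ℕ) (R : ℝ) (f : ℂ → ℂ) (A B : ℝ) :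
    truncatedContourIntegral (j + 1) R f A B =
      truncatedContourIntegral j R (fun k => f (Complex.I * k) * Complex.I) A B := by
  have e1 : ((j + 1 : ℕ) * Real.pi / 2 : ℝ) = j * Real.pi / 2 + Real.pi / 2 := by push_cast; ring
  have e2 : (((j + 1 : ℕ) - 1) * Real.pi / 2 : ℝ) = (j - 1) * Real.pi / 2 + Real.pi / 2 := by
    push_cast; ring
  have e3 : ∀ θ : ℝ, Complex.exp (((θ + Real.pi / 2 : ℝ) : ℂ) * Complex.I) =
      Complex.I * Complex.exp (θ * Complex.I) := by
    intro θ
    rw [Complex.ofReal_add, add_mul, Complex.exp_add]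
    push_cast
    rw [Complex.exp_pi_div_two_mul_I]; ring
  unfold truncatedContourIntegral
  rw [e1, e2, e3, e3, ← intervalIntegral.integral_comp_add_right]
  simp only [circleMap_add_pi_div_two]
  congr 2
  · congr 1
    refine intervalIntegral.integral_congr fun r _ => ?_
    ring
  · refine intervalIntegral.integral_congr fun r _ => ?_
    ring
  · refine funext fun r => ?_
    ring

/-! ### The branch `k √(1 + δ / k²)` of `√(k² + δ)` -/

/-- The branch `k √(1 + δ / k²)` of `√(k² + δ)`, asymptotic to `k` at infinity. It carries the
dispersion relation of one half-line to that of the other. -/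
noncomputable def shiftedRoot (δ : ℝ) (k : ℂ) : ℂ := k * Complex.sqrt (1 + δ / k ^ 2)

lemma one_add_div_re_pos {δ : ℝ} {k : ℂ} (h : |δ| < ‖k‖ ^ 2) : 0 < (1 + δ / k ^ 2).re := by
  have h0 : 0 < ‖k‖ ^ 2 := (abs_nonneg δ).trans_lt h
  have h1 : ‖(δ : ℂ) / k ^ 2‖ < 1 := by
    rw [norm_div, norm_pow, Complex.norm_real, Real.norm_eq_abs, div_lt_one h0]
    exact h
  have h2 := (abs_le.1 (Complex.abs_re_le_norm ((δ : ℂ) / k ^ 2))).1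
  rw [Complex.add_re, Complex.one_re]
  linarith

lemma one_add_div_mem_slitPlane {δ : ℝ} {k : ℂ} (h : |δ| < ‖k‖ ^ 2) :
    1 + δ / k ^ 2 ∈ Complex.slitPlane := Or.inl (one_add_div_re_pos h)

lemma sqrt_mul_sqrt_self (w : ℂ) : Complex.sqrt w * Complex.sqrt w = w := by
  rw [← sq]
  simp [Complex.sqrt]

lemma re_sqrt_pos {w : ℂ} (h : w ∈ Complex.slitPlane) : 0 < (Complex.sqrt w).re := by
  rw [Complex.sqrt, Complex.cpow_inv_two_re]
  apply Real.sqrt_pos.2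
  have h1 : -w.re < ‖w‖ := by
    rcases h with h | h
    · linarith [norm_nonneg w]
    · by_contra! h2
      have h3 : ‖w‖ ^ 2 = w.re ^ 2 + w.im ^ 2 := by
        rw [Complex.sq_norm, Complex.normSq_apply]; ring
      have h4 : 0 < w.im ^ 2 := by positivity
      nlinarith [norm_nonneg w]
  linarith

/-- The principal square root is the only one with positive real part. -/
lemma eq_sqrt_of_mul_self {z w : ℂ} (h : z * z = w) (hz : 0 < z.re) : z = Complex.sqrt w := by
  have h1 : (Complex.sqrt w - z) * (Complex.sqrt w + z) = 0 := by
    have := sqrt_mul_sqrt_self w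
    linear_combination this - h
  rcases mul_eq_zero.1 h1 with h2 | h2
  · exact (sub_eq_zero.1 h2).symm
  · have h3 : 0 ≤ (Complex.sqrt w).re := by
      rw [Complex.sqrt, Complex.cpow_inv_two_re]; exact Real.sqrt_nonneg _
    have h4 := congrArg Complex.re h2
    simp only [Complex.add_re, Complex.zero_re] at h4
    linarith

lemma ne_zero_of_abs_lt {δ : ℝ} {k : ℂ} (h : |δ| < ‖k‖ ^ 2) : k ≠ 0 := by
  rintro rfl
  simp at h
  linarith [abs_nonneg δ]

lemma shiftedRoot_sq {δ : ℝ} {k : ℂ} (hk : k ≠ 0) : shiftedRoot δ k ^ 2 = k ^ 2 + δ := by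
  rw [shiftedRoot, mul_pow, sq (Complex.sqrt _), sqrt_mul_sqrt_self]
  field_simp

lemma shiftedRoot_div_re_pos {δ : ℝ} {k : ℂ} (h : |δ| < ‖k‖ ^ 2) :
    0 < (shiftedRoot δ k / k).re := by
  rw [shiftedRoot, mul_div_cancel_left₀ _ (ne_zero_of_abs_lt h)]
  exact re_sqrt_pos (one_add_div_mem_slitPlane h)

lemma shiftedRoot_ne_zero {δ : ℝ} {k : ℂ} (h : |δ| < ‖k‖ ^ 2) : shiftedRoot δ k ≠ 0 := by
  intro h0
  have := shiftedRoot_div_re_pos h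
  simp [h0] at this

lemma eq_shiftedRoot {δ : ℝ} {k z : ℂ} (hk : k ≠ 0) (h1 : z ^ 2 = k ^ 2 + δ)
    (h2 : 0 < (z / k).re) : z = shiftedRoot δ k := by
  rw [shiftedRoot, ← eq_sqrt_of_mul_self (z := z / k) (w := 1 + δ / k ^ 2) ?_ h2]
  · field_simp
  · field_simp
    exact h1

/-- The branch maps the closed lower half-plane into itself. -/
lemma shiftedRoot_im_nonpos {δ : ℝ} {k : ℂ} (h : |δ| < ‖k‖ ^ 2) (hk : k.im ≤ 0) :
    (shiftedRoot δ k).im ≤ 0 := by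
  have h0 := ne_zero_of_abs_lt h
  have h1 := congrArg Complex.im (shiftedRoot_sq (δ := δ) h0)
  have h2 := shiftedRoot_div_re_pos h
  have hn : 0 < Complex.normSq k := Complex.normSq_pos.2 h0
  rw [Complex.div_re, ← add_div] at h2
  have h3 := (div_pos_iff_of_pos_right hn).1 h2
  set z := shiftedRoot δ k
  simp only [sq, Complex.mul_im, Complex.add_im, Complex.ofReal_im, add_zero] at h1
  by_contra! h4
  nlinarith [mul_pos h3 h4, mul_nonneg (sq_nonneg k.re) (neg_nonneg.2 hk),
    mul_nonneg (sq_nonneg z.im) (neg_nonneg.2 hk), congrArg (· * k.re) h1]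

lemma one_le_norm_one_add_of_re_nonneg {z : ℂ} (h : 0 ≤ z.re) : 1 ≤ ‖1 + z‖ := by
  have := Complex.abs_re_le_norm (1 + z)
  rw [Complex.add_re, Complex.one_re, abs_of_nonneg (by linarith)] at this
  linarith

lemma one_le_norm_one_add_sqrt {δ : ℝ} {k : ℂ} (h : |δ| < ‖k‖ ^ 2) :
    1 ≤ ‖1 + Complex.sqrt (1 + δ / k ^ 2)‖ :=
  one_le_norm_one_add_of_re_nonneg (re_sqrt_pos (one_add_div_mem_slitPlane h)).le

lemma one_add_sqrt_ne_zero {δ : ℝ} {k : ℂ} (h : |δ| < ‖k‖ ^ 2) :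
    1 + Complex.sqrt (1 + δ / k ^ 2) ≠ 0 := by
  have := one_le_norm_one_add_sqrt h
  intro h0
  rw [h0, norm_zero] at this
  linarith

/-- The reflection coefficient is of second order at infinity. -/
lemma norm_reflection_le {δ : ℝ} {k : ℂ} (h : |δ| < ‖k‖ ^ 2) :
    ‖(1 - Complex.sqrt (1 + δ / k ^ 2)) / (1 + Complex.sqrt (1 + δ / k ^ 2))‖ ≤
      |δ| / ‖k‖ ^ 2 := by
  set s := Complex.sqrt (1 + δ / k ^ 2) with hs
  have h1 : s * s = 1 + δ / k ^ 2 := sqrt_mul_sqrt_self _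
  have h2 := one_le_norm_one_add_sqrt h
  rw [← hs] at h2
  have h0 := one_add_sqrt_ne_zero h
  rw [← hs] at h0
  have h3 : (1 - s) / (1 + s) = -(δ / k ^ 2) / (1 + s) ^ 2 := by
    rw [div_eq_div_iff h0 (pow_ne_zero 2 h0)]
    linear_combination (-(1 + s)) * h1
  rw [h3, norm_div, norm_neg, norm_div, norm_pow, norm_pow, Complex.norm_real, Real.norm_eq_abs]
  exact div_le_self (by positivity) (one_le_pow₀ h2)

lemma differentiableAt_sqrt_one_add {δ : ℝ} {k : ℂ} (h : |δ| < ‖k‖ ^ 2) :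
    DifferentiableAt ℂ (fun k : ℂ => Complex.sqrt (1 + δ / k ^ 2)) k := by
  have h0 := ne_zero_of_abs_lt h
  have h1 : DifferentiableAt ℂ (fun k : ℂ => 1 + δ / k ^ 2) k :=
    (differentiableAt_const _).add ((differentiableAt_const _).div
      (differentiableAt_id.pow 2) (pow_ne_zero 2 h0))
  exact DifferentiableAt.comp k
    (Complex.differentiableAt_sqrt (one_add_div_mem_slitPlane h)) h1

lemma differentiableAt_shiftedRoot {δ : ℝ} {k : ℂ} (h : |δ| < ‖k‖ ^ 2) :
    DifferentiableAt ℂ (shiftedRoot δ) k :=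
  differentiableAt_id.mul (differentiableAt_sqrt_one_add h)

/-- Composing two branches gives a branch; `k` has to be so large that all the radicands stay
within an angle less than `π / 2` of the positive axis. -/
lemma shiftedRoot_shiftedRoot {δ c : ℝ} {k : ℂ} (hc : 2 * |c| < ‖k‖ ^ 2)
    (hδ : 2 * |δ + c| < ‖k‖ ^ 2) :
    shiftedRoot δ (shiftedRoot c k) = shiftedRoot (δ + c) k := by
  have hc' : |c| < ‖k‖ ^ 2 := by linarith [abs_nonneg c]
  have hδ' : |δ + c| < ‖k‖ ^ 2 := by linarith [abs_nonneg (δ + c)]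
  have h0 := ne_zero_of_abs_lt hc'
  have h1 := shiftedRoot_ne_zero hc'
  refine (eq_shiftedRoot h1 ?_ ?_).symm
  · rw [shiftedRoot_sq h0, shiftedRoot_sq h0]; push_cast; ring
  · -- both quotients by `k` have argument less than `π / 4` in absolute value
    have key : ∀ b : ℝ, 2 * |b| < ‖k‖ ^ 2 →
        |(shiftedRoot b k / k).im| < (shiftedRoot b k / k).re := by
      intro b hb
      have hb' : |b| < ‖k‖ ^ 2 := by linarith [abs_nonneg b]
      have hp := shiftedRoot_div_re_pos hb'
      have hsq : (shiftedRoot b k / k) ^ 2 = 1 + b / k ^ 2 := by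
        rw [div_pow, shiftedRoot_sq h0]; field_simp
      have hre : 0 < (1 + b / k ^ 2).re := one_add_div_re_pos hb'
      rw [← hsq, sq, Complex.mul_re] at hre
      exact abs_lt_of_sq_lt_sq (by nlinarith) hp.le
    have k1 := key c hc
    have k2 := key (δ + c) hδ
    set u := shiftedRoot c k / k
    set v := shiftedRoot (δ + c) k / k
    have huv : shiftedRoot (δ + c) k / shiftedRoot c k = v / u := by
      simp only [u, v]; field_simp
    have hu : u ≠ 0 := div_ne_zero h1 h0
    rw [huv, Complex.div_re, ← add_div]
    refine div_pos ?_ (Complex.normSq_pos.2 hu)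
    rw [abs_lt] at k1 k2
    nlinarith [k1.1, k1.2, k2.1, k2.2]

lemma shiftedRoot_norm_sq_ge {δ : ℝ} {k : ℂ} (hk : k ≠ 0) :
    ‖k‖ ^ 2 - |δ| ≤ ‖shiftedRoot δ k‖ ^ 2 := by
  rw [← norm_pow, ← norm_pow, shiftedRoot_sq hk]
  have := norm_sub_le (k ^ 2 + δ) (δ : ℂ)
  rw [add_sub_cancel_right, Complex.norm_real, Real.norm_eq_abs] at this
  linarith

/-! ### Substitution of the branch in a contour integral -/

/-- The branch `shiftedRoot δ` in the coordinate `log k`. -/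
noncomputable def logShift (δ : ℝ) (z : ℂ) : ℂ :=
  z + Complex.log (1 + δ / Complex.exp z ^ 2) / 2

lemma exp_logShift {δ : ℝ} {z : ℂ} (h : |δ| < ‖Complex.exp z‖ ^ 2) :
    Complex.exp (logShift δ z) = shiftedRoot δ (Complex.exp z) := by
  rw [logShift, Complex.exp_add, shiftedRoot,
    sqrt_eq_exp (Complex.slitPlane_ne_zero (one_add_div_mem_slitPlane h))]

lemma hasDerivAt_logShift {δ : ℝ} {z : ℂ} (h : |δ| < ‖Complex.exp z‖ ^ 2) :
    HasDerivAt (logShift δ) (Complex.exp z ^ 2 / shiftedRoot δ (Complex.exp z) ^ 2) z := by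
  have he := Complex.exp_ne_zero z
  have hs := one_add_div_mem_slitPlane h
  have h1 : HasDerivAt (fun z => 1 + (δ : ℂ) / Complex.exp z ^ 2)
      (-(2 * δ / Complex.exp z ^ 2)) z := by
    have := ((hasDerivAt_const z (δ : ℂ)).div ((Complex.hasDerivAt_exp z).pow 2)
      (pow_ne_zero 2 he)).const_add (1 : ℂ)
    refine this.congr_deriv ?_
    simp only [Pi.pow_apply]
    push_cast
    field_simp
    ring
  have h2 := (hasDerivAt_id z).add ((h1.clog hs).div_const 2)
  have h3 := Complex.slitPlane_ne_zero hs
  have h4 : Complex.exp z ^ 2 + δ ≠ 0 := by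
    have : Complex.exp z ^ 2 + δ = Complex.exp z ^ 2 * (1 + δ / Complex.exp z ^ 2) := by
      field_simp
    rw [this]
    exact mul_ne_zero (pow_ne_zero 2 he) h3
  refine h2.congr_deriv ?_
  rw [shiftedRoot_sq he]
  field_simp
  ring

lemma logShift_of_real {δ r : ℝ} {θ : ℝ} {ε : ℝ} (hr : 0 < r) (h : |δ| < r ^ 2)
    (hθ : Complex.exp (θ * Complex.I) ^ 2 = ε) (hε : |ε| = 1) :
    logShift δ (Real.log r + θ * Complex.I) =
      Real.log √(r ^ 2 + ε * δ) + θ * Complex.I := by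
  have hε2 : ε * ε = 1 := by rw [← abs_mul_abs_self, hε]; norm_num
  have hε0 : ε ≠ 0 := by intro h0; simp [h0] at hε
  have h1 : Complex.exp ((Real.log r : ℂ) + θ * Complex.I) ^ 2 = ((r ^ 2 * ε : ℝ) : ℂ) := by
    rw [Complex.exp_add, mul_pow, hθ, ← Complex.ofReal_exp, Real.exp_log hr]; push_cast; ring
  have h2 : |ε * δ| < r ^ 2 := by rwa [abs_mul, hε, one_mul]
  have h3 : 0 < r ^ 2 + ε * δ := by linarith [(abs_lt.1 h2).1]
  have h4 : (1 : ℝ) + δ / (r ^ 2 * ε) = (r ^ 2 + ε * δ) / r ^ 2 := by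
    field_simp
    linear_combination (-δ) * hε2
  rw [logShift, h1]
  have h5 : (1 : ℂ) + δ / ((r ^ 2 * ε : ℝ) : ℂ) = (((r ^ 2 + ε * δ) / r ^ 2 : ℝ) : ℂ) := by
    rw [← h4]; push_cast; rfl
  rw [h5, ← Complex.ofReal_log (by positivity), Real.log_div h3.ne' (by positivity), Real.log_pow,
    Real.log_sqrt h3.le]
  push_cast
  ring

lemma exp_pi_mul_I_sq (j : ℕ) :
    Complex.exp ((((j : ℕ) * Real.pi / 2 : ℝ) : ℂ) * Complex.I) ^ 2 = ((-1 : ℝ) ^ j : ℝ) := by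
  rw [← Complex.exp_nat_mul]
  have : ((2 : ℕ) : ℂ) * ((((j : ℕ) * Real.pi / 2 : ℝ) : ℂ) * Complex.I) =
      (j : ℕ) * (Real.pi * Complex.I) := by push_cast; ring
  rw [this, Complex.exp_nat_mul, Complex.exp_pi_mul_I]
  push_cast
  rfl

/-- Change of variables `k ↦ shiftedRoot δ k` in a contour integral along the boundary of the third
quadrant. It is exact for truncated integrals, since both sides are the values of one and the same
logarithmic primitive at the same endpoints; the cut-off radii change as the branch maps the two
rays into themselves. -/
lemma truncatedContourIntegral_shiftedRoot {f : ℂ → ℂ} {δ ρ R A B : ℝ} (hρ : 0 < ρ)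
    (hf : DifferentiableOn ℂ f {k | ρ < ‖k‖}) (hR : ρ < R)
    (hRδ : ρ ^ 2 + |δ| < R ^ 2) (hA : R ≤ A) (hB : R ≤ B) :
    truncatedContourIntegral 3 R (fun k => f (shiftedRoot δ k) * (k / shiftedRoot δ k)) A B =
      truncatedContourIntegral 3 R f √(A ^ 2 - δ) √(B ^ 2 + δ) := by
  have hR0 : 0 < R := hρ.trans hR
  have hsmall : ∀ r, R ≤ r → ρ ^ 2 + |δ| < r ^ 2 := fun r hr =>
    hRδ.trans_le (pow_le_pow_left₀ hR0.le hr 2)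
  have hend : ∀ r, R ≤ r → ∀ η : ℝ, |η| = |δ| → ρ < √(r ^ 2 + η) := by
    intro r hr η hη
    apply Real.lt_sqrt_of_sq_lt
    have := hsmall r hr
    have := neg_abs_le η
    linarith
  have hA' := hend A hA (-δ) (abs_neg δ)
  rw [← sub_eq_add_neg] at hA'
  have hB' := hend B hB δ rfl
  obtain ⟨ρ', h1, h2⟩ := exists_between (lt_min (lt_min hR (lt_min hA' hB'))
    (Real.lt_sqrt_of_sq_lt (show ρ ^ 2 < R ^ 2 - |δ| by linarith)))
  simp only [lt_min_iff] at h2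
  obtain ⟨⟨h3, h5, h6⟩, h7⟩ := h2
  have hρ'0 : 0 < ρ' := hρ.trans h1
  have hρ'2 : ρ' ^ 2 < R ^ 2 - |δ| := (Real.lt_sqrt hρ'0.le).1 h7
  set M₀ := max (max (Real.log R) (max (Real.log A) (Real.log B)))
    (max (max (Real.log √(A ^ 2 - δ)) (Real.log √(B ^ 2 + δ))) (4 * Real.pi)) with hM₀
  set M := M₀ + 2 + Real.pi with hM
  have hπ := Real.pi_pos
  obtain ⟨H, hH⟩ := exists_log_primitive hρ h1 hf M
  have hH' : IsLogPrimitive H f ρ' M := hH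
  have hc : ContinuousOn f {k | ρ' ≤ ‖k‖} :=
    hf.continuousOn.mono fun k hk => lt_of_lt_of_le h1 hk
  have hbig : ∀ k : ℂ, R ≤ ‖k‖ → |δ| < ‖k‖ ^ 2 ∧ ρ' < ‖shiftedRoot δ k‖ := by
    intro k hk
    have h8 := hsmall _ hk
    have h9 : |δ| < ‖k‖ ^ 2 := by linarith [sq_nonneg ρ]
    refine ⟨h9, ?_⟩
    have h10 := shiftedRoot_norm_sq_ge (δ := δ) (ne_zero_of_abs_lt h9)
    have h11 : R ^ 2 ≤ ‖k‖ ^ 2 := pow_le_pow_left₀ hR0.le hk 2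
    exact lt_of_pow_lt_pow_left₀ 2 (norm_nonneg _) (by linarith)
  -- the primitive for the substituted integrand
  have hG : IsLogPrimitive (H ∘ logShift δ)
      (fun k => f (shiftedRoot δ k) * (k / shiftedRoot δ k)) R M₀ := by
    intro z hz1 hz2 hz3
    have hn : R ≤ ‖Complex.exp z‖ := by
      rw [Complex.norm_exp]; exact (Real.log_le_iff_le_exp hR0).1 hz1
    obtain ⟨h8, h9⟩ := hbig _ hn
    have hlog := exp_logShift h8
    have hs := one_add_div_mem_slitPlane h8
    have hre : (logShift δ z).re = Real.log ‖shiftedRoot δ (Complex.exp z)‖ := by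
      rw [← hlog, Complex.norm_exp, Real.log_exp]
    have hup : ‖(1 : ℂ) + δ / Complex.exp z ^ 2‖ ≤ 2 := by
      refine (norm_add_le _ _).trans ?_
      have : ‖(δ : ℂ) / Complex.exp z ^ 2‖ ≤ 1 := by
        rw [norm_div, norm_pow, Complex.norm_real, Real.norm_eq_abs]
        exact div_le_one_of_le₀ h8.le (by positivity)
      rw [norm_one]; linarith
    have h10 := hH (logShift δ z)
      (by rw [hre]; exact Real.log_le_log hρ'0 h9.le)
      (by
        rw [logShift, Complex.add_re, Complex.div_ofNat_re, Complex.log_re]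
        have : Real.log ‖(1 : ℂ) + δ / Complex.exp z ^ 2‖ ≤ 1 := by
          have := Real.log_le_sub_one_of_pos (norm_pos_iff.2 (Complex.slitPlane_ne_zero hs))
          linarith
        linarith)
      (by
        rw [logShift, Complex.add_im, Complex.div_ofNat_im, Complex.log_im]
        have h11 := Complex.abs_arg_le_pi (1 + δ / Complex.exp z ^ 2)
        rw [abs_le] at h11 hz3 ⊢
        constructor <;> linarith [h11.1, h11.2, hz3.1, hz3.2])
    have h11 := h10.comp z (hasDerivAt_logShift h8)
    refine h11.congr_deriv ?_
    rw [hlog]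
    have := shiftedRoot_ne_zero h8
    field_simp
  have hcG : ContinuousOn (fun k => f (shiftedRoot δ k) * (k / shiftedRoot δ k))
      {k | R ≤ ‖k‖} := by
    have hcs : ContinuousOn (shiftedRoot δ) {k | R ≤ ‖k‖} := fun k hk =>
      (differentiableAt_shiftedRoot (hbig k hk).1).continuousAt.continuousWithinAt
    refine (hc.comp hcs fun k hk => (hbig k hk).2.le).mul (continuousOn_id.div hcs ?_)
    exact fun k hk => shiftedRoot_ne_zero (hbig k hk).1
  have hj : ((3 : ℕ) + 1 : ℝ) * Real.pi = 4 * Real.pi := by push_cast; ring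
  have le1 : ∀ x, x ≤ M₀ → x ≤ M := fun x hx => by linarith
  rw [hG.truncatedContourIntegral_eq hcG hR0 le_rfl hA hB (by simp [hM₀]) (by simp [hM₀])
      (by simp [hM₀]) (hj.le.trans (by simp [hM₀])),
    hH'.truncatedContourIntegral_eq hc hρ'0 h3.le h5.le h6.le (le1 _ (by simp [hM₀]))
      (le1 _ (by simp [hM₀])) (le1 _ (by simp [hM₀])) (le1 _ (hj.le.trans (by simp [hM₀])))]
  have hδA : |δ| < A ^ 2 := by linarith [hsmall A hA, sq_nonneg ρ]
  have hδB : |δ| < B ^ 2 := by linarith [hsmall B hB, sq_nonneg ρ]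
  have e2 : (((3 : ℕ) - 1 : ℝ) * Real.pi / 2 : ℝ) = (2 : ℕ) * Real.pi / 2 := by push_cast; ring
  simp only [Function.comp_apply]
  rw [e2, logShift_of_real (hR0.trans_le hB) hδB (exp_pi_mul_I_sq 2) (by norm_num),
    logShift_of_real (hR0.trans_le hA) hδA (exp_pi_mul_I_sq 3) (by norm_num)]
  congr 5 <;> ring_nf

/-! ### Interchanging contour integrals with integrals over the data -/

/-- Fubini's theorem for a bounded continuous kernel against an integrable density. -/
lemma integral_swap {S : Set ℝ} (hS : MeasurableSet S) {K : ℝ → ℝ → ℂ} {g : ℝ → ℂ} {a b M : ℝ}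
    (hK : ContinuousOn (Function.uncurry K) (S ×ˢ Set.uIcc a b))
    (hM : ∀ y ∈ S, ∀ u ∈ Set.uIcc a b, ‖K y u‖ ≤ M) (hg : IntegrableOn g S) :
    IntervalIntegrable (fun u => ∫ y in S, K y u * g y) volume a b ∧
    IntegrableOn (fun y => (∫ u in a..b, K y u) * g y) S ∧
    ∫ u in a..b, (∫ y in S, K y u * g y) = ∫ y in S, (∫ u in a..b, K y u) * g y := by
  have hint : Integrable (fun p : ℝ × ℝ => K p.1 p.2 * g p.1)
      ((volume.restrict S).prod (volume.restrict (Set.uIoc a b))) := by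
    have : IsFiniteMeasure (volume.restrict (Set.uIoc a b)) :=
      inferInstanceAs (IsFiniteMeasure (volume.restrict (Set.Ioc _ _)))
    refine Integrable.mono' (g := fun p : ℝ × ℝ => M * ‖g p.1‖) ?_ ?_ ?_
    · exact (hg.norm.comp_fst (volume.restrict (Set.uIoc a b))).const_mul M
    · refine AEStronglyMeasurable.mul ?_ hg.aestronglyMeasurable.comp_fst
      rw [Measure.prod_restrict]
      refine (hK.aestronglyMeasurable (μ := volume.prod volume)
        (hS.prod measurableSet_uIcc)).mono_measure ?_
      exact Measure.restrict_mono (Set.prod_mono le_rfl Set.uIoc_subset_uIcc) le_rfl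
    · rw [Measure.prod_restrict]
      filter_upwards [ae_restrict_mem (hS.prod measurableSet_uIoc)] with p hp
      rw [norm_mul]
      exact mul_le_mul_of_nonneg_right (hM _ hp.1 _ (Set.uIoc_subset_uIcc hp.2)) (norm_nonneg _)
  have hunfold : ∀ y, (∫ u in a..b, K y u) * g y =
      (if a ≤ b then 1 else -1 : ℝ) • ∫ u in Set.uIoc a b, K y u * g y := by
    intro y
    rw [intervalIntegral.intervalIntegral_eq_integral_uIoc, integral_mul_const, smul_mul_assoc]
  refine ⟨?_, ?_, ?_⟩
  · rw [intervalIntegrable_iff]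
    exact hint.integral_prod_right
  · simp_rw [hunfold]
    exact hint.integral_prod_left.smul (if a ≤ b then (1 : ℝ) else -1)
  · simp_rw [hunfold]
    rw [integral_smul, integral_integral_swap hint,
      intervalIntegral.intervalIntegral_eq_integral_uIoc]

/-- The part of the closed third quadrant outside the open disc of radius `ρ`. -/
def thirdQuadrant (ρ : ℝ) : Set ℂ := {k | k.re ≤ 0 ∧ k.im ≤ 0 ∧ ρ ≤ ‖k‖}

lemma circleMap_re_im (r θ : ℝ) :
    (circleMap 0 r θ).re = r * Real.cos θ ∧ (circleMap 0 r θ).im = r * Real.sin θ := by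
  rw [circleMap, zero_add]
  constructor
  · rw [Complex.re_ofReal_mul, Complex.exp_ofReal_mul_I_re]
  · rw [Complex.im_ofReal_mul, Complex.exp_ofReal_mul_I_im]

lemma sin_nonpos_of_lower {θ : ℝ} (h1 : Real.pi ≤ θ) (h2 : θ ≤ 2 * Real.pi) :
    Real.sin θ ≤ 0 := by
  have h := Real.sin_nonneg_of_nonneg_of_le_pi (x := θ - Real.pi) (by linarith) (by linarith)
  rw [Real.sin_sub_pi] at h
  linarith

lemma circleMap_mem_thirdQuadrant {ρ r θ : ℝ} (hρ : 0 ≤ ρ) (hr : ρ ≤ r) (h1 : Real.pi ≤ θ)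
    (h2 : θ ≤ 3 * Real.pi / 2) : circleMap 0 r θ ∈ thirdQuadrant ρ := by
  have hr0 : 0 ≤ r := hρ.trans hr
  refine ⟨?_, ?_, ?_⟩
  · rw [(circleMap_re_im r θ).1]
    exact mul_nonpos_of_nonneg_of_nonpos hr0
      (Real.cos_nonpos_of_pi_div_two_le_of_le (by linarith [Real.pi_pos]) (by linarith))
  · rw [(circleMap_re_im r θ).2]
    exact mul_nonpos_of_nonneg_of_nonpos hr0
      (sin_nonpos_of_lower h1 (by linarith [Real.pi_pos]))
  · rwa [norm_circleMap_zero' hr0]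

/-- A kernel `K y k`, continuous for `y ∈ S` and `k` in the closed third quadrant off a disc, and
bounded for bounded `k`. -/
structure IsContourKernel (S : Set ℝ) (ρ : ℝ) (K : ℝ → ℂ → ℂ) : Prop where
  continuousOn : ContinuousOn (Function.uncurry K) (S ×ˢ thirdQuadrant ρ)
  bounded : ∀ N : ℝ, ∃ M : ℝ, ∀ y ∈ S, ∀ k ∈ thirdQuadrant ρ, ‖k‖ ≤ N → ‖K y k‖ ≤ M

lemma IsContourKernel.mul_path {S : Set ℝ} {ρ : ℝ} {K : ℝ → ℂ → ℂ} (hK : IsContourKernel S ρ K)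
    {γ w : ℝ → ℂ} {a b N : ℝ} (hγ : Continuous γ) (hw : Continuous w)
    (hmem : ∀ u ∈ Set.uIcc a b, γ u ∈ thirdQuadrant ρ ∧ ‖γ u‖ ≤ N) (hwN : ∀ u, ‖w u‖ ≤ N) :
    ContinuousOn (Function.uncurry fun y u => K y (γ u) * w u) (S ×ˢ Set.uIcc a b) ∧
    ∃ M, ∀ y ∈ S, ∀ u ∈ Set.uIcc a b, ‖K y (γ u) * w u‖ ≤ M := by
  constructor
  · refine ContinuousOn.mul ?_ (hw.comp continuous_snd).continuousOn
    refine hK.continuousOn.comp (f := fun p : ℝ × ℝ => (p.1, γ p.2)) (by fun_prop) ?_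
    exact fun p hp => ⟨hp.1, (hmem _ hp.2).1⟩
  · obtain ⟨M, hM⟩ := hK.bounded N
    refine ⟨M * N, fun y hy u hu => ?_⟩
    rw [norm_mul]
    have := hM y hy _ (hmem u hu).1 (hmem u hu).2
    exact mul_le_mul this (hwN u) (norm_nonneg _) ((norm_nonneg _).trans this)

lemma IsContourKernel.truncated_swap {S : Set ℝ} (hS : MeasurableSet S) {ρ R A B : ℝ}
    {K : ℝ → ℂ → ℂ} {g : ℝ → ℂ} (hK : IsContourKernel S ρ K) (hg : IntegrableOn g S)
    (hρ : 0 < ρ) (hR : ρ ≤ R) (hA : ρ ≤ A) (hB : ρ ≤ B) :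
    IntegrableOn (fun y => truncatedContourIntegral 3 R (K y) A B * g y) S ∧
    truncatedContourIntegral 3 R (fun k => ∫ y in S, K y k * g y) A B =
      ∫ y in S, truncatedContourIntegral 3 R (K y) A B * g y := by
  have hπ := Real.pi_pos
  have hrange : ∀ u : ℝ, ∀ a b, ρ ≤ a → ρ ≤ b → u ∈ Set.uIcc a b → ρ ≤ u ∧ u ≤ max a b :=
    fun u a b ha hb hu => ⟨(le_min ha hb).trans hu.1, hu.2⟩
  have hray : ∀ θ : ℝ, Real.pi ≤ θ → θ ≤ 3 * Real.pi / 2 → ∀ b, ρ ≤ b →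
      (IntegrableOn (fun y => (∫ r in R..b, K y (circleMap 0 r θ) *
          Complex.exp (θ * Complex.I)) * g y) S ∧
        ∫ r in R..b, (∫ y in S, K y (circleMap 0 r θ) * g y) * Complex.exp (θ * Complex.I) =
          ∫ y in S, (∫ r in R..b, K y (circleMap 0 r θ) * Complex.exp (θ * Complex.I)) * g y) := by
    intro θ h1 h2 b hb
    obtain ⟨hc, M, hM⟩ := hK.mul_path (γ := fun r => circleMap 0 r θ) (a := R) (b := b)
      (w := fun _ => Complex.exp (θ * Complex.I)) (N := max 1 (max R b))
      (continuous_circleMap_radius θ) continuous_const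
      (fun u hu => by
        obtain ⟨h3, h4⟩ := hrange u R b hR hb hu
        refine ⟨circleMap_mem_thirdQuadrant hρ.le h3 h1 h2, ?_⟩
        rw [norm_circleMap_zero' (hρ.le.trans h3)]
        exact h4.trans (le_max_right _ _))
      (fun u => by rw [Complex.norm_exp_ofReal_mul_I]; exact le_max_left _ _)
    obtain ⟨-, h5, h6⟩ := integral_swap hS hc hM hg
    refine ⟨h5, h6 ▸ ?_⟩
    refine intervalIntegral.integral_congr fun r _ => ?_
    rw [← integral_mul_const]
    congr 1 with y
    ring
  have e2 : (((3 : ℕ) - 1 : ℝ) * Real.pi / 2 : ℝ) = Real.pi := by push_cast; ring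
  have e3 : (((3 : ℕ) : ℝ) * Real.pi / 2 : ℝ) = 3 * Real.pi / 2 := by push_cast; ring
  obtain ⟨i1, s1⟩ := hray (3 * Real.pi / 2) (by linarith) le_rfl A hA
  obtain ⟨i3, s3⟩ := hray Real.pi le_rfl (by linarith) B hB
  obtain ⟨i2, s2⟩ : (IntegrableOn (fun y => (∫ θ in (3 * Real.pi / 2)..Real.pi,
        K y (circleMap 0 R θ) * (circleMap 0 R θ * Complex.I)) * g y) S ∧
      ∫ θ in (3 * Real.pi / 2)..Real.pi, (∫ y in S, K y (circleMap 0 R θ) * g y) *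
        (circleMap 0 R θ * Complex.I) = ∫ y in S, (∫ θ in (3 * Real.pi / 2)..Real.pi,
          K y (circleMap 0 R θ) * (circleMap 0 R θ * Complex.I)) * g y) := by
    obtain ⟨hc, M, hM⟩ := hK.mul_path (γ := circleMap 0 R) (a := 3 * Real.pi / 2) (b := Real.pi)
      (w := fun θ => circleMap 0 R θ * Complex.I) (N := R)
      (continuous_circleMap 0 R) (by fun_prop)
      (fun u hu => by
        rw [Set.uIcc_of_ge (by linarith)] at hu
        refine ⟨circleMap_mem_thirdQuadrant hρ.le hR hu.1 hu.2, ?_⟩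
        rw [norm_circleMap_zero' (hρ.le.trans hR)])
      (fun u => by rw [norm_mul, Complex.norm_I, mul_one, norm_circleMap_zero' (hρ.le.trans hR)])
    obtain ⟨-, h5, h6⟩ := integral_swap hS hc hM hg
    refine ⟨h5, h6 ▸ ?_⟩
    refine intervalIntegral.integral_congr fun r _ => ?_
    rw [← integral_mul_const]
    congr 1 with y
    ring
  unfold truncatedContourIntegral
  rw [e2, e3]
  simp only [add_mul, neg_mul]
  refine ⟨(i1.neg.add i2).add i3, ?_⟩
  rw [s1, s2, s3]
  refine Eq.trans ?_ (integral_add (i1.neg.add i2) i3).symm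
  congr 1
  refine Eq.trans ?_ (integral_add i1.neg i2).symm
  congr 1
  exact (integral_neg _).symm

/-- Dominated convergence for contour integrals of `∫ K y k * g y dy`. -/
lemma IsContourKernel.hasContourIntegral {S : Set ℝ} (hS : MeasurableSet S) {ρ R C : ℝ}
    {K : ℝ → ℂ → ℂ} {g : ℝ → ℂ} {l : ℝ → ℂ} (hK : IsContourKernel S ρ K)
    (hg : IntegrableOn g S) (hρ : 0 < ρ) (hR : ρ ≤ R)
    (hC : ∀ y ∈ S, ∀ A B, R ≤ A → R ≤ B → ‖truncatedContourIntegral 3 R (K y) A B‖ ≤ C)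
    (hl : ∀ y ∈ S, HasContourIntegral 3 R (K y) (l y)) :
    HasContourIntegral 3 R (fun k => ∫ y in S, K y k * g y) (∫ y in S, l y * g y) := by
  have hlarge : ∀ᶠ p : ℝ × ℝ in atTop ×ˢ atTop, R ≤ p.1 ∧ R ≤ p.2 :=
    (eventually_ge_atTop R).prod_mk (eventually_ge_atTop R)
  have key : Tendsto (fun p : ℝ × ℝ => ∫ y in S, truncatedContourIntegral 3 R (K y) p.1 p.2 * g y)
      (atTop ×ˢ atTop) (𝓝 (∫ y in S, l y * g y)) := by
    refine tendsto_integral_filter_of_dominated_convergence (fun y => C * ‖g y‖) ?_ ?_ ?_ ?_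
    · filter_upwards [hlarge] with p hp
      exact (hK.truncated_swap hS hg hρ hR (hR.trans hp.1) (hR.trans hp.2)).1.aestronglyMeasurable
    · filter_upwards [hlarge] with p hp
      filter_upwards [ae_restrict_mem hS] with y hy
      rw [norm_mul]
      exact mul_le_mul_of_nonneg_right (hC y hy _ _ hp.1 hp.2) (norm_nonneg _)
    · exact hg.norm.const_mul C
    · filter_upwards [ae_restrict_mem hS] with y hy
      exact (hl y hy).mul_const _
  refine key.congr' ?_
  filter_upwards [hlarge] with p hp
  exact (hK.truncated_swap hS hg hρ hR (hR.trans hp.1) (hR.trans hp.2)).2.symm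

/-! ### Oscillatory integrals -/

lemma integrableOn_const_div_sq {R : ℝ} (hR : 0 < R) (D : ℝ) :
    IntegrableOn (fun r : ℝ => D / r ^ 2) (Set.Ioi R) ∧
      ∫ r in Set.Ioi R, D / r ^ 2 = D / R := by
  have heq : Set.EqOn (fun r : ℝ => D * r ^ (-2 : ℝ)) (fun r : ℝ => D / r ^ 2) (Set.Ioi R) := by
    intro r hr
    have hr0 : 0 < r := hR.trans hr
    simp only
    rw [Real.rpow_neg hr0.le, div_eq_mul_inv]
    norm_num
  have h : IntegrableOn (fun r : ℝ => D * r ^ (-2 : ℝ)) (Set.Ioi R) :=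
    (integrableOn_Ioi_rpow_of_lt (a := -2) (by norm_num) hR).const_mul D
  refine ⟨h.congr_fun heq measurableSet_Ioi, ?_⟩
  rw [← setIntegral_congr_fun measurableSet_Ioi heq, integral_const_mul,
    integral_Ioi_rpow_of_lt (by norm_num) hR]
  norm_num
  rw [Real.rpow_neg_one, div_eq_mul_inv]

/-- An absolutely convergent improper integral, with its bound. -/
lemma improper_integral_of_bound {f : ℝ → ℂ} {g : ℝ → ℝ} {R : ℝ} (hf : ContinuousOn f (Set.Ici R))
    (hg : IntegrableOn g (Set.Ioi R)) (hb : ∀ r ∈ Set.Ioi R, ‖f r‖ ≤ g r) :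
    Tendsto (fun B => ∫ r in R..B, f r) atTop (𝓝 (∫ r in Set.Ioi R, f r)) ∧
      ∀ B, R ≤ B → ‖∫ r in R..B, f r‖ ≤ ∫ r in Set.Ioi R, g r := by
  constructor
  · refine intervalIntegral_tendsto_integral_Ioi R (hg.mono' ?_ ?_) tendsto_id
    · exact (hf.mono Set.Ioi_subset_Ici_self).aestronglyMeasurable measurableSet_Ioi
    · exact (ae_restrict_mem measurableSet_Ioi).mono hb
  · intro B hB
    rw [intervalIntegral.integral_of_le hB]
    refine (norm_integral_le_of_norm_le (hg.mono_set Set.Ioc_subset_Ioi_self)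
      ((ae_restrict_mem measurableSet_Ioc).mono fun r hr => hb r hr.1)).trans ?_
    refine setIntegral_mono_set hg ?_ (Eventually.of_forall Set.Ioc_subset_Ioi_self)
    filter_upwards [ae_restrict_mem measurableSet_Ioi] with r hr
    exact (norm_nonneg _).trans (hb r hr)

/-- Integration by parts for an improper oscillatory integral: `P'` has a bounded primitive, and the
amplitude `a` varies slowly. -/
lemma oscillatory_integral {a a' P P' : ℝ → ℂ} {R C D D' : ℝ} {l : ℂ} (hR : 0 < R)
    (ha : ∀ r, R ≤ r → HasDerivAt a (a' r) r) (hP : ∀ r, R ≤ r → HasDerivAt P (P' r) r)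
    (ha'c : ContinuousOn a' (Set.Ici R)) (hP'c : ContinuousOn P' (Set.Ici R))
    (hPb : ∀ r, R ≤ r → ‖P r‖ ≤ C) (hab : ∀ r, R ≤ r → ‖a r‖ ≤ D')
    (ha'b : ∀ r, R ≤ r → ‖a' r‖ ≤ D / r ^ 2)
    (hlim : Tendsto (fun r => a r * P r) atTop (𝓝 l)) :
    (∃ l', Tendsto (fun B => ∫ r in R..B, a r * P' r) atTop (𝓝 l')) ∧
      ∀ B, R ≤ B → ‖∫ r in R..B, a r * P' r‖ ≤ 2 * (D' * C) + D * C / R := by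
  have hC : 0 ≤ C := (norm_nonneg _).trans (hPb R le_rfl)
  have hD' : 0 ≤ D' := (norm_nonneg _).trans (hab R le_rfl)
  have hparts : ∀ B, R ≤ B → ∫ r in R..B, a r * P' r =
      a B * P B - a R * P R - ∫ r in R..B, a' r * P r := by
    intro B hB
    have hsub : Set.uIcc R B ⊆ Set.Ici R := by
      rw [Set.uIcc_of_le hB]; exact Set.Icc_subset_Ici_self
    exact intervalIntegral.integral_mul_deriv_eq_deriv_mul (fun r hr => ha r (hsub hr))
      (fun r hr => hP r (hsub hr)) (ha'c.mono hsub).intervalIntegrable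
      (hP'c.mono hsub).intervalIntegrable
  have hPc : ContinuousOn P (Set.Ici R) := fun r hr => (hP r hr).continuousAt.continuousWithinAt
  have hb : ∀ r ∈ Set.Ioi R, ‖a' r * P r‖ ≤ D * C / r ^ 2 := by
    intro r hr
    have hr' : R ≤ r := le_of_lt hr
    rw [norm_mul, mul_div_right_comm]
    exact mul_le_mul (ha'b r hr') (hPb r hr') (norm_nonneg _)
      ((norm_nonneg _).trans (ha'b r hr'))
  obtain ⟨hpow, hpowval⟩ := integrableOn_const_div_sq hR (D * C)
  obtain ⟨hconv, hbound⟩ := improper_integral_of_bound (f := fun r => a' r * P r)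
    (ha'c.mul hPc) hpow hb
  constructor
  · refine ⟨l - a R * P R - ∫ r in Set.Ioi R, a' r * P r, ?_⟩
    refine Tendsto.congr' ?_ ((hlim.sub_const _).sub hconv)
    filter_upwards [eventually_ge_atTop R] with B hB
    exact (hparts B hB).symm
  · intro B hB
    rw [hparts B hB]
    have h1 := hbound B hB
    rw [hpowval] at h1
    have h2 : ∀ r, R ≤ r → ‖a r * P r‖ ≤ D' * C := fun r hr => by
      rw [norm_mul]; exact mul_le_mul (hab r hr) (hPb r hr) (norm_nonneg _) hD'
    have h3 := norm_sub_le (a B * P B - a R * P R) (∫ r in R..B, a' r * P r)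
    have h4 := norm_sub_le (a B * P B) (a R * P R)
    linarith [h2 B hB, h2 R le_rfl]

/-- The Fresnel-type primitive `∫_0^r e^{i (z ρ - t ρ²)} dρ`. -/
noncomputable def fresnel (t z r : ℝ) : ℂ :=
  ∫ ρ in (0 : ℝ)..r, Complex.exp (Complex.I * (z * ρ - t * ρ ^ 2 : ℝ))

lemma hasDerivAt_fresnel (t z r : ℝ) :
    HasDerivAt (fresnel t z) (Complex.exp (Complex.I * (z * r - t * r ^ 2 : ℝ))) r := by
  refine intervalIntegral.integral_hasDerivAt_right ?_ ?_ ?_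
  · exact Continuous.intervalIntegrable (by fun_prop) _ _
  · exact Continuous.stronglyMeasurableAtFilter (by fun_prop) _ _
  · exact Continuous.continuousAt (by fun_prop)

lemma norm_exp_I_mul_real (x : ℝ) : ‖Complex.exp (Complex.I * x)‖ = 1 := by
  rw [mul_comm, Complex.norm_exp_ofReal_mul_I]

lemma fresnel_zero_neg (t r : ℝ) : fresnel t 0 (-r) = -fresnel t 0 r := by
  unfold fresnel
  have h := intervalIntegral.integral_comp_neg (a := 0) (b := r)
    (fun ρ : ℝ => Complex.exp (Complex.I * ((0 * ρ - t * ρ ^ 2 : ℝ) : ℂ)))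
  rw [neg_zero] at h
  rw [intervalIntegral.integral_symm, ← h]
  congr 1
  refine intervalIntegral.integral_congr fun ρ _ => ?_
  simp

lemma fresnel_zero_tendsto {t : ℝ} (ht : 0 < t) : ∃ l, Tendsto (fresnel t 0) atTop (𝓝 l) := by
  have ht' : (t : ℂ) ≠ 0 := by exact_mod_cast ht.ne'
  have hP : ∀ r : ℝ, HasDerivAt
      (fun r : ℝ => Complex.exp (Complex.I * (0 * r - t * r ^ 2 : ℝ)) / (-(2 * Complex.I * t)))
      (r * Complex.exp (Complex.I * (0 * r - t * r ^ 2 : ℝ))) r := by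
    intro r
    have h1 : HasDerivAt (fun r : ℝ => 0 * r - t * r ^ 2) (-(2 * t * r)) r := by
      have := ((hasDerivAt_id r).const_mul 0).sub (((hasDerivAt_id r).pow 2).const_mul t)
      refine this.congr_deriv ?_
      simp; ring
    have h2 := ((h1.ofReal_comp.const_mul Complex.I).cexp).div_const (-(2 * Complex.I * t))
    refine h2.congr_deriv ?_
    push_cast
    field_simp [Complex.I_ne_zero]
  have hinv : ∀ r : ℝ, 1 ≤ r → HasDerivAt (fun r : ℝ => ((r⁻¹ : ℝ) : ℂ))
      ((-(r ^ 2)⁻¹ : ℝ) : ℂ) r := fun r hr =>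
    (hasDerivAt_inv (by linarith)).ofReal_comp
  have hPb : ∀ r : ℝ, ‖Complex.exp (Complex.I * (0 * r - t * r ^ 2 : ℝ)) /
      (-(2 * Complex.I * t))‖ = 1 / (2 * t) := by
    intro r
    rw [norm_div, norm_exp_I_mul_real]
    simp [abs_of_pos ht]
  obtain ⟨⟨l', hl'⟩, -⟩ := oscillatory_integral (R := 1) (C := 1 / (2 * t)) (D := 1) (D' := 1)
    (l := 0) one_pos hinv (fun r _ => hP r)
    (by
      refine Complex.continuous_ofReal.comp_continuousOn ?_
      refine ContinuousOn.neg (ContinuousOn.inv₀ (by fun_prop) ?_)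
      intro r hr
      have : (1 : ℝ) ≤ r := hr
      positivity)
    (by fun_prop) (fun r _ => (hPb r).le)
    (fun r hr => by
      rw [Complex.norm_real, Real.norm_eq_abs, abs_of_nonneg (by positivity)]
      exact inv_le_one_of_one_le₀ hr)
    (fun r hr => by
      rw [Complex.norm_real, Real.norm_eq_abs, abs_neg, abs_of_nonneg (by positivity), one_div])
    (by
      refine squeeze_zero_norm (a := fun r : ℝ => |r⁻¹| * (1 / (2 * t))) (fun r => ?_) ?_
      · rw [norm_mul, hPb, Complex.norm_real, Real.norm_eq_abs]
      · have := (tendsto_inv_atTop_zero (𝕜 := ℝ)).abs.mul_const (1 / (2 * t))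
        simpa using this)
  refine ⟨fresnel t 0 1 + l', (hl'.const_add _).congr' ?_⟩
  filter_upwards [eventually_ge_atTop 1] with B hB
  unfold fresnel
  rw [← intervalIntegral.integral_add_adjacent_intervals (b := 1) (c := B)
    (f := fun ρ : ℝ => Complex.exp (Complex.I * ((0 * ρ - t * ρ ^ 2 : ℝ) : ℂ)))
    (Continuous.intervalIntegrable (by fun_prop) _ _)
    (Continuous.intervalIntegrable (by fun_prop) _ _)]
  congr 1
  refine intervalIntegral.integral_congr fun r hr => ?_
  rw [Set.uIcc_of_le hB] at hr
  have : (r : ℂ) ≠ 0 := by exact_mod_cast (by linarith [hr.1] : r ≠ 0)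
  rw [← mul_assoc, Complex.ofReal_inv, inv_mul_cancel₀ this, one_mul]

lemma fresnel_zero_bounded {t : ℝ} (ht : 0 < t) : ∃ C, ∀ r, ‖fresnel t 0 r‖ ≤ C := by
  obtain ⟨l, hl⟩ := fresnel_zero_tendsto ht
  have hcont : Continuous (fresnel t 0) :=
    continuous_iff_continuousAt.2 fun r => (hasDerivAt_fresnel t 0 r).continuousAt
  have h1 : ∀ᶠ r in atTop, ‖fresnel t 0 r‖ < ‖l‖ + 1 :=
    hl.norm.eventually (gt_mem_nhds (lt_add_one _))
  obtain ⟨N, hN⟩ := eventually_atTop.1 h1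
  obtain ⟨C, hC⟩ := (isCompact_Icc (a := 0) (b := N)).exists_bound_of_continuousOn
    hcont.continuousOn
  have hpos : ∀ r, 0 ≤ r → ‖fresnel t 0 r‖ ≤ max C (‖l‖ + 1) := by
    intro r hr
    rcases le_total r N with h | h
    · exact (hC r ⟨hr, h⟩).trans (le_max_left _ _)
    · exact (hN r h).le.trans (le_max_right _ _)
  refine ⟨max C (‖l‖ + 1), fun r => ?_⟩
  rcases le_total 0 r with h | h
  · exact hpos r h
  · have := hpos (-r) (by linarith)
    rwa [fresnel_zero_neg, norm_neg] at this

/-- Completing the square. -/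
lemma fresnel_eq {t : ℝ} (ht : 0 < t) (z r : ℝ) :
    fresnel t z r = Complex.exp (Complex.I * (z ^ 2 / (4 * t) : ℝ)) *
      (fresnel t 0 (r - z / (2 * t)) - fresnel t 0 (-(z / (2 * t)))) := by
  set c := z / (2 * t) with hc
  have hz : z = 2 * t * c := by rw [hc]; field_simp
  have hz2 : z ^ 2 / (4 * t) = t * c ^ 2 := by rw [hz]; field_simp; ring
  unfold fresnel
  rw [intervalIntegral.integral_interval_sub_left
    (Continuous.intervalIntegrable (by fun_prop) _ _)
    (Continuous.intervalIntegrable (by fun_prop) _ _), ← intervalIntegral.integral_const_mul,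
    ← zero_sub c, ← intervalIntegral.integral_comp_sub_right]
  refine intervalIntegral.integral_congr fun ρ _ => ?_
  rw [← Complex.exp_add, hz2, hz]
  congr 1
  push_cast
  ring

/-- The Fresnel primitives are bounded, uniformly in the linear part of the phase. -/
lemma fresnel_bounded {t : ℝ} (ht : 0 < t) : ∃ C, ∀ z r, ‖fresnel t z r‖ ≤ C := by
  obtain ⟨C, hC⟩ := fresnel_zero_bounded ht
  refine ⟨C + C, fun z r => ?_⟩
  rw [fresnel_eq ht, norm_mul, norm_exp_I_mul_real, one_mul]
  exact (norm_sub_le _ _).trans (add_le_add (hC _) (hC _))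

lemma fresnel_tendsto_atTop {t : ℝ} (ht : 0 < t) (z : ℝ) :
    ∃ l, Tendsto (fresnel t z) atTop (𝓝 l) := by
  obtain ⟨l, hl⟩ := fresnel_zero_tendsto ht
  refine ⟨_, Tendsto.congr (fun r => (fresnel_eq ht z r).symm)
    (((hl.comp (tendsto_atTop_add_const_right atTop (-(z / (2 * t))) tendsto_id)).sub_const
      _).const_mul _)⟩

lemma fresnel_neg (t z r : ℝ) : fresnel t z (-r) = -fresnel t (-z) r := by
  unfold fresnel
  have h := intervalIntegral.integral_comp_neg (a := 0) (b := r)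
    (fun ρ : ℝ => Complex.exp (Complex.I * ((z * ρ - t * ρ ^ 2 : ℝ) : ℂ)))
  rw [neg_zero] at h
  rw [intervalIntegral.integral_symm, ← h]
  congr 1
  refine intervalIntegral.integral_congr fun ρ _ => ?_
  simp

lemma fresnel_tendsto_atBot {t : ℝ} (ht : 0 < t) (z : ℝ) :
    ∃ l, Tendsto (fresnel t z) atBot (𝓝 l) := by
  obtain ⟨l, hl⟩ := fresnel_tendsto_atTop ht (-z)
  refine ⟨-l, ((hl.comp tendsto_neg_atBot_atTop).neg).congr fun r => ?_⟩
  rw [Function.comp_apply, ← fresnel_neg, neg_neg]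

/-! ### Half-line Fourier transforms -/

lemma norm_exp_neg_I_mul (k : ℂ) (x : ℝ) :
    ‖Complex.exp (-Complex.I * k * x)‖ = Real.exp (k.im * x) := by
  rw [Complex.norm_exp]
  simp

lemma norm_exp_neg_I_mul_le {k : ℂ} (hk : 0 ≤ k.im) {x : ℝ} (hx : x ≤ 0) :
    ‖Complex.exp (-Complex.I * k * x)‖ ≤ 1 := by
  rw [norm_exp_neg_I_mul, Real.exp_le_one_iff]
  exact mul_nonpos_of_nonneg_of_nonpos hk hx

lemma integrableOn_exp_mul {f : ℝ → ℂ} (hf : IntegrableOn f (Set.Iio 0)) {k : ℂ} (hk : 0 ≤ k.im) :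
    IntegrableOn (fun x : ℝ => Complex.exp (-Complex.I * k * x) * f x) (Set.Iio 0) := by
  refine hf.norm.mono' (AEStronglyMeasurable.mul ?_ hf.aestronglyMeasurable) ?_
  · exact Continuous.aestronglyMeasurable (by fun_prop)
  · filter_upwards [ae_restrict_mem measurableSet_Iio] with x hx
    rw [norm_mul]
    exact mul_le_of_le_one_left (norm_nonneg _) (norm_exp_neg_I_mul_le hk (le_of_lt hx))

lemma fourierPos_eq_fourierNeg (f : ℝ → ℂ) (k : ℂ) :
    fourierPos f k = fourierNeg (fun x => f (-x)) (-k) := by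
  unfold fourierPos fourierNeg
  rw [← integral_Iic_eq_integral_Iio, ← neg_zero, ← integral_comp_neg_Ioi, neg_zero]
  refine setIntegral_congr_fun measurableSet_Ioi fun x _ => ?_
  simp

lemma fourierNeg_eq_fourierPos (f : ℝ → ℂ) (k : ℂ) :
    fourierNeg f k = fourierPos (fun x => f (-x)) (-k) := by
  rw [fourierPos_eq_fourierNeg]; simp

/-- The half-line transform of an integrable function with integrable derivative is `O(1 / |k|)`,
by an integration by parts. -/
lemma norm_mul_fourierNeg_le {f : ℝ → ℂ} (hf : Integrable f) (hd : Differentiable ℝ f)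
    (hf' : Integrable (deriv f)) {k : ℂ} (hk : 0 ≤ k.im) :
    ‖k‖ * ‖fourierNeg f k‖ ≤ ‖f 0‖ + ∫ x, ‖deriv f x‖ := by
  set F : ℝ → ℂ := fun x => Complex.exp (-Complex.I * k * x) * f x with hF
  have hderiv : ∀ x : ℝ, HasDerivAt F (-Complex.I * k * F x +
      Complex.exp (-Complex.I * k * x) * deriv f x) x := by
    intro x
    have h1 : HasDerivAt (fun x : ℝ => Complex.exp (-Complex.I * k * x))
        (Complex.exp (-Complex.I * k * x) * (-Complex.I * k)) x := by
      simpa using ((hasDerivAt_id x).ofReal_comp.const_mul (-Complex.I * k)).cexp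
    refine (h1.mul (hd x).hasDerivAt).congr_deriv ?_
    simp only [hF]; ring
  have i1 : IntegrableOn F (Set.Iic 0) := by
    rw [integrableOn_Iic_iff_integrableOn_Iio]
    exact integrableOn_exp_mul hf.integrableOn hk
  have i2 : IntegrableOn (fun x : ℝ => Complex.exp (-Complex.I * k * x) * deriv f x)
      (Set.Iic 0) := by
    rw [integrableOn_Iic_iff_integrableOn_Iio]
    exact integrableOn_exp_mul hf'.integrableOn hk
  have i3 := (i1.const_mul (-Complex.I * k)).add i2
  have hlim := tendsto_zero_of_hasDerivAt_of_integrableOn_Iic (fun x _ => hderiv x) i3 i1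
  have h := integral_Iic_of_hasDerivAt_of_tendsto' (a := 0) (fun x _ => hderiv x) i3 hlim
  have h2 : fourierNeg f k = ∫ x in Set.Iic 0, F x := integral_Iic_eq_integral_Iio.symm
  have h3 := integral_add (i1.const_mul (-Complex.I * k)) i2
  rw [h3, integral_const_mul, ← h2, sub_zero] at h
  have h4 : F 0 = f 0 := by simp [hF]
  rw [h4] at h
  have h5 : ‖∫ x : ℝ in Set.Iic 0, Complex.exp (-Complex.I * k * x) * deriv f x‖ ≤
      ∫ x, ‖deriv f x‖ := by
    refine (norm_integral_le_of_norm_le hf'.norm.integrableOn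
      ((ae_restrict_mem measurableSet_Iic).mono fun x hx => ?_)).trans
      (setIntegral_le_integral hf'.norm (Eventually.of_forall fun x => norm_nonneg _))
    rw [norm_mul]
    exact mul_le_of_le_one_left (norm_nonneg _) (norm_exp_neg_I_mul_le hk hx)
  have h6 : ‖k‖ * ‖fourierNeg f k‖ = ‖-Complex.I * k * fourierNeg f k‖ := by simp
  rw [h6, eq_sub_of_add_eq h]
  exact (norm_sub_le _ _).trans (by linarith)

lemma norm_mul_fourierPos_le {f : ℝ → ℂ} (hf : Integrable f) (hd : Differentiable ℝ f)
    (hf' : Integrable (deriv f)) {k : ℂ} (hk : k.im ≤ 0) :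
    ‖k‖ * ‖fourierPos f k‖ ≤ ‖f 0‖ + ∫ x, ‖deriv f x‖ := by
  have hder : deriv (fun x => f (-x)) = fun x => -deriv f (-x) := by
    ext x; exact deriv_comp_neg f x
  have h := norm_mul_fourierNeg_le (f := fun x => f (-x)) hf.comp_neg
    (hd.comp differentiable_neg) (by rw [hder]; exact hf'.comp_neg.neg)
    (k := -k) (by simpa using hk)
  rw [← fourierPos_eq_fourierNeg, norm_neg, hder, neg_zero] at h
  simpa [integral_neg_eq_self (fun x => ‖deriv f x‖)] using h

lemma continuousOn_fourierNeg {f : ℝ → ℂ} (hf : IntegrableOn f (Set.Iio 0)) :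
    ContinuousOn (fourierNeg f) {k | 0 ≤ k.im} := by
  refine continuousOn_of_dominated (bound := fun x => ‖f x‖) ?_ ?_ hf.norm ?_
  · exact fun k hk => (integrableOn_exp_mul hf hk).aestronglyMeasurable
  · intro k hk
    filter_upwards [ae_restrict_mem measurableSet_Iio] with x hx
    rw [norm_mul]
    exact mul_le_of_le_one_left (norm_nonneg _) (norm_exp_neg_I_mul_le hk (le_of_lt hx))
  · exact Eventually.of_forall fun x => Continuous.continuousOn (by fun_prop)

lemma continuousOn_fourierPos {f : ℝ → ℂ} (hf : IntegrableOn f (Set.Ioi 0)) :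
    ContinuousOn (fourierPos f) {k | k.im ≤ 0} := by
  have h1 : IntegrableOn (fun x => f (-x)) (Set.Iio 0) := by
    refine IntegrableOn.comp_neg_Iio (c := 0) ?_
    rwa [neg_zero]
  have h2 := (continuousOn_fourierNeg h1).comp (s := {k : ℂ | k.im ≤ 0}) (f := fun k => -k)
    continuous_neg.continuousOn (fun k hk => by simpa using hk)
  exact h2.congr fun k _ => fourierPos_eq_fourierNeg f k

/-! ### Fourier inversion at a point of differentiability -/

lemma norm_exp_neg_I_mul_real (k u : ℝ) : ‖Complex.exp (-Complex.I * k * u)‖ = 1 := by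
  rw [norm_exp_neg_I_mul]; simp

lemma integrable_exp_mul {f : ℝ → ℂ} (hf : Integrable f) (k : ℝ) :
    Integrable fun u : ℝ => Complex.exp (-Complex.I * k * u) * f u := by
  refine hf.norm.mono' (AEStronglyMeasurable.mul
    (Continuous.aestronglyMeasurable (by fun_prop)) hf.aestronglyMeasurable) ?_
  refine Eventually.of_forall fun u => ?_
  rw [norm_mul, norm_exp_neg_I_mul_real, one_mul]

lemma continuous_fourier {f : ℝ → ℂ} (hf : Integrable f) :
    Continuous fun k : ℝ => ∫ u : ℝ, Complex.exp (-Complex.I * k * u) * f u := by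
  refine continuous_of_dominated (bound := fun u => ‖f u‖) ?_ ?_ hf.norm ?_
  · exact fun k => (integrable_exp_mul hf k).aestronglyMeasurable
  · refine fun k => Eventually.of_forall fun u => ?_
    rw [norm_mul, norm_exp_neg_I_mul_real, one_mul]
  · exact Eventually.of_forall fun u => by fun_prop

/-- The Riemann–Lebesgue lemma. -/
lemma riemannLebesgue (q : ℝ → ℂ) :
    Tendsto (fun k : ℝ => ∫ u : ℝ, Complex.exp (-Complex.I * k * u) * q u) (cocompact ℝ) (𝓝 0) := by
  have h := Real.tendsto_integral_exp_smul_cocompact q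
  have h2 : Tendsto (fun k : ℝ => (2 * Real.pi)⁻¹ * k) (cocompact ℝ) (cocompact ℝ) :=
    (Homeomorph.mulLeft₀ (2 * Real.pi)⁻¹ (by positivity)).isClosedEmbedding.tendsto_cocompact
  refine (h.comp h2).congr fun k => ?_
  refine integral_congr_ae (Eventually.of_forall fun u => ?_)
  have hπ : (Real.pi : ℂ) ≠ 0 := by exact_mod_cast Real.pi_ne_zero
  simp only [Circle.smul_def, Real.fourierChar_apply, smul_eq_mul]
  congr 2
  push_cast
  field_simp

/-- If `w` vanishes at `0` and is differentiable there, the symmetric integrals of its Fourier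
transform tend to `0`: with `w = u q`, they are boundary values of the transform of `q`. -/
lemma tendsto_integral_fourier_of_zero {w : ℝ → ℂ} (hw : Integrable w) (h0 : w 0 = 0)
    (hd : DifferentiableAt ℝ w 0) :
    Tendsto (fun r : ℝ => ∫ k in -r..r, ∫ u : ℝ, Complex.exp (-Complex.I * k * u) * w u)
      atTop (𝓝 0) := by
  set q : ℝ → ℂ := fun u => (u : ℂ)⁻¹ * w u with hq
  have hwq : ∀ u : ℝ, (u : ℂ) * q u = w u := by
    intro u
    rcases eq_or_ne u 0 with rfl | hu
    · simp [h0]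
    · have : (u : ℂ) ≠ 0 := by exact_mod_cast hu
      simp only [hq]; field_simp
  -- near `0` the quotient is bounded by differentiability of `w`, elsewhere by a multiple of `w`
  have hqi : Integrable q := by
    obtain ⟨C, hC⟩ := (hd.isBigO_sub).bound
    obtain ⟨δ, hδ, hball⟩ := Metric.eventually_nhds_iff.1 hC
    simp only [h0, sub_zero, dist_zero_right] at hball
    have hC0 : 0 ≤ |C| := abs_nonneg C
    refine Integrable.mono' (g := fun u => (Set.Icc (-δ) δ).indicator (fun _ => |C|) u +
      δ⁻¹ * ‖w u‖) ?_ ?_ ?_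
    · exact ((integrable_indicator_iff measurableSet_Icc).2
        (integrableOn_const (by simp))).add (hw.norm.const_mul _)
    · exact AEStronglyMeasurable.mul
        (Complex.measurable_ofReal.inv.aestronglyMeasurable) hw.aestronglyMeasurable
    · refine Eventually.of_forall fun u => ?_
      have hn : ‖q u‖ = |u|⁻¹ * ‖w u‖ := by
        simp [hq]
      rw [hn]
      by_cases hu : |u| < δ
      · have hmem : u ∈ Set.Icc (-δ) δ := ⟨(abs_lt.1 hu).1.le, (abs_lt.1 hu).2.le⟩
        rw [Set.indicator_of_mem hmem]
        have h1 : ‖w u‖ ≤ |C| * |u| := (hball (by simpa using hu)).trans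
          (mul_le_mul_of_nonneg_right (le_abs_self C) (norm_nonneg _))
        have h2 : |u|⁻¹ * ‖w u‖ ≤ |C| := by
          rcases eq_or_ne u 0 with rfl | hu0
          · simp
          · rw [inv_mul_le_iff₀ (abs_pos.2 hu0), mul_comm]; exact h1
        have h3 : 0 ≤ δ⁻¹ * ‖w u‖ := by positivity
        linarith
      · have h1 : |u|⁻¹ ≤ δ⁻¹ := inv_anti₀ hδ (not_lt.1 hu)
        have h2 : 0 ≤ (Set.Icc (-δ) δ).indicator (fun _ => |C|) u :=
          Set.indicator_nonneg (fun _ _ => hC0) _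
        have := mul_le_mul_of_nonneg_right h1 (norm_nonneg (w u))
        linarith
  -- `i` times the transform of `q` is a primitive of the transform of `w = u q`
  have hQ : ∀ k : ℝ, HasDerivAt (fun k : ℝ => Complex.I *
      ∫ u : ℝ, Complex.exp (-Complex.I * k * u) * q u)
      (∫ u : ℝ, Complex.exp (-Complex.I * k * u) * w u) k := by
    intro k
    have h := (hasDerivAt_integral_of_dominated_loc_of_deriv_le (μ := volume)
      (F := fun (k : ℝ) (u : ℝ) => Complex.exp (-Complex.I * k * u) * q u)
      (F' := fun (k : ℝ) (u : ℝ) => -Complex.I * (Complex.exp (-Complex.I * k * u) * w u))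
      (x₀ := k) (s := Set.univ) (bound := fun u => ‖w u‖) univ_mem
      (Eventually.of_forall fun k => (integrable_exp_mul hqi k).aestronglyMeasurable)
      (integrable_exp_mul hqi k)
      ((integrable_exp_mul hw k).const_mul _).aestronglyMeasurable
      (Eventually.of_forall fun u k _ => by
        rw [norm_mul, norm_mul, norm_exp_neg_I_mul_real]; simp)
      hw.norm
      (Eventually.of_forall fun u k _ => by
        have h1 : HasDerivAt (fun k : ℝ => Complex.exp (-Complex.I * k * u))
            (Complex.exp (-Complex.I * k * u) * (-Complex.I * u)) k := by
          have := (((hasDerivAt_id k).ofReal_comp.const_mul (-Complex.I)).mul_const (u : ℂ)).cexp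
          simpa using this
        refine (h1.mul_const (q u)).congr_deriv ?_
        rw [← hwq u]; ring)).2
    refine (h.const_mul Complex.I).congr_deriv ?_
    rw [integral_const_mul, ← mul_assoc]
    simp
  have hR := (riemannLebesgue q).const_mul Complex.I
  rw [mul_zero, cocompact_eq_atBot_atTop, tendsto_sup] at hR
  have h := (hR.2.sub (hR.1.comp tendsto_neg_atTop_atBot))
  rw [sub_zero] at h
  refine h.congr fun r => ?_
  rw [intervalIntegral.integral_eq_sub_of_hasDerivAt (fun k _ => hQ k)
    ((continuous_fourier hw).intervalIntegrable _ _)]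
  simp

lemma tendsto_integral_fourier_gaussian :
    Tendsto (fun r : ℝ => ∫ k in -r..r, ∫ u : ℝ,
      Complex.exp (-Complex.I * k * u) * Complex.exp (-(u : ℂ) ^ 2)) atTop
      (𝓝 (2 * Real.pi)) := by
  have h1 : ∀ k : ℝ, ∫ u : ℝ, Complex.exp (-Complex.I * k * u) * Complex.exp (-(u : ℂ) ^ 2) =
      (Real.pi : ℂ) ^ (1 / 2 : ℂ) * Complex.exp (-(1 / 4 : ℂ) * (k : ℂ) ^ 2) := by
    intro k
    have := fourierIntegral_gaussian (b := 1) (by norm_num) (-k)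
    rw [div_one] at this
    convert this using 2
    · ext u; congr 2 <;> ring
    · congr 1; ring
  simp_rw [h1]
  have h2 := (integrable_cexp_neg_mul_sq (b := 1 / 4) (by norm_num)).const_mul
    ((Real.pi : ℂ) ^ (1 / 2 : ℂ))
  have h3 := intervalIntegral_tendsto_integral h2 tendsto_neg_atTop_atBot tendsto_id
  rw [integral_const_mul, integral_gaussian_complex (by norm_num)] at h3
  have h4 : (Real.pi : ℂ) / (1 / 4) = ((4 * Real.pi : ℝ) : ℂ) := by push_cast; ring
  have h5 : ∀ x : ℝ, 0 ≤ x → (x : ℂ) ^ (1 / 2 : ℂ) = (√x : ℝ) := by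
    intro x hx
    rw [Real.sqrt_eq_rpow, Complex.ofReal_cpow hx]; norm_num
  have h6 : (Real.pi : ℂ) ^ (1 / 2 : ℂ) * ((Real.pi : ℂ) / (1 / 4)) ^ (1 / 2 : ℂ) =
      2 * Real.pi := by
    rw [h4, h5 _ Real.pi_pos.le, h5 _ (by positivity), ← Complex.ofReal_mul,
      Real.sqrt_mul (by norm_num), mul_left_comm, Real.mul_self_sqrt Real.pi_pos.le,
      show (4 : ℝ) = 2 ^ 2 by norm_num, Real.sqrt_sq (by norm_num)]
    push_cast; rfl
  rw [h6] at h3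
  exact h3

/-- Fourier inversion at a point of differentiability: subtracting a multiple of a Gaussian, for
which inversion is explicit, reduces it to the case of a function vanishing at the point. -/
lemma tendsto_integral_fourier {h : ℝ → ℂ} (hh : Integrable h) (hd : DifferentiableAt ℝ h 0) :
    Tendsto (fun r : ℝ => ∫ k in -r..r, ∫ u : ℝ, Complex.exp (-Complex.I * k * u) * h u)
      atTop (𝓝 (2 * Real.pi * h 0)) := by
  have hgi : Integrable fun u : ℝ => Complex.exp (-(u : ℂ) ^ 2) := by
    simpa using integrable_cexp_neg_mul_sq (b := 1) (by norm_num)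
  have hgd : DifferentiableAt ℝ (fun u : ℝ => Complex.exp (-(u : ℂ) ^ 2)) 0 := by
    have : Differentiable ℝ fun u : ℝ => (u : ℂ) := Complex.ofRealCLM.differentiable
    exact ((this.pow 2).neg.cexp) 0
  have hw : Integrable fun u : ℝ => h u - h 0 * Complex.exp (-(u : ℂ) ^ 2) :=
    hh.sub (hgi.const_mul _)
  have h1 := tendsto_integral_fourier_of_zero hw (by simp) (hd.sub (hgd.const_mul _))
  have h2 := h1.add (tendsto_integral_fourier_gaussian.const_mul (h 0))
  rw [zero_add, mul_comm] at h2
  refine h2.congr fun r => ?_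
  rw [← intervalIntegral.integral_const_mul, ← intervalIntegral.integral_add
    ((continuous_fourier hw).intervalIntegrable _ _)
    (((continuous_fourier hgi).const_mul (h 0)).intervalIntegrable _ _)]
  refine intervalIntegral.integral_congr fun k _ => ?_
  rw [← integral_const_mul, ← integral_add (integrable_exp_mul hw k)
    ((integrable_exp_mul hgi k).const_mul _)]
  refine integral_congr_ae (Eventually.of_forall fun u => ?_)
  ring

/-- Inversion of the transform on the left half-line. -/
lemma tendsto_integral_fourierNeg {f : ℝ → ℂ} (hf : Integrable f) {x : ℝ} (hx : x < 0)
    (hd : DifferentiableAt ℝ f x) :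
    Tendsto (fun r : ℝ => ∫ k in -r..r, Complex.exp (Complex.I * k * x) * fourierNeg f k)
      atTop (𝓝 (2 * Real.pi * f x)) := by
  set h : ℝ → ℂ := fun u => (Set.Iio 0).indicator f (u + x) with hh
  have hind : Integrable ((Set.Iio 0).indicator f) :=
    (integrable_indicator_iff measurableSet_Iio).2 hf.integrableOn
  have h1 : Integrable h := hind.comp_add_right x
  have h2 : DifferentiableAt ℝ h 0 := by
    have h3 : DifferentiableAt ℝ (fun u => f (u + x)) 0 := by
      refine DifferentiableAt.comp (0 : ℝ) (g := f) (f := fun u => u + x) ?_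
        (differentiableAt_id.add_const x)
      simpa using hd
    refine h3.congr_of_eventuallyEq ?_
    have : ∀ᶠ u : ℝ in 𝓝 0, u < -x := gt_mem_nhds (by linarith)
    filter_upwards [this] with u hu
    exact Set.indicator_of_mem (show u + x ∈ Set.Iio 0 by simp; linarith) _
  have h4 : h 0 = f x := by
    simp only [hh, zero_add]
    exact Set.indicator_of_mem (show x ∈ Set.Iio 0 from hx) _
  have h5 := tendsto_integral_fourier h1 h2
  rw [h4] at h5
  refine h5.congr fun r => ?_
  refine intervalIntegral.integral_congr fun k _ => ?_
  unfold fourierNeg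
  rw [← integral_indicator measurableSet_Iio, ← integral_const_mul]
  refine Eq.trans ?_ (integral_add_right_eq_self (fun v : ℝ => Complex.exp (Complex.I * k * x) *
    (Set.Iio 0).indicator (fun y : ℝ => Complex.exp (-Complex.I * k * y) * f y) v) x)
  refine integral_congr_ae (Eventually.of_forall fun u => ?_)
  simp only [hh, Set.indicator]
  split_ifs with hu
  · rw [← mul_assoc, ← Complex.exp_add]
    congr 2
    push_cast
    ring
  · simp

/-! ### The global relation on a half-line -/

/-- An integrable function is small at points of any set of full measure arbitrarily far to the
left. -/
lemma exists_small_of_integrable {N : ℝ → ℝ} (hN : Integrable N)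
    {P : ℝ → Prop} (hP : ∀ᵐ a, P a) {ε : ℝ} (hε : 0 < ε) (M : ℝ) :
    ∃ a < M, P a ∧ N a < ε := by
  by_contra! h
  have h1 : ∀ᵐ a ∂volume.restrict (Set.Iio M), ‖ε‖ ≤ ‖N a‖ := by
    filter_upwards [ae_restrict_of_ae hP, ae_restrict_mem measurableSet_Iio] with a ha haM
    rw [Real.norm_of_nonneg hε.le]
    exact (h a haM ha).trans (Real.le_norm_self _)
  have h2 : IntegrableOn (fun _ : ℝ => ε) (Set.Iio M) :=
    Integrable.mono hN.restrict aestronglyMeasurable_const h1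
  rw [integrableOn_const_iff] at h2
  simp [hε.ne'] at h2

variable {α₁ α₂ : ℝ} {ψ₀ : ℝ → ℂ} {ψ : ℝ → ℝ → ℂ}

/-- The density `e^{-ikx + ωt} ψ` of the local conservation law. -/
noncomputable def density (α : ℝ) (ψ : ℝ → ℝ → ℂ) (k : ℂ) (x s : ℝ) : ℂ :=
  Complex.exp (-Complex.I * k * x + omega α k * s) * ψ x s

/-- The flux `e^{-ikx + ωt} (i ψ_x - k ψ)` of the local conservation law. -/
noncomputable def flux (α : ℝ) (ψ : ℝ → ℝ → ℂ) (k : ℂ) (x s : ℝ) : ℂ :=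
  Complex.exp (-Complex.I * k * x + omega α k * s) * (Complex.I * dx ψ x s - k * ψ x s)

/-- The time derivative of the density. -/
noncomputable def densityDeriv (α : ℝ) (ψ : ℝ → ℝ → ℂ) (k : ℂ) (x s : ℝ) : ℂ :=
  Complex.exp (-Complex.I * k * x + omega α k * s) * (omega α k * ψ x s + dt ψ x s)

lemma IsSolution.hasDerivAt_density (hψ : IsSolution α₁ α₂ ψ₀ ψ) (k : ℂ) {x s : ℝ} (hx : x < 0)
    (hs : 0 < s) : HasDerivAt (fun s => density α₁ ψ k x s) (densityDeriv α₁ ψ k x s) s := by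
  have h1 : HasDerivAt (fun s : ℝ => Complex.exp (-Complex.I * k * x + omega α₁ k * s))
      (Complex.exp (-Complex.I * k * x + omega α₁ k * s) * omega α₁ k) s := by
    simpa using (((hasDerivAt_id s).ofReal_comp.const_mul (omega α₁ k)).const_add
      (-Complex.I * k * x)).cexp
  refine (h1.mul (hψ.differentiableAt_t x s hx.ne hs).hasDerivAt).congr_deriv ?_
  unfold densityDeriv dt
  ring

/-- The local conservation law: by the equation, the space derivative of the flux is the time
derivative of the density. -/
lemma IsSolution.hasDerivAt_flux (hψ : IsSolution α₁ α₂ ψ₀ ψ) (k : ℂ) {x s : ℝ} (hx : x < 0)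
    (hs : 0 < s) : HasDerivAt (fun x => flux α₁ ψ k x s) (densityDeriv α₁ ψ k x s) x := by
  have h1 : HasDerivAt (fun x : ℝ => Complex.exp (-Complex.I * k * x + omega α₁ k * s))
      (Complex.exp (-Complex.I * k * x + omega α₁ k * s) * (-Complex.I * k)) x := by
    simpa using (((hasDerivAt_id x).ofReal_comp.const_mul (-Complex.I * k)).add_const
      (omega α₁ k * s)).cexp
  have h2 := (hψ.differentiableAt_dx x s hx.ne hs).hasDerivAt
  have h3 := (hψ.differentiableAt_x x s hs).hasDerivAt
  refine (h1.mul ((h2.const_mul Complex.I).sub (h3.const_mul k))).congr_deriv ?_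
  have heq := hψ.equation x s hx.ne hs
  rw [potential, if_pos hx] at heq
  have e1 : deriv (fun y => dx ψ y s) x = dxx ψ x s := rfl
  have e2 : deriv (fun y => ψ y s) x = dx ψ x s := rfl
  have hdt : dt ψ x s = -Complex.I * (-dxx ψ x s + α₁ * ψ x s) := by
    rw [← heq, ← mul_assoc]; simp
  rw [e1, e2]
  unfold densityDeriv
  simp only [Pi.sub_apply]
  rw [hdt, omega]
  linear_combination (-Complex.exp (-Complex.I * k * x + Complex.I * (α₁ + k ^ 2) * s)) *
    (k * dx ψ x s) * Complex.I_mul_I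

lemma IsSolution.continuousOn_density (hψ : IsSolution α₁ α₂ ψ₀ ψ) (k : ℂ) :
    ContinuousOn (fun p : ℝ × ℝ => density α₁ ψ k p.1 p.2) {p | 0 ≤ p.2} :=
  ContinuousOn.mul (Continuous.continuousOn (by fun_prop)) hψ.continuousOn

lemma IsSolution.continuousOn_flux (hψ : IsSolution α₁ α₂ ψ₀ ψ) (k : ℂ) :
    ContinuousOn (fun p : ℝ × ℝ => flux α₁ ψ k p.1 p.2) {p | 0 < p.2} :=
  ContinuousOn.mul (Continuous.continuousOn (by fun_prop))
    ((continuousOn_const.mul hψ.continuousOn_dx).sub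
      (continuousOn_const.mul (hψ.continuousOn.mono fun p (h : 0 < p.2) => h.le)))

lemma IsSolution.continuousOn_densityDeriv (hψ : IsSolution α₁ α₂ ψ₀ ψ) (k : ℂ) :
    ContinuousOn (fun p : ℝ × ℝ => densityDeriv α₁ ψ k p.1 p.2) {p | p.1 ≠ 0 ∧ 0 < p.2} :=
  ContinuousOn.mul (Continuous.continuousOn (by fun_prop))
    ((continuousOn_const.mul (hψ.continuousOn.mono fun p h => le_of_lt h.2)).add
      hψ.continuousOn_dt)

lemma IsSolution.continuous_density_left (hψ : IsSolution α₁ α₂ ψ₀ ψ) (k : ℂ) {s : ℝ}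
    (hs : 0 ≤ s) : Continuous fun x => density α₁ ψ k x s := by
  have := (hψ.continuousOn_density k).comp (f := fun x : ℝ => (x, s)) (s := Set.univ)
    (by fun_prop) (fun x _ => hs)
  exact continuousOn_univ.1 this

lemma IsSolution.continuousOn_flux_right (hψ : IsSolution α₁ α₂ ψ₀ ψ) (k : ℂ) (x : ℝ) :
    ContinuousOn (fun s => flux α₁ ψ k x s) (Set.Ioi 0) :=
  (hψ.continuousOn_flux k).comp (f := fun s : ℝ => (x, s)) (by fun_prop) (fun _ hs => hs)

/-- The integrated conservation law on a rectangle off the interface and the initial line. -/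
lemma IsSolution.conservation_rect (hψ : IsSolution α₁ α₂ ψ₀ ψ) (k : ℂ) {a b τ t : ℝ}
    (hab : a ≤ b) (hb : b < 0) (hτ : 0 < τ) (ht : τ ≤ t) :
    (∫ x in a..b, density α₁ ψ k x t) - ∫ x in a..b, density α₁ ψ k x τ =
      (∫ s in τ..t, flux α₁ ψ k b s) - ∫ s in τ..t, flux α₁ ψ k a s := by
  have hsub : Set.Icc a b ×ˢ Set.uIcc τ t ⊆ {p : ℝ × ℝ | p.1 ≠ 0 ∧ 0 < p.2} := by
    rintro ⟨x, s⟩ ⟨hx, hs⟩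
    rw [Set.uIcc_of_le ht] at hs
    exact ⟨(hx.2.trans_lt hb).ne, hτ.trans_le hs.1⟩
  have hc := (hψ.continuousOn_densityDeriv k).mono hsub
  obtain ⟨M, hM⟩ := (isCompact_Icc.prod isCompact_uIcc).exists_bound_of_continuousOn hc
  obtain ⟨-, -, hswap⟩ := integral_swap (K := densityDeriv α₁ ψ k) (g := fun _ => 1)
    measurableSet_Icc hc (fun y hy u hu => hM (y, u) ⟨hy, hu⟩)
    (integrableOn_const (by simp))
  simp only [mul_one] at hswap
  have hflux : ∀ x, IntervalIntegrable (fun s => flux α₁ ψ k x s) volume τ t := fun x =>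
    ((hψ.continuousOn_flux_right k x).mono (by
      rw [Set.uIcc_of_le ht]; exact fun s hs => hτ.trans_le hs.1)).intervalIntegrable
  rw [← intervalIntegral.integral_sub
      ((hψ.continuous_density_left k (hτ.le.trans ht)).intervalIntegrable _ _)
      ((hψ.continuous_density_left k hτ.le).intervalIntegrable _ _),
    ← intervalIntegral.integral_sub (hflux b) (hflux a)]
  have e1 : ∀ x ∈ Set.Icc a b, ∫ s in τ..t, densityDeriv α₁ ψ k x s =
      density α₁ ψ k x t - density α₁ ψ k x τ := by
    intro x hx
    refine intervalIntegral.integral_eq_sub_of_hasDerivAt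
      (f := fun s => density α₁ ψ k x s) (fun s hs => ?_) ?_
    · rw [Set.uIcc_of_le ht] at hs
      exact hψ.hasDerivAt_density k (hx.2.trans_lt hb) (hτ.trans_le hs.1)
    · exact (hc.comp (f := fun s : ℝ => (x, s)) (by fun_prop)
        fun s hs => ⟨hx, hs⟩).intervalIntegrable
  have e2 : ∀ s ∈ Set.uIcc τ t, ∫ x in Set.Icc a b, densityDeriv α₁ ψ k x s =
      flux α₁ ψ k b s - flux α₁ ψ k a s := by
    intro s hs
    rw [integral_Icc_eq_integral_Ioc, ← intervalIntegral.integral_of_le hab]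
    refine intervalIntegral.integral_eq_sub_of_hasDerivAt
      (f := fun x => flux α₁ ψ k x s) (fun x hx => ?_) ?_
    · rw [Set.uIcc_of_le hab] at hx
      rw [Set.uIcc_of_le ht] at hs
      exact hψ.hasDerivAt_flux k (hx.2.trans_lt hb) (hτ.trans_le hs.1)
    · rw [← Set.uIcc_of_le hab] at hc
      exact (hc.comp (f := fun x : ℝ => (x, s)) (by fun_prop)
        fun x hx => ⟨hx, hs⟩).intervalIntegrable
  rw [intervalIntegral.integral_congr e2, setIntegral_congr_fun measurableSet_Icc e1,
    integral_Icc_eq_integral_Ioc, ← intervalIntegral.integral_of_le hab] at hswap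
  exact hswap.symm

/-- The integrated conservation law up to the interface. -/
lemma IsSolution.conservation_interface (hψ : IsSolution α₁ α₂ ψ₀ ψ) (k : ℂ) {a τ t : ℝ}
    (ha : a < 0) (hτ : 0 < τ) (ht : τ ≤ t) :
    (∫ x in a..0, density α₁ ψ k x t) - ∫ x in a..0, density α₁ ψ k x τ =
      (∫ s in τ..t, flux α₁ ψ k 0 s) - ∫ s in τ..t, flux α₁ ψ k a s := by
  have hev : ∀ᶠ b in 𝓝[<] (0 : ℝ), b ∈ Set.Ico a 0 := Ico_mem_nhdsLT ha
  have hdens : ∀ s, 0 ≤ s → Tendsto (fun b => ∫ x in a..b, density α₁ ψ k x s) (𝓝[<] 0)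
      (𝓝 (∫ x in a..0, density α₁ ψ k x s)) := fun s hs =>
    ((intervalIntegral.continuous_primitive (fun _ _ =>
      (hψ.continuous_density_left k hs).intervalIntegrable _ _) a).tendsto 0).mono_left
      nhdsWithin_le_nhds
  have hsub : Set.Icc a 0 ×ˢ Set.Icc τ t ⊆ {p : ℝ × ℝ | 0 < p.2} :=
    fun p hp => hτ.trans_le hp.2.1
  obtain ⟨M, hM⟩ := (isCompact_Icc.prod isCompact_Icc).exists_bound_of_continuousOn
    ((hψ.continuousOn_flux k).mono hsub)
  have hflux : Tendsto (fun b => ∫ s in τ..t, flux α₁ ψ k b s) (𝓝[<] 0)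
      (𝓝 (∫ s in τ..t, flux α₁ ψ k 0 s)) := by
    refine intervalIntegral.tendsto_integral_filter_of_dominated_convergence (fun _ => M) ?_ ?_
      intervalIntegrable_const ?_
    · refine Eventually.of_forall fun b => ContinuousOn.aestronglyMeasurable
        ((hψ.continuousOn_flux_right k b).mono ?_) measurableSet_uIoc
      rw [Set.uIoc_of_le ht]
      exact fun s hs => hτ.trans hs.1
    · filter_upwards [hev] with b hb
      refine Eventually.of_forall fun s hs => ?_
      rw [Set.uIoc_of_le ht] at hs
      exact hM (b, s) ⟨⟨hb.1, hb.2.le⟩, ⟨hs.1.le, hs.2⟩⟩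
    · refine Eventually.of_forall fun s hs => ?_
      rw [Set.uIoc_of_le ht] at hs
      have h0 : (0 : ℝ) < s := hτ.trans hs.1
      have hat : ContinuousAt (fun p : ℝ × ℝ => flux α₁ ψ k p.1 p.2) (0, s) :=
        (hψ.continuousOn_flux k).continuousAt
          ((isOpen_lt continuous_const continuous_snd).mem_nhds h0)
      have hc : ContinuousAt (fun b : ℝ => (b, s)) 0 := by fun_prop
      exact (ContinuousAt.comp (f := fun b : ℝ => (b, s)) hat hc).tendsto.mono_left
        nhdsWithin_le_nhds
  refine tendsto_nhds_unique ((hdens t (hτ.le.trans ht)).sub (hdens τ hτ.le)) ?_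
  refine (hflux.sub_const (∫ s in τ..t, flux α₁ ψ k a s)).congr' ?_
  filter_upwards [hev] with b hb
  exact (hψ.conservation_rect k hb.1 hb.2 hτ ht).symm

/-- The integrated conservation law down to the initial time, over a segment from a point at which
the flux is integrable in time. -/
lemma IsSolution.conservation_initial (hψ : IsSolution α₁ α₂ ψ₀ ψ) (k : ℂ) {a t : ℝ}
    (ha : a < 0) (ht : 0 < t) (h0 : IntegrableOn (fun s => flux α₁ ψ k 0 s) (Set.uIcc 0 t))
    (hint : IntegrableOn (fun s => flux α₁ ψ k a s) (Set.uIcc 0 t)) :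
    (∫ x in a..0, density α₁ ψ k x t) - ∫ x in a..0, density α₁ ψ k x 0 =
      (∫ s in (0 : ℝ)..t, flux α₁ ψ k 0 s) - ∫ s in (0 : ℝ)..t, flux α₁ ψ k a s := by
  have hev : ∀ᶠ τ in 𝓝[>] (0 : ℝ), τ ∈ Set.Ioc 0 t := Ioc_mem_nhdsGT ht
  have hflux : ∀ y, IntegrableOn (fun s => flux α₁ ψ k y s) (Set.uIcc 0 t) →
      Tendsto (fun τ => ∫ s in τ..t, flux α₁ ψ k y s) (𝓝[>] 0)
        (𝓝 (∫ s in (0 : ℝ)..t, flux α₁ ψ k y s)) := by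
    intro y hy
    refine (intervalIntegral.continuousOn_primitive_interval_left hy 0
      Set.left_mem_uIcc).mono_left ?_
    rw [Set.uIcc_of_le ht.le]
    exact nhdsWithin_le_of_mem (mem_of_superset (Ioc_mem_nhdsGT ht) Set.Ioc_subset_Icc_self)
  have hsub : Set.Icc a 0 ×ˢ Set.Icc 0 t ⊆ {p : ℝ × ℝ | 0 ≤ p.2} := fun p hp => hp.2.1
  obtain ⟨M, hM⟩ := (isCompact_Icc.prod isCompact_Icc).exists_bound_of_continuousOn
    ((hψ.continuousOn_density k).mono hsub)
  have hdens : Tendsto (fun τ => ∫ x in a..0, density α₁ ψ k x τ) (𝓝[>] 0)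
      (𝓝 (∫ x in a..0, density α₁ ψ k x 0)) := by
    refine intervalIntegral.tendsto_integral_filter_of_dominated_convergence (fun _ => M) ?_ ?_
      intervalIntegrable_const ?_
    · filter_upwards [hev] with τ hτ
      exact (hψ.continuous_density_left k hτ.1.le).aestronglyMeasurable
    · filter_upwards [hev] with τ hτ
      refine Eventually.of_forall fun x hx => ?_
      rw [Set.uIoc_of_le ha.le] at hx
      exact hM (x, τ) ⟨⟨hx.1.le, hx.2⟩, ⟨hτ.1.le, hτ.2⟩⟩
    · refine Eventually.of_forall fun x _ => ?_
      have hw := (hψ.continuousOn_density k) (x, 0) (show (0 : ℝ) ≤ 0 from le_rfl)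
      exact (hw.comp (f := fun τ : ℝ => (x, τ)) (s := Set.Ioi 0) (by fun_prop)
        (fun τ (hτ : 0 < τ) => hτ.le)).tendsto
  refine tendsto_nhds_unique (hdens.const_sub _) ?_
  refine ((hflux 0 h0).sub (hflux a hint)).congr' ?_
  filter_upwards [hev] with τ hτ
  exact (hψ.conservation_interface k ha hτ.1 hτ.2).symm

lemma IsSolution.integrableOn_flux (hψ : IsSolution α₁ α₂ ψ₀ ψ) (k : ℂ) {t : ℝ} (ht : 0 ≤ t) (x : ℝ)
    (h : IntegrableOn (fun s => dx ψ x s) (Set.Ioo 0 t)) :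
    IntegrableOn (fun s => flux α₁ ψ k x s) (Set.uIcc 0 t) := by
  rw [Set.uIcc_of_le ht]
  have h1 : IntegrableOn (fun s => dx ψ x s) (Set.Icc 0 t) := by
    rwa [integrableOn_Icc_iff_integrableOn_Ioo]
  have h2 : ContinuousOn (fun s => ψ x s) (Set.Icc 0 t) :=
    hψ.continuousOn.comp (f := fun s : ℝ => (x, s)) (by fun_prop) fun s hs => hs.1
  refine IntegrableOn.continuousOn_mul (Continuous.continuousOn (by fun_prop)) ?_ isCompact_Icc
  exact (h1.const_mul Complex.I).sub (h2.integrableOn_Icc.const_mul k)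

/-- The global relation for the left half-line: the transform at time `t` in terms of the initial
transform and the traces at the interface. -/
lemma IsSolution.global_relation (hψ₀ : Integrable ψ₀) (hψ : IsSolution α₁ α₂ ψ₀ ψ) {k : ℂ}
    (hk : 0 ≤ k.im) {t : ℝ} (ht : 0 < t) :
    fourierNeg (fun x => ψ x t) k = Complex.exp (-omega α₁ k * t) * fourierNeg ψ₀ k +
      ∫ s in (0 : ℝ)..t, Complex.exp (-omega α₁ k * (t - s)) *
        (Complex.I * dx ψ 0 s - k * ψ 0 s) := by
  set ω := omega α₁ k with hω
  set ν := (volume : Measure ℝ).restrict (Set.Ioo 0 t) with hν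
  have hprod : (volume : Measure (ℝ × ℝ)).restrict (Set.univ ×ˢ Set.Ioo 0 t) =
      (volume : Measure ℝ).prod ν := by
    rw [Measure.volume_eq_prod, ← Measure.prod_restrict, Measure.restrict_univ]
  have hI1 : Integrable (fun p : ℝ × ℝ => ψ p.1 p.2) (volume.prod ν) := by
    rw [← hprod]; exact hψ.integrableOn_strip t ht
  have hI2 : Integrable (fun p : ℝ × ℝ => dx ψ p.1 p.2) (volume.prod ν) := by
    rw [← hprod]; exact hψ.integrableOn_strip_dx t ht
  have hN := hI1.integral_norm_prod_left.add hI2.integral_norm_prod_left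
  have hP := hI1.prod_right_ae.and hI2.prod_right_ae
  -- integrability over the strip gives a sequence of points `a n → -∞` at which `ψ` and `ψ_x` are
  -- small in `L¹(0, t)`; pointwise decay of `ψ_x` is not assumed
  have hseq : ∀ n : ℕ, ∃ a < -(n : ℝ) - 1, (Integrable (fun s => ψ a s) ν ∧
      Integrable (fun s => dx ψ a s) ν) ∧
      (∫ s, ‖ψ a s‖ ∂ν) + (∫ s, ‖dx ψ a s‖ ∂ν) < 1 / ((n : ℝ) + 1) := fun n =>
    exists_small_of_integrable hN hP (by positivity) _
  choose a ha hPa hNa using hseq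
  have ha0 : ∀ n, a n < 0 := fun n => (ha n).trans (by linarith [Nat.cast_nonneg (α := ℝ) n])
  have hatBot : Tendsto a atTop atBot := by
    refine tendsto_atBot_mono (fun n => (ha n).le) ?_
    exact tendsto_atBot_add_const_right _ _
      (tendsto_neg_atTop_atBot.comp tendsto_natCast_atTop_atTop)
  have h0 := hψ.integrableOn_flux k ht.le 0 (hψ.integrableOn_trace_dx t ht)
  have hcons := fun n => hψ.conservation_initial k (ha0 n) ht h0
    (hψ.integrableOn_flux k ht.le (a n) (hPa n).2)
  -- the flux through the far end of the segment tends to zero along the chosen sequence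
  have hfar : Tendsto (fun n => ∫ s in (0 : ℝ)..t, flux α₁ ψ k (a n) s) atTop (𝓝 0) := by
    set C := Real.exp (|ω.re| * t) * (1 + ‖k‖) with hC
    have hC0 : 0 ≤ C := by positivity
    refine squeeze_zero_norm (a := fun n : ℕ => C * (1 / ((n : ℝ) + 1))) (fun n => ?_) ?_
    · rw [intervalIntegral.integral_of_le ht.le, integral_Ioc_eq_integral_Ioo]
      have hb : ∀ᵐ s ∂ν, ‖flux α₁ ψ k (a n) s‖ ≤ C * (‖ψ (a n) s‖ + ‖dx ψ (a n) s‖) := by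
        filter_upwards [ae_restrict_mem measurableSet_Ioo] with s hs
        unfold flux
        rw [norm_mul, Complex.exp_add, norm_mul, hC, mul_assoc (Real.exp _)]
        have h1 := norm_exp_neg_I_mul_le hk (ha0 n).le
        have h2 : ‖Complex.exp (omega α₁ k * s)‖ ≤ Real.exp (|ω.re| * t) := by
          rw [Complex.norm_exp, Complex.re_mul_ofReal]
          refine Real.exp_le_exp.2 ?_
          exact (mul_le_mul_of_nonneg_right (le_abs_self _) hs.1.le).trans
            (mul_le_mul_of_nonneg_left hs.2.le (abs_nonneg _))
        refine mul_le_mul ?_ ?_ (norm_nonneg _) (Real.exp_pos _).le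
        · calc _ ≤ 1 * Real.exp (|ω.re| * t) := mul_le_mul h1 h2 (norm_nonneg _) zero_le_one
            _ = _ := one_mul _
        · refine (norm_sub_le _ _).trans ?_
          rw [norm_mul, norm_mul, Complex.norm_I, one_mul]
          nlinarith [norm_nonneg k, norm_nonneg (ψ (a n) s), norm_nonneg (dx ψ (a n) s),
            mul_nonneg (norm_nonneg k) (norm_nonneg (dx ψ (a n) s))]
      refine (norm_integral_le_of_norm_le
        (((hPa n).1.norm.add (hPa n).2.norm).const_mul C) hb).trans ?_
      rw [integral_const_mul]
      refine mul_le_mul_of_nonneg_left ?_ hC0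
      have := integral_add (hPa n).1.norm (hPa n).2.norm
      exact this.le.trans (hNa n).le
    · simpa using (tendsto_one_div_add_atTop_nhds_zero_nat (𝕜 := ℝ)).const_mul C
  have hdens : ∀ s : ℝ, ∀ f : ℝ → ℂ, Integrable f → (∀ x, ψ x s = f x) →
      Tendsto (fun n => ∫ x in a n..0, density α₁ ψ k x s) atTop
        (𝓝 (Complex.exp (ω * s) * fourierNeg f k)) := by
    intro s f hf hfs
    have hi : IntegrableOn (fun x => density α₁ ψ k x s) (Set.Iic 0) := by
      rw [integrableOn_Iic_iff_integrableOn_Iio]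
      have := (integrableOn_exp_mul hf.integrableOn hk).const_mul (Complex.exp (ω * s))
      refine this.congr (Eventually.of_forall fun x => ?_)
      simp only [density]
      rw [hfs, Complex.exp_add]; ring
    have h := intervalIntegral_tendsto_integral_Iic 0 hi hatBot
    convert h using 2
    rw [fourierNeg, ← integral_Iic_eq_integral_Iio, ← integral_const_mul]
    refine integral_congr_ae (Eventually.of_forall fun x => ?_)
    simp only [density]
    rw [hfs, Complex.exp_add]; ring
  have hL := (hdens t (fun x => ψ x t) (hψ.integrable t ht) fun _ => rfl).sub
    (hdens 0 ψ₀ hψ₀ hψ.initial)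
  have hR := hfar.const_sub (∫ s in (0 : ℝ)..t, flux α₁ ψ k 0 s)
  have hfin := tendsto_nhds_unique (hL.congr hcons) hR
  rw [sub_zero] at hfin
  have hexp : Complex.exp (-ω * t) * Complex.exp (ω * t) = 1 := by
    rw [← Complex.exp_add]; simp
  have hI : ∫ s in (0 : ℝ)..t, Complex.exp (-ω * (t - s)) * (Complex.I * dx ψ 0 s - k * ψ 0 s) =
      Complex.exp (-ω * t) * ∫ s in (0 : ℝ)..t, flux α₁ ψ k 0 s := by
    rw [← intervalIntegral.integral_const_mul]
    refine intervalIntegral.integral_congr fun s _ => ?_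
    simp only [flux]
    rw [← mul_assoc, ← Complex.exp_add, ← hω]
    congr 2
    push_cast; ring
  rw [hI, ← hfin]
  simp only [Complex.ofReal_zero, mul_zero, Complex.exp_zero, one_mul]
  linear_combination (-fourierNeg (fun x => ψ x t) k) * hexp

/-! ### Convergence of the contour integrals -/

lemma truncatedContourIntegral_three (R : ℝ) (f : ℂ → ℂ) (A B : ℝ) :
    truncatedContourIntegral 3 R f A B = -(∫ r in R..A, f (-Complex.I * r) * (-Complex.I)) +
      (∫ θ in (3 * Real.pi / 2)..Real.pi, f (circleMap 0 R θ) * (circleMap 0 R θ * Complex.I)) +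
      ∫ r in R..B, f (-r) * (-1) := by
  have e2 : (((3 : ℕ) - 1 : ℝ) * Real.pi / 2 : ℝ) = Real.pi := by push_cast; ring
  have e3 : (((3 : ℕ) : ℝ) * Real.pi / 2 : ℝ) = Real.pi + Real.pi / 2 := by push_cast; ring
  have e4 : Complex.exp ((Real.pi + Real.pi / 2 : ℝ) * Complex.I) = -Complex.I := by
    push_cast
    rw [add_mul, Complex.exp_add, Complex.exp_pi_mul_I, Complex.exp_pi_div_two_mul_I]; ring
  have e5 : ∀ r : ℝ, circleMap 0 r (Real.pi + Real.pi / 2) = -Complex.I * r := fun r => by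
    rw [circleMap, e4]; ring
  have e6 : ∀ r : ℝ, circleMap 0 r Real.pi = -r := fun r => by
    rw [circleMap, Complex.exp_pi_mul_I]; ring
  have e7 : 3 * Real.pi / 2 = Real.pi + Real.pi / 2 := by ring
  unfold truncatedContourIntegral
  rw [e2, e3, e4, e7, Complex.exp_pi_mul_I]
  simp only [e5, e6]

lemma neg_I_mul_mem {ρ r : ℝ} (hρ : 0 ≤ ρ) (hr : ρ ≤ r) :
    -Complex.I * r ∈ thirdQuadrant ρ := by
  refine ⟨by simp, by simp; linarith, ?_⟩
  rw [norm_mul, norm_neg, Complex.norm_I, one_mul, Complex.norm_real, Real.norm_eq_abs]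
  exact hr.trans (le_abs_self r)

lemma neg_ofReal_mem {ρ r : ℝ} (hρ : 0 ≤ ρ) (hr : ρ ≤ r) : -(r : ℂ) ∈ thirdQuadrant ρ := by
  refine ⟨by simp; linarith, by simp, ?_⟩
  rw [norm_neg, Complex.norm_real, Real.norm_eq_abs]
  exact hr.trans (le_abs_self r)

/-- A function that decays exponentially on the imaginary ray has a contour integral as soon as the
integral along the real ray converges. -/
lemma hasContourIntegral_of_rays {f : ℂ → ℂ} {R x C₂ C₃ : ℝ} (hR : 0 < R) (hx : x < 0)
    (hf : ContinuousOn f (thirdQuadrant R))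
    (h1 : ∀ r : ℝ, R ≤ r → ‖f (-Complex.I * r)‖ ≤ Real.exp (x * r))
    (h2 : ∀ k ∈ thirdQuadrant R, ‖k‖ = R → ‖f k‖ ≤ C₂)
    (h3 : ∃ l, Tendsto (fun B : ℝ => ∫ r in R..B, f (-r)) atTop (𝓝 l))
    (h4 : ∀ B : ℝ, R ≤ B → ‖∫ r in R..B, f (-r)‖ ≤ C₃) :
    (∃ l, HasContourIntegral 3 R f l) ∧ ∀ A B, R ≤ A → R ≤ B →
      ‖truncatedContourIntegral 3 R f A B‖ ≤
        (∫ r in Set.Ioi R, Real.exp (x * r)) + C₂ * R * (Real.pi / 2) + C₃ := by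
  have hπ := Real.pi_pos
  have hray := improper_integral_of_bound (f := fun r : ℝ => f (-Complex.I * r) * (-Complex.I))
    (g := fun r => Real.exp (x * r)) (R := R)
    (ContinuousOn.mul (hf.comp (f := fun r : ℝ => -Complex.I * (r : ℂ)) (by fun_prop)
      fun r hr => neg_I_mul_mem hR.le hr) continuousOn_const)
    (integrableOn_exp_mul_Ioi hx R)
    (fun r hr => by
      rw [norm_mul, norm_neg, Complex.norm_I, mul_one]; exact h1 r (le_of_lt hr))
  constructor
  · obtain ⟨l, hl⟩ := h3
    refine ⟨-(∫ r in Set.Ioi R, f (-Complex.I * (r : ℂ)) * (-Complex.I)) +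
      (∫ θ in (3 * Real.pi / 2)..Real.pi, f (circleMap 0 R θ) * (circleMap 0 R θ * Complex.I)) +
      l * (-1), ?_⟩
    unfold HasContourIntegral
    simp_rw [truncatedContourIntegral_three]
    have h5 : Tendsto (fun B : ℝ => ∫ r in R..B, f (-r) * (-1)) atTop (𝓝 (l * (-1))) := by
      simp_rw [intervalIntegral.integral_mul_const]
      exact hl.mul_const _
    exact ((hray.1.comp tendsto_fst).neg.add tendsto_const_nhds).add (h5.comp tendsto_snd)
  · intro A B hA hB
    rw [truncatedContourIntegral_three]
    refine (norm_add₃_le).trans (add_le_add_three ?_ ?_ ?_)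
    · rw [norm_neg]; exact hray.2 A hA
    · have := intervalIntegral.norm_integral_le_of_norm_le_const (a := 3 * Real.pi / 2)
        (b := Real.pi) (C := C₂ * R)
        (f := fun θ => f (circleMap 0 R θ) * (circleMap 0 R θ * Complex.I)) (fun θ hθ => by
          rw [Set.uIoc_of_ge (by linarith)] at hθ
          rw [norm_mul, norm_mul, Complex.norm_I, mul_one, norm_circleMap_zero' hR.le]
          refine mul_le_mul_of_nonneg_right (h2 _ ?_ (norm_circleMap_zero' hR.le θ)) hR.le
          exact circleMap_mem_thirdQuadrant hR.le le_rfl hθ.1.le hθ.2)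
      refine this.trans_eq ?_
      rw [show Real.pi - 3 * Real.pi / 2 = -(Real.pi / 2) by ring, abs_neg,
        abs_of_pos (by positivity)]
    · rw [intervalIntegral.integral_mul_const, norm_mul, norm_neg, norm_one, mul_one]
      exact h4 B hB

/-- The plane wave `e^{ikx - ω(k) t}`. -/
noncomputable def planeWave (α x t : ℝ) (k : ℂ) : ℂ :=
  Complex.exp (Complex.I * k * x - omega α k * t)

lemma norm_planeWave (α x t : ℝ) (k : ℂ) :
    ‖planeWave α x t k‖ = Real.exp (-k.im * x + 2 * (k.re * k.im) * t) := by
  rw [planeWave, Complex.norm_exp, omega]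
  congr 1
  simp [sq]
  ring

lemma differentiable_planeWave (α x t : ℝ) : Differentiable ℂ (planeWave α x t) := by
  unfold planeWave omega; fun_prop

lemma norm_planeWave_le {α x t R : ℝ} (ht : 0 ≤ t) {k : ℂ} (hk : ‖k‖ = R) :
    ‖planeWave α x t k‖ ≤ Real.exp (R * |x| + 2 * (R * R) * t) := by
  rw [norm_planeWave]
  have h1 : |k.re| ≤ R := hk ▸ Complex.abs_re_le_norm k
  have h2 : |k.im| ≤ R := hk ▸ Complex.abs_im_le_norm k
  have hR : 0 ≤ R := hk ▸ norm_nonneg k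
  have h3 : -k.im * x ≤ R * |x| := by
    refine (le_abs_self _).trans ?_
    rw [abs_mul, abs_neg]
    exact mul_le_mul_of_nonneg_right h2 (abs_nonneg x)
  have h4 : k.re * k.im ≤ R * R := by
    refine (le_abs_self _).trans ?_
    rw [abs_mul]
    exact mul_le_mul h1 h2 (abs_nonneg _) hR
  have h5 := mul_le_mul_of_nonneg_right h4 ht
  exact Real.exp_le_exp.2 (by linarith)

/-- The coefficient of the reflected wave, times the plane wave. Here `δ` is the potential of the
incoming side minus that of the other side. -/
noncomputable def reflected (α δ x t : ℝ) (k : ℂ) : ℂ :=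
  (1 - Complex.sqrt (1 + δ / k ^ 2)) / (2 * Real.pi * (1 + Complex.sqrt (1 + δ / k ^ 2))) *
    planeWave α x t k

/-- The coefficient of the transmitted wave, times the plane wave. As in `reflected`, `δ` is a
difference of potentials. -/
noncomputable def transmitted (α δ x t : ℝ) (k : ℂ) : ℂ :=
  1 / (Real.pi * (1 + Complex.sqrt (1 + δ / k ^ 2))) * planeWave α x t k

lemma norm_reflected_le {α δ x t : ℝ} {k : ℂ} (h : |δ| < ‖k‖ ^ 2) :
    ‖reflected α δ x t k‖ ≤ |δ| / ‖k‖ ^ 2 * ‖planeWave α x t k‖ := by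
  rw [reflected, norm_mul]
  refine mul_le_mul_of_nonneg_right ?_ (norm_nonneg _)
  have h1 : (1 - Complex.sqrt (1 + δ / k ^ 2)) /
      (2 * Real.pi * (1 + Complex.sqrt (1 + δ / k ^ 2))) =
      (1 - Complex.sqrt (1 + δ / k ^ 2)) / (1 + Complex.sqrt (1 + δ / k ^ 2)) /
        ((2 * Real.pi : ℝ) : ℂ) := by
    rw [div_div, mul_comm]; push_cast; rfl
  rw [h1, norm_div, Complex.norm_real, Real.norm_of_nonneg (by positivity)]
  exact (div_le_self (norm_nonneg _) (by linarith [Real.pi_gt_three])).trans (norm_reflection_le h)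

lemma norm_transmitted_le {α δ x t : ℝ} {k : ℂ} (h : |δ| < ‖k‖ ^ 2) :
    ‖transmitted α δ x t k‖ ≤ ‖planeWave α x t k‖ := by
  rw [transmitted, norm_mul]
  refine mul_le_of_le_one_left (norm_nonneg _) ?_
  rw [norm_div, norm_one, norm_mul, Complex.norm_real, Real.norm_of_nonneg Real.pi_pos.le]
  have h1 := one_le_norm_one_add_sqrt h
  refine div_le_one_of_le₀ ?_ (by positivity)
  nlinarith [Real.pi_gt_three]

lemma norm_reflected_le' {α δ x t : ℝ} {k : ℂ} (h : |δ| < ‖k‖ ^ 2) :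
    ‖reflected α δ x t k‖ ≤ ‖planeWave α x t k‖ :=
  (norm_reflected_le h).trans (mul_le_of_le_one_left (norm_nonneg _)
    (div_le_one_of_le₀ h.le (by positivity)))

lemma differentiableAt_reflected {α δ x t : ℝ} {k : ℂ} (h : |δ| < ‖k‖ ^ 2) :
    DifferentiableAt ℂ (reflected α δ x t) k := by
  have h1 := differentiableAt_sqrt_one_add h
  refine DifferentiableAt.mul (DifferentiableAt.div (h1.const_sub 1)
    ((h1.const_add 1).const_mul _) ?_) (differentiable_planeWave α x t k)
  have : (Real.pi : ℂ) ≠ 0 := by exact_mod_cast Real.pi_ne_zero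
  exact mul_ne_zero (mul_ne_zero two_ne_zero this) (one_add_sqrt_ne_zero h)

lemma differentiableAt_transmitted {α δ x t : ℝ} {k : ℂ} (h : |δ| < ‖k‖ ^ 2) :
    DifferentiableAt ℂ (transmitted α δ x t) k := by
  have h1 := differentiableAt_sqrt_one_add h
  refine DifferentiableAt.mul (DifferentiableAt.div (differentiableAt_const 1)
    ((h1.const_add 1).const_mul _) ?_) (differentiable_planeWave α x t k)
  have : (Real.pi : ℂ) ≠ 0 := by exact_mod_cast Real.pi_ne_zero
  exact mul_ne_zero this (one_add_sqrt_ne_zero h)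

/-- Kernels of the form `c k * e^{-i n(k) y}` that are bounded on `S` in the third quadrant. -/
lemma isContourKernel_mul_exp {S : Set ℝ} {ρ : ℝ} {c n : ℂ → ℂ}
    (hc : ContinuousOn c (thirdQuadrant ρ)) (hn : ContinuousOn n (thirdQuadrant ρ))
    (hS : ∀ y ∈ S, ∀ k ∈ thirdQuadrant ρ, ‖Complex.exp (-Complex.I * n k * y)‖ ≤ 1) :
    IsContourKernel S ρ (fun y k => c k * Complex.exp (-Complex.I * n k * y)) := by
  constructor
  · refine ContinuousOn.mul (hc.comp continuousOn_snd fun p hp => hp.2) ?_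
    refine ContinuousOn.cexp (ContinuousOn.mul (continuousOn_const.mul
      (hn.comp continuousOn_snd fun p hp => hp.2)) ?_)
    exact (Complex.continuous_ofReal.comp continuous_fst).continuousOn
  · intro N
    have hcomp : IsCompact (thirdQuadrant ρ ∩ Metric.closedBall 0 N) := by
      refine (isCompact_closedBall 0 N).inter_left ?_
      exact (isClosed_le Complex.continuous_re continuous_const).inter
        ((isClosed_le Complex.continuous_im continuous_const).inter
          (isClosed_le continuous_const continuous_norm))
    obtain ⟨M, hM⟩ := hcomp.exists_bound_of_continuousOn (hc.mono Set.inter_subset_left)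
    refine ⟨M, fun y hy k hk hkN => ?_⟩
    rw [norm_mul]
    have := hM k ⟨hk, by simpa using hkN⟩
    exact (mul_le_of_le_one_right (norm_nonneg _) (hS y hy k hk)).trans this

/-- Convergence of the contour integral of a reflected wave: its kernel is of second order on the
real ray. -/
lemma reflected_kernel_convergence {α δ x t R y : ℝ} (hR : 0 < R) (hRδ : |δ| < R ^ 2) (hx : x < 0)
    (ht : 0 < t) (hy : y ≤ 0) :
    (∃ l, HasContourIntegral 3 R
      (fun k => reflected α δ x t k * Complex.exp (-Complex.I * (-k) * y)) l) ∧
    ∀ A B, R ≤ A → R ≤ B → ‖truncatedContourIntegral 3 R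
      (fun k => reflected α δ x t k * Complex.exp (-Complex.I * (-k) * y)) A B‖ ≤
        (∫ r in Set.Ioi R, Real.exp (x * r)) +
          Real.exp (R * |x| + 2 * (R * R) * t) * R * (Real.pi / 2) + |δ| / R := by
  have hlt : ∀ k ∈ thirdQuadrant R, |δ| < ‖k‖ ^ 2 := fun k hk =>
    hRδ.trans_le (pow_le_pow_left₀ hR.le hk.2.2 2)
  have hexp : ∀ k ∈ thirdQuadrant R, ‖Complex.exp (-Complex.I * (-k) * y)‖ ≤ 1 := fun k hk =>
    norm_exp_neg_I_mul_le (by simpa using hk.2.1) hy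
  have hcont : ContinuousOn (fun k => reflected α δ x t k * Complex.exp (-Complex.I * (-k) * y))
      (thirdQuadrant R) := by
    refine ContinuousOn.mul (fun k hk =>
      (differentiableAt_reflected (hlt k hk)).continuousAt.continuousWithinAt) ?_
    fun_prop
  have hb : ∀ k ∈ thirdQuadrant R, ‖reflected α δ x t k * Complex.exp (-Complex.I * (-k) * y)‖ ≤
      ‖planeWave α x t k‖ := fun k hk => by
    rw [norm_mul]
    exact (mul_le_of_le_one_right (norm_nonneg _) (hexp k hk)).trans (norm_reflected_le' (hlt k hk))
  obtain ⟨hpow, hpowval⟩ := integrableOn_const_div_sq hR |δ|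
  have hreal := improper_integral_of_bound (R := R)
    (f := fun r : ℝ => reflected α δ x t (-r) * Complex.exp (-Complex.I * (-(-r)) * y))
    (g := fun r : ℝ => |δ| / r ^ 2)
    (hcont.comp (f := fun r : ℝ => -(r : ℂ)) (by fun_prop) fun r hr => neg_ofReal_mem hR.le hr)
    hpow
    (fun r hr => by
      have hm : -(r : ℂ) ∈ thirdQuadrant R := neg_ofReal_mem hR.le (le_of_lt hr)
      rw [norm_mul]
      refine (mul_le_of_le_one_right (norm_nonneg _) (hexp _ hm)).trans
        ((norm_reflected_le (hlt _ hm)).trans_eq ?_)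
      rw [norm_planeWave]
      simp)
  rw [hpowval] at hreal
  refine hasContourIntegral_of_rays hR hx hcont ?_ ?_ ⟨_, hreal.1⟩ hreal.2
  · intro r hr
    refine (hb _ (neg_I_mul_mem hR.le hr)).trans_eq ?_
    rw [norm_planeWave]
    simp [mul_comm]
  · exact fun k hk hkR => (hb k hk).trans (norm_planeWave_le ht.le hkR)

lemma sqrt_one_add_neg_real {δ r : ℝ} (hr : 0 < r) (h : |δ| < r ^ 2) :
    Complex.sqrt (1 + δ / (-(r : ℂ)) ^ 2) = (√(r ^ 2 + δ) / r : ℝ) := by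
  have h1 : 0 < r ^ 2 + δ := by linarith [neg_abs_le δ]
  symm
  apply eq_sqrt_of_mul_self
  · rw [← Complex.ofReal_mul, div_mul_div_comm, Real.mul_self_sqrt h1.le]
    have : (r : ℂ) ≠ 0 := by exact_mod_cast hr.ne'
    push_cast
    field_simp
  · rw [Complex.ofReal_re]; positivity

/-- The integral of a transmitted wave along the real ray. In terms of `σ = √(r² + δ)` the phase is
quadratic, up to `(σ - r) x`, which varies slowly. So the integral is that of a slowly varying
amplitude against the derivative of a Fresnel primitive at `σ`, and the bounds do not depend on the
source point `y`. -/
lemma transmitted_real_ray {α δ x t R : ℝ} (hR : 0 < R) (hRδ : |δ| < R ^ 2) (ht : 0 < t) :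
    ∃ C, ∀ y : ℝ, (∃ l, Tendsto (fun B : ℝ => ∫ r in R..B, transmitted α δ x t (-r) *
        Complex.exp (-Complex.I * shiftedRoot δ (-r) * y)) atTop (𝓝 l)) ∧
      ∀ B : ℝ, R ≤ B → ‖∫ r in R..B, transmitted α δ x t (-r) *
        Complex.exp (-Complex.I * shiftedRoot δ (-r) * y)‖ ≤ C := by
  obtain ⟨C, hC⟩ := fresnel_bounded ht
  have hC0 : 0 ≤ C := (norm_nonneg _).trans (hC 0 0)
  set σ : ℝ → ℝ := fun r => √(r ^ 2 + δ) with hσ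
  set σ₀ := √(R ^ 2 - |δ|) with hσ₀
  have hσ₀pos : 0 < σ₀ := Real.sqrt_pos.2 (by linarith)
  have hr2 : ∀ r, R ≤ r → |δ| < r ^ 2 := fun r hr =>
    hRδ.trans_le (pow_le_pow_left₀ hR.le hr 2)
  have harg : ∀ r, R ≤ r → 0 < r ^ 2 + δ := fun r hr => by
    linarith [neg_abs_le δ, hr2 r hr]
  have hσpos : ∀ r, R ≤ r → 0 < σ r := fun r hr => Real.sqrt_pos.2 (harg r hr)
  have hσsq : ∀ r, R ≤ r → σ r ^ 2 = r ^ 2 + δ := fun r hr => Real.sq_sqrt (harg r hr).le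
  have hσge : ∀ r, R ≤ r → σ₀ ≤ σ r := fun r hr => Real.sqrt_le_sqrt (by
    have := pow_le_pow_left₀ hR.le hr 2
    linarith [neg_abs_le δ])
  have hσd : ∀ r, R ≤ r → HasDerivAt σ (r / σ r) r := by
    intro r hr
    have h1 : HasDerivAt (fun r : ℝ => r ^ 2 + δ) (2 * r) r := by
      simpa using ((hasDerivAt_id r).pow 2).add_const δ
    refine (h1.sqrt (harg r hr).ne').congr_deriv ?_
    have := (hσpos r hr).ne'
    simp only [hσ] at this ⊢
    field_simp
  have hσc : ContinuousOn σ (Set.Ici R) := fun r hr => (hσd r hr).continuousAt.continuousWithinAt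
  -- `c₀` collects the constant factors
  set c₀ : ℂ := Complex.exp (Complex.I * (δ * t - α * t : ℝ)) / Real.pi with hc₀
  have hc₀n : ‖c₀‖ ≤ 1 := by
    rw [hc₀, norm_div, norm_exp_I_mul_real, Complex.norm_real, Real.norm_of_nonneg Real.pi_pos.le]
    exact div_le_one_of_le₀ (by linarith [Real.pi_gt_three]) Real.pi_pos.le
  set e : ℝ → ℂ := fun r => Complex.exp (Complex.I * (x * (σ r - r) : ℝ)) with he
  have hen : ∀ r, ‖e r‖ = 1 := fun r => norm_exp_I_mul_real _
  -- `w r * (r / σ r)` is the coefficient `1 / (1 + σ r / r)`; the factor `r / σ r` is left to the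
  -- oscillating part, as the derivative of `σ`
  set w : ℝ → ℝ := fun r => σ r / (r + σ r) with hw
  set a : ℝ → ℂ := fun r => c₀ * (e r * (w r : ℂ)) with ha
  set a' : ℝ → ℂ := fun r => c₀ * (e r * (Complex.I * (x * (r / σ r - 1) : ℝ)) * (w r : ℂ) +
    e r * ((-δ / (σ r * (r + σ r) ^ 2) : ℝ) : ℂ)) with ha'
  have hpos : ∀ r, R ≤ r → 0 < r ∧ 0 < σ r ∧ 0 < r + σ r := fun r hr =>
    ⟨hR.trans_le hr, hσpos r hr, add_pos (hR.trans_le hr) (hσpos r hr)⟩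
  have had : ∀ r, R ≤ r → HasDerivAt a (a' r) r := by
    intro r hr
    obtain ⟨p1, p2, p3⟩ := hpos r hr
    have h1 : HasDerivAt e (e r * (Complex.I * (x * (r / σ r - 1) : ℝ))) r :=
      ((((hσd r hr).sub (hasDerivAt_id r)).const_mul x).ofReal_comp.const_mul Complex.I).cexp
    have h2 : HasDerivAt w (-δ / (σ r * (r + σ r) ^ 2)) r := by
      refine ((hσd r hr).div ((hasDerivAt_id r).add (hσd r hr)) p3.ne').congr_deriv ?_
      have := hσsq r hr
      simp only [Pi.add_apply, id]
      field_simp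
      linear_combination -this
    exact (h1.mul h2.ofReal_comp).const_mul c₀
  have hwn : ∀ r, R ≤ r → |w r| ≤ 1 := fun r hr => by
    obtain ⟨p1, p2, p3⟩ := hpos r hr
    rw [abs_of_pos (by positivity)]
    exact div_le_one_of_le₀ (by linarith) p3.le
  have hab : ∀ r, R ≤ r → ‖a r‖ ≤ 1 := fun r hr => by
    simp only [ha]
    rw [norm_mul, norm_mul, hen, one_mul, Complex.norm_real, Real.norm_eq_abs]
    exact mul_le_one₀ hc₀n (abs_nonneg _) (hwn r hr)
  have ha'b : ∀ r, R ≤ r → ‖a' r‖ ≤ (|x| * |δ| + |δ| / σ₀) / r ^ 2 := by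
    intro r hr
    obtain ⟨p1, p2, p3⟩ := hpos r hr
    simp only [ha']
    rw [norm_mul]
    refine (mul_le_of_le_one_left (norm_nonneg _) hc₀n).trans ((norm_add_le _ _).trans ?_)
    rw [norm_mul, norm_mul, norm_mul, hen, norm_mul, hen, Complex.norm_I, one_mul, one_mul, one_mul,
      Complex.norm_real, Complex.norm_real, Complex.norm_real, Real.norm_eq_abs, Real.norm_eq_abs,
      Real.norm_eq_abs, ← abs_mul, add_div]
    have hsq : r ^ 2 ≤ (r + σ r) ^ 2 := pow_le_pow_left₀ p1.le (by linarith) 2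
    refine add_le_add ?_ ?_
    · have : x * (r / σ r - 1) * w r = -(x * δ) / (r + σ r) ^ 2 := by
        have := hσsq r hr
        simp only [hw]
        field_simp
        linear_combination (-x) * this
      rw [this, abs_div, abs_neg, abs_mul, abs_of_pos (by positivity : 0 < (r + σ r) ^ 2)]
      exact div_le_div_of_nonneg_left (by positivity) (by positivity) hsq
    · rw [abs_div, abs_neg, abs_of_pos (by positivity : 0 < σ r * (r + σ r) ^ 2), div_div]
      refine div_le_div_of_nonneg_left (by positivity) (by positivity) ?_
      exact mul_le_mul (hσge r hr) hsq (by positivity) p2.le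
  have hec : ContinuousOn e (Set.Ici R) := by
    refine ContinuousOn.cexp (continuousOn_const.mul ?_)
    exact Complex.continuous_ofReal.comp_continuousOn
      (continuousOn_const.mul (hσc.sub continuousOn_id))
  have hwc : ContinuousOn w (Set.Ici R) :=
    hσc.div (continuousOn_id.add hσc) fun r hr => (hpos r hr).2.2.ne'
  have ha'c : ContinuousOn a' (Set.Ici R) := by
    refine continuousOn_const.mul (((hec.mul (continuousOn_const.mul ?_)).mul ?_).add
      (hec.mul ?_))
    · exact Complex.continuous_ofReal.comp_continuousOn (continuousOn_const.mul
        ((continuousOn_id.div hσc fun r hr => (hσpos r hr).ne').sub continuousOn_const))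
    · exact Complex.continuous_ofReal.comp_continuousOn hwc
    · refine Complex.continuous_ofReal.comp_continuousOn (continuousOn_const.div
        (hσc.mul ((continuousOn_id.add hσc).pow 2)) fun r hr => ?_)
      have := (hpos r hr).2
      exact (mul_pos this.1 (pow_pos this.2 2)).ne'
  -- limits at infinity
  have hσtop : Tendsto σ atTop atTop := by
    refine Real.tendsto_sqrt_atTop.comp (tendsto_atTop_add_const_right _ _ ?_)
    exact tendsto_pow_atTop two_ne_zero
  have hsum : Tendsto (fun r => r + σ r) atTop atTop := tendsto_id.atTop_add_atTop hσtop
  have hdiff : Tendsto (fun r => σ r - r) atTop (𝓝 0) := by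
    refine (hsum.const_div_atTop δ).congr' ?_
    filter_upwards [eventually_ge_atTop R] with r hr
    have := hσsq r hr
    rw [div_eq_iff (hpos r hr).2.2.ne']
    linear_combination -this
  have helim : Tendsto e atTop (𝓝 1) := by
    have h1 : Continuous fun u : ℝ => Complex.exp (Complex.I * (x * u : ℝ)) := by fun_prop
    have h2 := (h1.tendsto 0).comp hdiff
    simpa [he, Function.comp_def] using h2
  have hwlim : Tendsto w atTop (𝓝 (1 / 2)) := by
    have h1 : Tendsto (fun r => 1 / 2 + (σ r - r) * (r + σ r)⁻¹ / 2) atTop (𝓝 (1 / 2)) := by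
      have := ((hdiff.mul hsum.inv_tendsto_atTop).div_const 2).const_add (1 / 2)
      simpa using this
    refine h1.congr' ?_
    filter_upwards [eventually_ge_atTop R] with r hr
    have := (hpos r hr).2.2.ne'
    simp only [hw]
    field_simp
    ring
  refine ⟨2 * (1 * C) + (|x| * |δ| + |δ| / σ₀) * C / R, fun y => ?_⟩
  obtain ⟨L, hL⟩ := fresnel_tendsto_atTop ht (y - x)
  set P : ℝ → ℂ := fun r => fresnel t (y - x) (σ r) with hP
  set P' : ℝ → ℂ := fun r => ((r / σ r : ℝ) : ℂ) *
    Complex.exp (Complex.I * ((y - x) * σ r - t * σ r ^ 2 : ℝ)) with hP'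
  have hPd : ∀ r, R ≤ r → HasDerivAt P (P' r) r := fun r hr => by
    have := (hasDerivAt_fresnel t (y - x) (σ r)).scomp r (hσd r hr)
    rwa [Complex.real_smul] at this
  have hP'c : ContinuousOn P' (Set.Ici R) := by
    refine ContinuousOn.mul (Complex.continuous_ofReal.comp_continuousOn
      (continuousOn_id.div hσc fun r hr => (hσpos r hr).ne')) ?_
    exact ContinuousOn.cexp (continuousOn_const.mul (Complex.continuous_ofReal.comp_continuousOn
      ((continuousOn_const.mul hσc).sub (continuousOn_const.mul (hσc.pow 2)))))
  have key := oscillatory_integral hR had hPd ha'c hP'c (fun r _ => hC _ _) hab ha'b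
    (((helim.mul (Complex.continuous_ofReal.tendsto _ |>.comp hwlim)).const_mul c₀).mul
      (hL.comp hσtop))
  have heq : ∀ B, R ≤ B → ∫ r in R..B, transmitted α δ x t (-r) *
      Complex.exp (-Complex.I * shiftedRoot δ (-r) * y) = ∫ r in R..B, a r * P' r := by
    intro B hB
    refine intervalIntegral.integral_congr fun r hr => ?_
    rw [Set.uIcc_of_le hB] at hr
    obtain ⟨p1, p2, p3⟩ := hpos r hr.1
    have hs := sqrt_one_add_neg_real p1 (hr2 r hr.1)
    have c1 : (r : ℂ) ≠ 0 := by exact_mod_cast p1.ne'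
    have c2 : (σ r : ℂ) ≠ 0 := by exact_mod_cast p2.ne'
    have c3 : (r : ℂ) + σ r ≠ 0 := by exact_mod_cast p3.ne'
    have c4 : (Real.pi : ℂ) ≠ 0 := by exact_mod_cast Real.pi_ne_zero
    have hσsq' : (σ r : ℂ) ^ 2 = r ^ 2 + δ := by exact_mod_cast hσsq r hr.1
    have hsh : shiftedRoot δ (-r) = -(σ r : ℂ) := by
      rw [shiftedRoot, hs]; push_cast; field_simp; rfl
    have hcoef : (1 : ℂ) / (Real.pi * (1 + ((√(r ^ 2 + δ) / r : ℝ) : ℂ))) =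
        1 / Real.pi * ((w r : ℂ) * ((r / σ r : ℝ) : ℂ)) := by
      simp only [hw]
      push_cast
      change (1 : ℂ) / (Real.pi * (1 + (σ r : ℂ) / r)) = _
      field_simp
    have hexps : planeWave α x t (-r) * Complex.exp (-Complex.I * -(σ r : ℂ) * y) =
        Complex.exp (Complex.I * (δ * t - α * t : ℝ)) * e r *
          Complex.exp (Complex.I * ((y - x) * σ r - t * σ r ^ 2 : ℝ)) := by
      simp only [he, planeWave, omega]
      rw [← Complex.exp_add, ← Complex.exp_add, ← Complex.exp_add]
      congr 1
      push_cast
      linear_combination (Complex.I * t) * hσsq'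
    simp only [transmitted]
    rw [hs, hsh, hcoef, mul_assoc, hexps]
    simp only [ha, hP', hc₀]
    ring
  refine ⟨?_, fun B hB => by rw [heq B hB]; exact key.2 B hB⟩
  obtain ⟨l, hl⟩ := key.1
  refine ⟨l, hl.congr' ?_⟩
  filter_upwards [eventually_ge_atTop R] with B hB
  exact (heq B hB).symm

/-- Convergence of the contour integral of a transmitted wave, uniformly in the source point. -/
lemma transmitted_kernel_convergence {α δ x t R : ℝ} (hR : 0 < R) (hRδ : |δ| < R ^ 2) (hx : x < 0)
    (ht : 0 < t) : ∃ C, ∀ y : ℝ, 0 ≤ y →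
    (∃ l, HasContourIntegral 3 R (fun k => transmitted α δ x t k *
      Complex.exp (-Complex.I * shiftedRoot δ k * y)) l) ∧
    ∀ A B, R ≤ A → R ≤ B → ‖truncatedContourIntegral 3 R (fun k => transmitted α δ x t k *
      Complex.exp (-Complex.I * shiftedRoot δ k * y)) A B‖ ≤ C := by
  obtain ⟨C, hC⟩ := transmitted_real_ray (α := α) (x := x) hR hRδ ht
  refine ⟨(∫ r in Set.Ioi R, Real.exp (x * r)) +
          Real.exp (R * |x| + 2 * (R * R) * t) * R * (Real.pi / 2) + C, fun y hy => ?_⟩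
  have hlt : ∀ k ∈ thirdQuadrant R, |δ| < ‖k‖ ^ 2 := fun k hk =>
    hRδ.trans_le (pow_le_pow_left₀ hR.le hk.2.2 2)
  have hexp : ∀ k ∈ thirdQuadrant R, ‖Complex.exp (-Complex.I * shiftedRoot δ k * y)‖ ≤ 1 :=
    fun k hk => by
      rw [norm_exp_neg_I_mul, Real.exp_le_one_iff]
      exact mul_nonpos_of_nonpos_of_nonneg (shiftedRoot_im_nonpos (hlt k hk) hk.2.1) hy
  have hb : ∀ k ∈ thirdQuadrant R, ‖transmitted α δ x t k *
      Complex.exp (-Complex.I * shiftedRoot δ k * y)‖ ≤ ‖planeWave α x t k‖ := fun k hk => by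
    rw [norm_mul]
    exact (mul_le_of_le_one_right (norm_nonneg _) (hexp k hk)).trans
      (norm_transmitted_le (hlt k hk))
  refine hasContourIntegral_of_rays hR hx ?_ ?_ ?_ (hC y).1 (hC y).2
  · refine ContinuousOn.mul (fun k hk =>
      (differentiableAt_transmitted (hlt k hk)).continuousAt.continuousWithinAt) ?_
    refine ContinuousOn.cexp (ContinuousOn.mul (continuousOn_const.mul fun k hk =>
      (differentiableAt_shiftedRoot (hlt k hk)).continuousAt.continuousWithinAt)
      continuousOn_const)
  · intro r hr
    refine (hb _ (neg_I_mul_mem hR.le hr)).trans_eq ?_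
    rw [norm_planeWave]
    simp [mul_comm]
  · exact fun k hk hkR => (hb k hk).trans (norm_planeWave_le ht.le hkR)

/-! ### Contour integrals of the transforms of the data -/

lemma truncatedContourIntegral_congr {f g : ℂ → ℂ} {ρ R A B : ℝ} (hρ : 0 ≤ ρ) (hR : ρ ≤ R)
    (hA : ρ ≤ A) (hB : ρ ≤ B) (h : ∀ k ∈ thirdQuadrant ρ, f k = g k) :
    truncatedContourIntegral 3 R f A B = truncatedContourIntegral 3 R g A B := by
  have hπ := Real.pi_pos
  rw [truncatedContourIntegral_three, truncatedContourIntegral_three]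
  refine congrArg₂ (· + ·) (congrArg₂ (· + ·) (congrArg Neg.neg ?_) ?_) ?_
  · refine intervalIntegral.integral_congr fun r hr => ?_
    rw [h _ (neg_I_mul_mem hρ ((le_min hR hA).trans hr.1))]
  · refine intervalIntegral.integral_congr fun θ hθ => ?_
    rw [Set.uIcc_of_ge (by linarith)] at hθ
    rw [h _ (circleMap_mem_thirdQuadrant hρ hR hθ.1 hθ.2)]
  · refine intervalIntegral.integral_congr fun r hr => ?_
    rw [h _ (neg_ofReal_mem hρ ((le_min hR hB).trans hr.1))]

/-- The data of a contour integrand `c k * ∫_S e^{-i n(k) y} g y dy`: the functions `c` and `n` are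
holomorphic for `|k| > ρ`, and the exponentials are bounded in the third quadrant. -/
structure IsTransformPair (S : Set ℝ) (ρ : ℝ) (c n : ℂ → ℂ) : Prop where
  differentiableOn_coeff : DifferentiableOn ℂ c {k | ρ < ‖k‖}
  differentiableOn_arg : DifferentiableOn ℂ n {k | ρ < ‖k‖}
  norm_exp_le : ∀ y ∈ S, ∀ k : ℂ, k.im ≤ 0 → ρ < ‖k‖ → ‖Complex.exp (-Complex.I * n k * y)‖ ≤ 1

namespace IsTransformPair

variable {S : Set ℝ} {ρ R : ℝ} {c n d m : ℂ → ℂ} {g : ℝ → ℂ} {l : ℂ}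

lemma isContourKernel (h : IsTransformPair S ρ c n) (hR : ρ < R) :
    IsContourKernel S R (fun y k => c k * Complex.exp (-Complex.I * n k * y)) :=
  have hsub : thirdQuadrant R ⊆ {k | ρ < ‖k‖} := fun _ hk => hR.trans_le hk.2.2
  isContourKernel_mul_exp (h.differentiableOn_coeff.continuousOn.mono hsub)
    (h.differentiableOn_arg.continuousOn.mono hsub)
    fun y hy k hk => h.norm_exp_le y hy k hk.2.1 (hsub hk)

lemma differentiableOn (h : IsTransformPair S ρ c n) (y : ℝ) :
    DifferentiableOn ℂ (fun k => c k * Complex.exp (-Complex.I * n k * y)) {k | ρ < ‖k‖} :=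
  h.differentiableOn_coeff.mul ((h.differentiableOn_arg.const_mul _).mul_const _).cexp

lemma truncated_eq (hS : MeasurableSet S) (hg : IntegrableOn g S) (h : IsTransformPair S ρ c n)
    (hρ : 0 < ρ) {A B : ℝ} (hR : ρ < R) (hA : ρ < A) (hB : ρ < B) :
    truncatedContourIntegral 3 R (fun k => c k * ∫ y in S, Complex.exp (-Complex.I * n k * y) * g y)
        A B = ∫ y in S, truncatedContourIntegral 3 R
          (fun k => c k * Complex.exp (-Complex.I * n k * y)) A B * g y := by
  obtain ⟨ρ', h1, h2⟩ := exists_between (lt_min hR (lt_min hA hB))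
  simp only [lt_min_iff] at h2
  rw [← ((h.isContourKernel h1).truncated_swap hS hg (hρ.trans h1) h2.1.le h2.2.1.le h2.2.2.le).2]
  congr 1
  ext k
  rw [← integral_const_mul]
  simp only [mul_assoc]

lemma truncated_radius (hS : MeasurableSet S) (hg : IntegrableOn g S) (h : IsTransformPair S ρ c n)
    (hρ : 0 < ρ) {R' A B : ℝ} (hR : ρ < R) (hR' : ρ < R') (hA : ρ < A) (hB : ρ < B) :
    truncatedContourIntegral 3 R (fun k => c k * ∫ y in S, Complex.exp (-Complex.I * n k * y) * g y)
        A B = truncatedContourIntegral 3 R'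
          (fun k => c k * ∫ y in S, Complex.exp (-Complex.I * n k * y) * g y) A B := by
  rw [h.truncated_eq hS hg hρ hR hA hB, h.truncated_eq hS hg hρ hR' hA hB]
  simp_rw [fun y => truncatedContourIntegral_radius 3 hρ (h.differentiableOn y) hR hR' hA hB]

/-- Convergence for one radius and uniform bounds on the truncated integrals of the kernels give
convergence. -/
lemma hasContourIntegral (hS : MeasurableSet S) (hg : IntegrableOn g S)
    (h : IsTransformPair S ρ c n) (hρ : 0 < ρ) (hR : ρ < R) {C : ℝ}
    (hC : ∀ y ∈ S, (∃ l, HasContourIntegral 3 R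
        (fun k => c k * Complex.exp (-Complex.I * n k * y)) l) ∧
      ∀ A B, R ≤ A → R ≤ B → ‖truncatedContourIntegral 3 R
        (fun k => c k * Complex.exp (-Complex.I * n k * y)) A B‖ ≤ C) :
    ∃ l, HasContourIntegral 3 R
      (fun k => c k * ∫ y in S, Complex.exp (-Complex.I * n k * y) * g y) l := by
  choose! l hl using fun y hy => (hC y hy).1
  refine ⟨∫ y in S, l y * g y, ?_⟩
  have := (h.isContourKernel hR).hasContourIntegral hS hg (hρ.trans hR) le_rfl
    (fun y hy => (hC y hy).2) hl
  convert this using 2 with k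
  rw [← integral_const_mul]
  simp only [mul_assoc]

lemma truncated_shiftedRoot (hS : MeasurableSet S) (hg : IntegrableOn g S)
    (h : IsTransformPair S ρ c n) (h' : IsTransformPair S ρ d m) (hρ : 0 < ρ) (hR : ρ < R)
    {δ R' A B : ℝ}
    (hd : ∀ k : ℂ, ρ < ‖k‖ → d k = c (shiftedRoot δ k) * (k / shiftedRoot δ k))
    (hm : ∀ k : ℂ, ρ < ‖k‖ → m k = n (shiftedRoot δ k))
    (hRR' : ρ < R') (hR'δ : ρ ^ 2 + |δ| < R' ^ 2) (p1 : R' ≤ A) (p2 : ρ < √(A ^ 2 - δ))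
    (p3 : R' ≤ B) (p4 : ρ < √(B ^ 2 + δ)) :
    truncatedContourIntegral 3 R (fun k => d k * ∫ y in S, Complex.exp (-Complex.I * m k * y) * g y)
        A B = truncatedContourIntegral 3 R
      (fun k => c k * ∫ y in S, Complex.exp (-Complex.I * n k * y) * g y)
      √(A ^ 2 - δ) √(B ^ 2 + δ) := by
  rw [h'.truncated_eq hS hg hρ hR (hRR'.trans_le p1) (hRR'.trans_le p3),
    h.truncated_eq hS hg hρ hR p2 p4]
  refine setIntegral_congr_fun hS fun y _ => congrArg (· * g y) ?_
  -- the substitution is exact for large radii, to which the circle may be moved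
  rw [truncatedContourIntegral_radius 3 hρ (h'.differentiableOn y) hR hRR' (hRR'.trans_le p1)
      (hRR'.trans_le p3),
    truncatedContourIntegral_radius 3 hρ (h.differentiableOn y) hR hRR' p2 p4,
    ← truncatedContourIntegral_shiftedRoot hρ (h.differentiableOn y) hRR' hR'δ p1 p3]
  refine truncatedContourIntegral_congr (hρ.trans hRR').le le_rfl p1 p3 fun k hk => ?_
  have hk' : ρ < ‖k‖ := hRR'.trans_le hk.2.2
  rw [hd k hk', hm k hk']
  ring

/-- The substitution `k ↦ shiftedRoot δ k` in the contour integral of a transform. -/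
lemma hasContourIntegral_shiftedRoot (hS : MeasurableSet S) (hg : IntegrableOn g S)
    (h : IsTransformPair S ρ c n) (h' : IsTransformPair S ρ d m) (hρ : 0 < ρ) (hR : ρ < R) {δ : ℝ}
    (hd : ∀ k : ℂ, ρ < ‖k‖ → d k = c (shiftedRoot δ k) * (k / shiftedRoot δ k))
    (hm : ∀ k : ℂ, ρ < ‖k‖ → m k = n (shiftedRoot δ k))
    (hl : HasContourIntegral 3 R
      (fun k => c k * ∫ y in S, Complex.exp (-Complex.I * n k * y) * g y) l) :
    HasContourIntegral 3 R
      (fun k => d k * ∫ y in S, Complex.exp (-Complex.I * m k * y) * g y) l := by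
  have hR'0 : 0 < max R (√(ρ ^ 2 + |δ|) + 1) := (hρ.trans hR).trans_le (le_max_left _ _)
  have hR'δ : ρ ^ 2 + |δ| < max R (√(ρ ^ 2 + |δ|) + 1) ^ 2 :=
    (Real.sqrt_lt' hR'0).1 ((lt_add_one _).trans_le (le_max_right _ _))
  have hlim : ∀ η : ℝ, Tendsto (fun A : ℝ => √(A ^ 2 + η)) atTop atTop := fun η =>
    Real.tendsto_sqrt_atTop.comp
      (tendsto_atTop_add_const_right _ _ (tendsto_pow_atTop two_ne_zero))
  have hA : Tendsto (fun A : ℝ => √(A ^ 2 - δ)) atTop atTop := hlim (-δ)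
  have hB := hlim δ
  have hcomp := Tendsto.comp hl (hA.prodMap hB)
  refine Tendsto.congr' ?_ hcomp
  have ev := ((eventually_ge_atTop (max R (√(ρ ^ 2 + |δ|) + 1))).and
    (hA.eventually_gt_atTop ρ)).prod_mk ((eventually_ge_atTop (max R (√(ρ ^ 2 + |δ|) + 1))).and
    (hB.eventually_gt_atTop ρ))
  filter_upwards [ev] with p hp
  exact (h.truncated_shiftedRoot hS hg h' hρ hR hd hm (hR.trans_le (le_max_left _ _)) hR'δ
    hp.1.1 hp.1.2 hp.2.1 hp.2.2).symm

end IsTransformPair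

/-! ### The branches `ν⁽ʲ⁾` -/

lemma nu_I_mul (α : ℝ) (k : ℂ) : nu α (Complex.I * k) = -shiftedRoot (-α) k := by
  have h : 1 + (α : ℂ) / (Complex.I * k) ^ 2 = 1 + ((-α : ℝ) : ℂ) / k ^ 2 := by
    rw [mul_pow, Complex.I_sq]; push_cast; rw [neg_one_mul, div_neg, neg_div]
  rw [nu, shiftedRoot, h, ← mul_assoc, Complex.I_mul_I]
  ring

lemma shiftedRoot_add_ne_zero {a b : ℝ} {k : ℂ} (ha : |a| < ‖k‖ ^ 2) (hb : |b| < ‖k‖ ^ 2) :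
    shiftedRoot a k + shiftedRoot b k ≠ 0 := by
  intro h
  have h1 := shiftedRoot_div_re_pos ha
  have h2 := shiftedRoot_div_re_pos hb
  have h3 : (shiftedRoot a k / k).re + (shiftedRoot b k / k).re = 0 := by
    rw [← Complex.add_re, ← add_div, h, zero_div, Complex.zero_re]
  linarith

lemma abs_le_of_max {α₁ α₂ ρ : ℝ} (h : 2 * max |α₁| |α₂| < ρ ^ 2) :
    2 * |α₁| < ρ ^ 2 ∧ 2 * |α₂| < ρ ^ 2 ∧ |α₁ - α₂| < ρ ^ 2 := by
  have h1 := le_max_left |α₁| |α₂|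
  have h2 := le_max_right |α₁| |α₂|
  refine ⟨by linarith, by linarith, ?_⟩
  have := abs_sub α₁ α₂
  linarith

/-- The substitution `k = -ν⁽¹⁾` turns the branch `shiftedRoot (α₁ - α₂) k` into `-ν⁽²⁾`. -/
lemma shiftedRoot_sub_shiftedRoot {α₁ α₂ : ℝ} {k : ℂ} (h1 : 2 * |α₁| < ‖k‖ ^ 2)
    (h2 : 2 * |α₂| < ‖k‖ ^ 2) :
    shiftedRoot (α₁ - α₂) (shiftedRoot (-α₁) k) = shiftedRoot (-α₂) k := by
  have e : α₁ - α₂ + -α₁ = -α₂ := by ring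
  rw [shiftedRoot_shiftedRoot (by rwa [abs_neg]) (by rw [e]; rwa [abs_neg]), e]

variable {α₁ α₂ x t ρ : ℝ}

lemma isTransformPair_reflected (hρ : 0 < ρ) (hδ : |α₁ - α₂| < ρ ^ 2) :
    IsTransformPair (Set.Iio 0) ρ (reflected α₁ (α₁ - α₂) x t) (fun k => -k) where
  differentiableOn_coeff := fun k hk => (differentiableAt_reflected
    (hδ.trans_le (pow_le_pow_left₀ hρ.le (le_of_lt hk) 2))).differentiableWithinAt
  differentiableOn_arg := differentiable_neg.differentiableOn
  norm_exp_le := fun y hy k hk _ => norm_exp_neg_I_mul_le (by simpa using hk) (le_of_lt hy)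

lemma isTransformPair_transmitted (hρ : 0 < ρ) (hδ : |α₁ - α₂| < ρ ^ 2) :
    IsTransformPair (Set.Ioi 0) ρ (transmitted α₁ (α₁ - α₂) x t) (shiftedRoot (α₁ - α₂)) where
  differentiableOn_coeff := fun k hk => (differentiableAt_transmitted
    (hδ.trans_le (pow_le_pow_left₀ hρ.le (le_of_lt hk) 2))).differentiableWithinAt
  differentiableOn_arg := fun k hk => (differentiableAt_shiftedRoot
    (hδ.trans_le (pow_le_pow_left₀ hρ.le (le_of_lt hk) 2))).differentiableWithinAt
  norm_exp_le := fun y hy k hk hk' => by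
    rw [norm_exp_neg_I_mul, Real.exp_le_one_iff]
    exact mul_nonpos_of_nonpos_of_nonneg (shiftedRoot_im_nonpos
      (hδ.trans_le (pow_le_pow_left₀ hρ.le hk'.le 2)) hk) (le_of_lt hy)

/-- The kernel of the reflected wave in the variable `κ = i k`, where
`ν⁽ʲ⁾(κ) = -shiftedRoot (-αⱼ) k`, times the factor `i` of `dκ = i dk`. -/
noncomputable def reflectedNu (α₁ α₂ x t : ℝ) (k : ℂ) : ℂ :=
  k * (shiftedRoot (-α₁) k - shiftedRoot (-α₂) k) /
    (2 * Real.pi * shiftedRoot (-α₁) k * (shiftedRoot (-α₁) k + shiftedRoot (-α₂) k)) *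
    Complex.exp (Complex.I * shiftedRoot (-α₁) k * x - Complex.I * k ^ 2 * t)

/-- The kernel of the transmitted wave in the variable `κ = i k`, times the factor `i` of
`dκ = i dk`. -/
noncomputable def transmittedNu (α₁ α₂ x t : ℝ) (k : ℂ) : ℂ :=
  k / (Real.pi * (shiftedRoot (-α₁) k + shiftedRoot (-α₂) k)) *
    Complex.exp (Complex.I * shiftedRoot (-α₁) k * x - Complex.I * k ^ 2 * t)

lemma planeWave_shiftedRoot {k : ℂ} (hk : k ≠ 0) :
    planeWave α₁ x t (shiftedRoot (-α₁) k) =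
      Complex.exp (Complex.I * shiftedRoot (-α₁) k * x - Complex.I * k ^ 2 * t) := by
  rw [planeWave, omega, shiftedRoot_sq hk]
  congr 1
  push_cast
  ring

lemma sqrt_at_shiftedRoot {k : ℂ} (h1 : 2 * |α₁| < ‖k‖ ^ 2) (h2 : 2 * |α₂| < ‖k‖ ^ 2) :
    Complex.sqrt (1 + ((α₁ - α₂ : ℝ) : ℂ) / shiftedRoot (-α₁) k ^ 2) =
      shiftedRoot (-α₂) k / shiftedRoot (-α₁) k := by
  have h1' : |-α₁| < ‖k‖ ^ 2 := by rw [abs_neg]; linarith [abs_nonneg α₁]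
  have h := shiftedRoot_sub_shiftedRoot h1 h2
  rw [eq_div_iff (shiftedRoot_ne_zero h1'), ← h, mul_comm]
  rfl

lemma reflectedNu_eq {k : ℂ} (h1 : 2 * |α₁| < ‖k‖ ^ 2) (h2 : 2 * |α₂| < ‖k‖ ^ 2) :
    reflectedNu α₁ α₂ x t k = reflected α₁ (α₁ - α₂) x t (shiftedRoot (-α₁) k) *
      (k / shiftedRoot (-α₁) k) := by
  have h1' : |-α₁| < ‖k‖ ^ 2 := by rw [abs_neg]; linarith [abs_nonneg α₁]
  have h2' : |-α₂| < ‖k‖ ^ 2 := by rw [abs_neg]; linarith [abs_nonneg α₂]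
  have n1 := shiftedRoot_ne_zero h1'
  have n2 := shiftedRoot_add_ne_zero h1' h2'
  have hπ : (Real.pi : ℂ) ≠ 0 := by exact_mod_cast Real.pi_ne_zero
  rw [reflected, planeWave_shiftedRoot (ne_zero_of_abs_lt h1'), sqrt_at_shiftedRoot h1 h2,
    reflectedNu]
  field_simp

lemma transmittedNu_eq {k : ℂ} (h1 : 2 * |α₁| < ‖k‖ ^ 2) (h2 : 2 * |α₂| < ‖k‖ ^ 2) :
    transmittedNu α₁ α₂ x t k = transmitted α₁ (α₁ - α₂) x t (shiftedRoot (-α₁) k) *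
      (k / shiftedRoot (-α₁) k) := by
  have h1' : |-α₁| < ‖k‖ ^ 2 := by rw [abs_neg]; linarith [abs_nonneg α₁]
  have h2' : |-α₂| < ‖k‖ ^ 2 := by rw [abs_neg]; linarith [abs_nonneg α₂]
  have n1 := shiftedRoot_ne_zero h1'
  have n2 := shiftedRoot_add_ne_zero h1' h2'
  have hπ : (Real.pi : ℂ) ≠ 0 := by exact_mod_cast Real.pi_ne_zero
  rw [transmitted, planeWave_shiftedRoot (ne_zero_of_abs_lt h1'), sqrt_at_shiftedRoot h1 h2,
    transmittedNu]
  field_simp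

lemma isTransformPair_reflectedNu (hρ : 0 < ρ) (h : 2 * max |α₁| |α₂| < ρ ^ 2) :
    IsTransformPair (Set.Iio 0) ρ (reflectedNu α₁ α₂ x t) (fun k => -shiftedRoot (-α₁) k) := by
  obtain ⟨h1, h2, -⟩ := abs_le_of_max h
  have hlt : ∀ a : ℝ, 2 * |a| < ρ ^ 2 → ∀ k : ℂ, ρ < ‖k‖ → |-a| < ‖k‖ ^ 2 := fun a ha k hk => by
    have := pow_le_pow_left₀ hρ.le hk.le 2
    rw [abs_neg]; linarith [abs_nonneg a]
  have hπ : (Real.pi : ℂ) ≠ 0 := by exact_mod_cast Real.pi_ne_zero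
  refine ⟨fun k hk => ?_, fun k hk => ?_, fun y hy k hk hk' => ?_⟩
  · have d1 := differentiableAt_shiftedRoot (hlt α₁ h1 k hk)
    have d2 := differentiableAt_shiftedRoot (hlt α₂ h2 k hk)
    refine DifferentiableAt.differentiableWithinAt ?_
    refine DifferentiableAt.mul (DifferentiableAt.div (differentiableAt_id.mul (d1.sub d2))
      ((d1.const_mul _).mul (d1.add d2)) ?_) ?_
    · exact mul_ne_zero (mul_ne_zero (mul_ne_zero two_ne_zero hπ)
        (shiftedRoot_ne_zero (hlt α₁ h1 k hk)))
        (shiftedRoot_add_ne_zero (hlt α₁ h1 k hk) (hlt α₂ h2 k hk))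
    · exact (((d1.const_mul _).mul_const _).sub (by fun_prop)).cexp
  · exact (differentiableAt_shiftedRoot (hlt α₁ h1 k hk)).neg.differentiableWithinAt
  · refine norm_exp_neg_I_mul_le ?_ (le_of_lt hy)
    have := shiftedRoot_im_nonpos (hlt α₁ h1 k hk') hk
    simpa using this

lemma isTransformPair_transmittedNu (hρ : 0 < ρ) (h : 2 * max |α₁| |α₂| < ρ ^ 2) :
    IsTransformPair (Set.Ioi 0) ρ (transmittedNu α₁ α₂ x t) (shiftedRoot (-α₂)) := by
  obtain ⟨h1, h2, -⟩ := abs_le_of_max h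
  have hlt : ∀ a : ℝ, 2 * |a| < ρ ^ 2 → ∀ k : ℂ, ρ < ‖k‖ → |-a| < ‖k‖ ^ 2 := fun a ha k hk => by
    have := pow_le_pow_left₀ hρ.le hk.le 2
    rw [abs_neg]; linarith [abs_nonneg a]
  have hπ : (Real.pi : ℂ) ≠ 0 := by exact_mod_cast Real.pi_ne_zero
  refine ⟨fun k hk => ?_, fun k hk => ?_, fun y hy k hk hk' => ?_⟩
  · have d1 := differentiableAt_shiftedRoot (hlt α₁ h1 k hk)
    have d2 := differentiableAt_shiftedRoot (hlt α₂ h2 k hk)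
    refine DifferentiableAt.differentiableWithinAt ?_
    refine DifferentiableAt.mul (DifferentiableAt.div differentiableAt_id
      ((d1.add d2).const_mul _) ?_) ?_
    · exact mul_ne_zero hπ (shiftedRoot_add_ne_zero (hlt α₁ h1 k hk) (hlt α₂ h2 k hk))
    · exact (((d1.const_mul _).mul_const _).sub (by fun_prop)).cexp
  · exact (differentiableAt_shiftedRoot (hlt α₂ h2 k hk)).differentiableWithinAt
  · rw [norm_exp_neg_I_mul, Real.exp_le_one_iff]
    exact mul_nonpos_of_nonpos_of_nonneg (shiftedRoot_im_nonpos (hlt α₂ h2 k hk') hk) (le_of_lt hy)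

lemma exists_threshold {R : ℝ} (hR : √(2 * max |α₁| |α₂|) < R) :
    ∃ ρ, 0 < ρ ∧ ρ < R ∧ 2 * max |α₁| |α₂| < ρ ^ 2 := by
  obtain ⟨ρ, h1, h2⟩ := exists_between hR
  have h0 : 0 < ρ := (Real.sqrt_nonneg _).trans_lt h1
  exact ⟨ρ, h0, h2, (Real.sqrt_lt' h0).1 h1⟩

/-- The two forms of a contour integral over a transform converge, for all radii, to a common
limit, once this is known of the kernels of the first form for one radius. -/
lemma exists_hasContourIntegral {S : Set ℝ} (hS : MeasurableSet S) {g : ℝ → ℂ}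
    (hg : IntegrableOn g S) {c n d m : ℂ → ℂ}
    (hcn : ∀ ρ : ℝ, 0 < ρ → 2 * max |α₁| |α₂| < ρ ^ 2 → IsTransformPair S ρ c n)
    (hdm : ∀ ρ : ℝ, 0 < ρ → 2 * max |α₁| |α₂| < ρ ^ 2 → IsTransformPair S ρ d m)
    (hconv : ∀ R : ℝ, √(2 * max |α₁| |α₂|) < R → ∃ C, ∀ y ∈ S, (∃ l, HasContourIntegral 3 R
        (fun k => c k * Complex.exp (-Complex.I * n k * y)) l) ∧
      ∀ A B, R ≤ A → R ≤ B → ‖truncatedContourIntegral 3 R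
        (fun k => c k * Complex.exp (-Complex.I * n k * y)) A B‖ ≤ C)
    (hd : ∀ k : ℂ, 2 * |α₁| < ‖k‖ ^ 2 → 2 * |α₂| < ‖k‖ ^ 2 →
      d k = c (shiftedRoot (-α₁) k) * (k / shiftedRoot (-α₁) k))
    (hm : ∀ k : ℂ, 2 * |α₁| < ‖k‖ ^ 2 → 2 * |α₂| < ‖k‖ ^ 2 → m k = n (shiftedRoot (-α₁) k)) :
    ∃ l, ∀ R : ℝ, √(2 * max |α₁| |α₂|) < R →
      HasContourIntegral 3 R
        (fun k => c k * ∫ y in S, Complex.exp (-Complex.I * n k * y) * g y) l ∧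
      HasContourIntegral 3 R
        (fun k => d k * ∫ y in S, Complex.exp (-Complex.I * m k * y) * g y) l := by
  set R₀ := √(2 * max |α₁| |α₂|) + 1 with hR₀
  have hR₀' : √(2 * max |α₁| |α₂|) < R₀ := lt_add_one _
  obtain ⟨ρ₀, p1, p2, p3⟩ := exists_threshold hR₀'
  obtain ⟨C, hC⟩ := hconv R₀ hR₀'
  obtain ⟨l, hl⟩ := (hcn ρ₀ p1 p3).hasContourIntegral hS hg p1 p2 hC
  refine ⟨l, fun R hR => ?_⟩
  obtain ⟨ρ, q1, q2, q3⟩ := exists_threshold (lt_min hR hR₀')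
  rw [lt_min_iff] at q2
  have hl' : HasContourIntegral 3 R
      (fun k => c k * ∫ y in S, Complex.exp (-Complex.I * n k * y) * g y) l := by
    refine Tendsto.congr' ?_ hl
    filter_upwards [(eventually_gt_atTop ρ).prod_mk (eventually_gt_atTop ρ)] with p hp
    exact (hcn ρ q1 q3).truncated_radius hS hg q1 q2.2 q2.1 hp.1 hp.2
  have hk2 : ∀ k : ℂ, ρ < ‖k‖ → 2 * |α₁| < ‖k‖ ^ 2 ∧ 2 * |α₂| < ‖k‖ ^ 2 := fun k hk => by
    obtain ⟨h1, h2, -⟩ := abs_le_of_max q3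
    have := pow_le_pow_left₀ q1.le hk.le 2
    exact ⟨by linarith, by linarith⟩
  exact ⟨hl', (hcn ρ q1 q3).hasContourIntegral_shiftedRoot hS hg (hdm ρ q1 q3) q1 q2.1
    (fun k hk => hd k (hk2 k hk).1 (hk2 k hk).2) (fun k hk => hm k (hk2 k hk).1 (hk2 k hk).2) hl'⟩

/-- The integrals of the reflected wave converge, to a value independent of the radius and common to
the two forms. -/
lemma exists_reflected_integral {g : ℝ → ℂ} (hg : Integrable g) (hx : x < 0) (ht : 0 < t) :
    ∃ l, ∀ R : ℝ, √(2 * max |α₁| |α₂|) < R →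
      HasContourIntegral 3 R
        (fun k => reflected α₁ (α₁ - α₂) x t k * fourierNeg g (-k)) l ∧
      HasContourIntegral 3 R
        (fun k => reflectedNu α₁ α₂ x t k * fourierNeg g (-shiftedRoot (-α₁) k)) l := by
  refine exists_hasContourIntegral measurableSet_Iio hg.integrableOn
    (fun ρ h1 h2 => isTransformPair_reflected h1 (abs_le_of_max h2).2.2)
    (fun ρ h1 h2 => isTransformPair_reflectedNu h1 h2) (fun R hR => ?_)
    (fun k => reflectedNu_eq) (fun k _ _ => rfl)
  obtain ⟨ρ, h1, h2, h3⟩ := exists_threshold hR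
  have hδ := (abs_le_of_max h3).2.2.trans_le (pow_le_pow_left₀ h1.le h2.le 2)
  exact ⟨_, fun y hy => reflected_kernel_convergence (h1.trans h2) hδ hx ht (le_of_lt hy)⟩

/-- The integrals of the transmitted wave converge, to a value independent of the radius and common
to the two forms. -/
lemma exists_transmitted_integral {g : ℝ → ℂ} (hg : Integrable g) (hx : x < 0) (ht : 0 < t) :
    ∃ l, ∀ R : ℝ, √(2 * max |α₁| |α₂|) < R →
      HasContourIntegral 3 R
        (fun k => transmitted α₁ (α₁ - α₂) x t k * fourierPos g (shiftedRoot (α₁ - α₂) k)) l ∧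
      HasContourIntegral 3 R
        (fun k => transmittedNu α₁ α₂ x t k * fourierPos g (shiftedRoot (-α₂) k)) l := by
  refine exists_hasContourIntegral measurableSet_Ioi hg.integrableOn
    (fun ρ h1 h2 => isTransformPair_transmitted h1 (abs_le_of_max h2).2.2)
    (fun ρ h1 h2 => isTransformPair_transmittedNu h1 h2) (fun R hR => ?_)
    (fun k => transmittedNu_eq) (fun k h1 h2 => (shiftedRoot_sub_shiftedRoot h1 h2).symm)
  obtain ⟨ρ, h1, h2, h3⟩ := exists_threshold hR
  have hδ := (abs_le_of_max h3).2.2.trans_le (pow_le_pow_left₀ h1.le h2.le 2)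
  obtain ⟨C, hC⟩ := transmitted_kernel_convergence (α := α₁) (h1.trans h2) hδ hx ht
  exact ⟨C, fun y hy => hC y (le_of_lt hy)⟩

/-- The integral over the real line of the free evolution of data on the left half-line converges,
by dominated convergence from the Fresnel integrals. -/
lemma exists_hasLineIntegral {g : ℝ → ℂ} (hg : Integrable g) (α x : ℝ) (ht : 0 < t) :
    ∃ l, HasLineIntegral (fun k => planeWave α x t k * fourierNeg g k) l := by
  obtain ⟨C, hC⟩ := fresnel_bounded ht
  have hinner : ∀ y a b : ℝ, ∫ k in a..b, planeWave α x t k * Complex.exp (-Complex.I * k * y) =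
      Complex.exp (Complex.I * (-(α * t) : ℝ)) * (fresnel t (x - y) b - fresnel t (x - y) a) := by
    intro y a b
    unfold fresnel
    rw [intervalIntegral.integral_interval_sub_left
      (Continuous.intervalIntegrable (by fun_prop) _ _)
      (Continuous.intervalIntegrable (by fun_prop) _ _), ← intervalIntegral.integral_const_mul]
    refine intervalIntegral.integral_congr fun k _ => ?_
    simp only [planeWave, omega]
    rw [← Complex.exp_add, ← Complex.exp_add]
    congr 1
    push_cast
    ring
  have hcont : Continuous (Function.uncurry fun y k : ℝ =>
      planeWave α x t k * Complex.exp (-Complex.I * k * y)) := by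
    unfold planeWave omega Function.uncurry
    fun_prop
  have hnorm : ∀ y k : ℝ, ‖planeWave α x t k * Complex.exp (-Complex.I * k * y)‖ ≤ 1 := by
    intro y k
    rw [norm_mul, norm_exp_neg_I_mul_real, norm_planeWave]
    simp
  have hswap := fun a b : ℝ => integral_swap (S := Set.Iio 0) (a := a) (b := b) measurableSet_Iio
    hcont.continuousOn (fun y _ k _ => hnorm y k) hg.integrableOn
  choose lp hlp using fun y => fresnel_tendsto_atTop ht (x - y)
  choose lm hlm using fun y => fresnel_tendsto_atBot ht (x - y)
  refine ⟨∫ y in Set.Iio (0 : ℝ), Complex.exp (Complex.I * (-(α * t) : ℝ)) * (lp y - lm y) * g y,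
    ?_⟩
  have key : Tendsto (fun p : ℝ × ℝ => ∫ y in Set.Iio (0 : ℝ), (∫ k in p.1..p.2,
      planeWave α x t k * Complex.exp (-Complex.I * k * y)) * g y) (atBot ×ˢ atTop)
      (𝓝 (∫ y in Set.Iio (0 : ℝ),
        Complex.exp (Complex.I * (-(α * t) : ℝ)) * (lp y - lm y) * g y)) := by
    refine tendsto_integral_filter_of_dominated_convergence (fun y => (C + C) * ‖g y‖) ?_ ?_ ?_ ?_
    · exact Eventually.of_forall fun p => (hswap p.1 p.2).2.1.aestronglyMeasurable
    · refine Eventually.of_forall fun p => Eventually.of_forall fun y => ?_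
      rw [norm_mul, hinner, norm_mul, norm_exp_I_mul_real, one_mul]
      exact mul_le_mul_of_nonneg_right ((norm_sub_le _ _).trans (add_le_add (hC _ _) (hC _ _)))
        (norm_nonneg _)
    · exact hg.integrableOn.norm.const_mul _
    · refine Eventually.of_forall fun y => ?_
      simp_rw [hinner]
      exact ((((hlp y).comp tendsto_snd).sub ((hlm y).comp tendsto_fst)).const_mul _).mul_const _
  refine key.congr fun p => ?_
  rw [← (hswap p.1 p.2).2.2]
  refine intervalIntegral.integral_congr fun k _ => ?_
  simp only [fourierNeg]
  rw [← integral_const_mul]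
  simp only [mul_assoc]

/-! ### Reflection in the interface -/

section Reflection

variable {α₁ α₂ : ℝ} {ψ₀ : ℝ → ℂ} {ψ : ℝ → ℝ → ℂ}

lemma dx_reflect (ψ : ℝ → ℝ → ℂ) (x t : ℝ) : dx (fun y s => ψ (-y) s) x t = -dx ψ (-x) t :=
  deriv_comp_neg (fun y => ψ y t) x

lemma dxx_reflect (ψ : ℝ → ℝ → ℂ) (x t : ℝ) : dxx (fun y s => ψ (-y) s) x t = dxx ψ (-x) t := by
  unfold dxx
  simp_rw [dx_reflect]
  rw [deriv.fun_neg, deriv_comp_neg (fun y => dx ψ y t) x, neg_neg]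

lemma integrableOn_strip_reflect {f : ℝ × ℝ → ℂ} {T : ℝ}
    (hf : IntegrableOn f (Set.univ ×ˢ Set.Ioo 0 T)) :
    IntegrableOn (fun p : ℝ × ℝ => f (-p.1, p.2)) (Set.univ ×ˢ Set.Ioo 0 T) := by
  have hprod : (volume : Measure (ℝ × ℝ)).restrict (Set.univ ×ˢ Set.Ioo 0 T) =
      (volume : Measure ℝ).prod (volume.restrict (Set.Ioo 0 T)) := by
    rw [Measure.volume_eq_prod, ← Measure.prod_restrict, Measure.restrict_univ]
  rw [IntegrableOn, hprod] at hf ⊢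
  have hmp := (Measure.measurePreserving_neg (volume : Measure ℝ)).prod
    (MeasurePreserving.id (volume.restrict (Set.Ioo 0 T)))
  exact (hmp.integrable_comp hf.aestronglyMeasurable).2 hf

/-- Reflection in the interface exchanges the two half-lines. -/
lemma IsSolution.reflect (hψ : IsSolution α₁ α₂ ψ₀ ψ) :
    IsSolution α₂ α₁ (fun x => ψ₀ (-x)) (fun x t => ψ (-x) t) where
  continuousOn := hψ.continuousOn.comp (f := fun p : ℝ × ℝ => (-p.1, p.2)) (by fun_prop)
    fun _ hp => hp
  initial x := hψ.initial (-x)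
  differentiableAt_x x t ht :=
    (hψ.differentiableAt_x (-x) t ht).comp x differentiable_neg.differentiableAt
  continuousOn_dx := by
    simp_rw [dx_reflect]
    exact (hψ.continuousOn_dx.comp (f := fun p : ℝ × ℝ => (-p.1, p.2)) (by fun_prop)
      fun _ hp => hp).neg
  differentiableAt_dx x t hx ht := by
    simp_rw [dx_reflect]
    exact ((hψ.differentiableAt_dx (-x) t (neg_ne_zero.2 hx) ht).comp x
      differentiable_neg.differentiableAt).neg
  differentiableAt_t x t hx ht := hψ.differentiableAt_t (-x) t (neg_ne_zero.2 hx) ht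
  continuousOn_dt := hψ.continuousOn_dt.comp (f := fun p : ℝ × ℝ => (-p.1, p.2)) (by fun_prop)
    fun _ hp => ⟨neg_ne_zero.2 hp.1, hp.2⟩
  equation x t hx ht := by
    have h := hψ.equation (-x) t (neg_ne_zero.2 hx) ht
    have hpot : potential α₂ α₁ x = potential α₁ α₂ (-x) := by
      unfold potential
      rcases lt_or_gt_of_ne hx with h1 | h1
      · rw [if_pos h1, if_neg (by linarith)]
      · rw [if_neg (by linarith), if_pos (by linarith)]
    rw [dxx_reflect, hpot]
    exact h
  tendsto_atTop t ht := (hψ.tendsto_atBot t ht).comp tendsto_neg_atTop_atBot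
  tendsto_atBot t ht := (hψ.tendsto_atTop t ht).comp tendsto_neg_atBot_atTop
  integrable t ht := (hψ.integrable t ht).comp_neg
  integrable_dx t ht := by
    simp_rw [dx_reflect]
    exact (hψ.integrable_dx t ht).comp_neg.neg
  integrableOn_strip T hT := integrableOn_strip_reflect (hψ.integrableOn_strip T hT)
  integrableOn_strip_dx T hT := by
    simp_rw [dx_reflect]
    exact (integrableOn_strip_reflect (hψ.integrableOn_strip_dx T hT)).neg
  integrableOn_trace_dx T hT := by
    simp_rw [dx_reflect, neg_zero]
    exact (hψ.integrableOn_trace_dx T hT).neg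

lemma omega_neg (α : ℝ) (k : ℂ) : omega α (-k) = omega α k := by
  rw [omega, omega, neg_sq]

/-- The global relation for the right half-line. -/
lemma IsSolution.global_relation_right (hψ₀ : Integrable ψ₀) (hψ : IsSolution α₁ α₂ ψ₀ ψ) {k : ℂ}
    (hk : k.im ≤ 0) {t : ℝ} (ht : 0 < t) :
    fourierPos (fun x => ψ x t) k = Complex.exp (-omega α₂ k * t) * fourierPos ψ₀ k +
      ∫ s in (0 : ℝ)..t, Complex.exp (-omega α₂ k * (t - s)) *
        (-(Complex.I * dx ψ 0 s) + k * ψ 0 s) := by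
  have h := hψ.reflect.global_relation hψ₀.comp_neg (k := -k) (by simpa using hk) ht
  rw [omega_neg, ← fourierPos_eq_fourierNeg ψ₀ k] at h
  rw [fourierPos_eq_fourierNeg (fun x => ψ x t) k]
  refine h.trans ?_
  congr 1
  refine intervalIntegral.integral_congr fun s _ => ?_
  simp only [dx_reflect, neg_zero]
  ring

end Reflection

/-! ### Elimination of the boundary values -/

section Elimination

variable {α₁ α₂ : ℝ} {ψ₀ : ℝ → ℂ} {ψ : ℝ → ℝ → ℂ} {x t : ℝ}

/-- The contribution to the spectral representation of the waves scattered at the interface, for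
data `g` a time `τ` earlier. -/
noncomputable def scattered (α₁ α₂ x τ : ℝ) (g : ℝ → ℂ) (k : ℂ) : ℂ :=
  reflected α₁ (α₁ - α₂) x τ k * fourierNeg g (-k) +
    transmitted α₁ (α₁ - α₂) x τ k * fourierPos g (shiftedRoot (α₁ - α₂) k)

/-- The boundary term of the global relation of the left half-line, with the factor `e^{ikx}`. -/
noncomputable def boundaryTerm (α : ℝ) (ψ : ℝ → ℝ → ℂ) (x t : ℝ) (k : ℂ) : ℂ :=
  Complex.exp (Complex.I * k * x) * ∫ s in (0 : ℝ)..t, Complex.exp (-omega α k * (t - s)) *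
    (Complex.I * dx ψ 0 s - k * ψ 0 s)

lemma IsSolution.integrableOn_Icc_trace_dx (hψ : IsSolution α₁ α₂ ψ₀ ψ) (ht : 0 < t) :
    IntegrableOn (fun s => dx ψ 0 s) (Set.Icc 0 t) := by
  rw [integrableOn_Icc_iff_integrableOn_Ioo]
  exact hψ.integrableOn_trace_dx t ht

lemma IsSolution.integrableOn_Icc_trace (hψ : IsSolution α₁ α₂ ψ₀ ψ) :
    IntegrableOn (fun s => ψ 0 s) (Set.Icc 0 t) := by
  refine ContinuousOn.integrableOn_Icc ?_
  exact hψ.continuousOn.comp (f := fun s : ℝ => ((0 : ℝ), s)) (by fun_prop) fun s hs => hs.1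

/-- The two global relations, taken at `-k` and at `shiftedRoot (α₁ - α₂) k`, where the time
exponents agree, form a linear system for the two boundary values. Its solution expresses the
boundary term by transforms of the data and of the solution at time `t`. -/
lemma IsSolution.boundaryTerm_eq (hψ₀ : Integrable ψ₀) (hψ : IsSolution α₁ α₂ ψ₀ ψ) (ht : 0 < t)
    {k : ℂ} (hk : k.im ≤ 0) (hδ : |α₁ - α₂| < ‖k‖ ^ 2) :
    boundaryTerm α₁ ψ x t k = 2 * Real.pi *
      (scattered α₁ α₂ x t ψ₀ k - scattered α₁ α₂ x 0 (fun y => ψ y t) k) := by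
  have h1 := hψ.global_relation hψ₀ (k := -k) (by simpa using hk) ht
  have h2 := hψ.global_relation_right hψ₀ (shiftedRoot_im_nonpos hδ hk) ht
  have hω : omega α₂ (shiftedRoot (α₁ - α₂) k) = omega α₁ k := by
    rw [omega, omega, shiftedRoot_sq (ne_zero_of_abs_lt hδ)]; push_cast; ring
  rw [omega_neg] at h1
  rw [hω] at h2
  have hX : IntervalIntegrable (fun s : ℝ => Complex.exp (-omega α₁ k * (t - s)) * dx ψ 0 s)
      volume 0 t := by
    have := (intervalIntegrable_iff_integrableOn_Icc_of_le ht.le).2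
      (hψ.integrableOn_Icc_trace_dx ht)
    exact this.continuousOn_mul (Continuous.continuousOn (by fun_prop))
  have hY : IntervalIntegrable (fun s : ℝ => Complex.exp (-omega α₁ k * (t - s)) * ψ 0 s)
      volume 0 t := by
    have := (intervalIntegrable_iff_integrableOn_Icc_of_le ht.le).2
      (hψ.integrableOn_Icc_trace (t := t))
    exact this.continuousOn_mul (Continuous.continuousOn (by fun_prop))
  set X := ∫ s in (0 : ℝ)..t, Complex.exp (-omega α₁ k * (t - s)) * dx ψ 0 s with hXdef
  set Y := ∫ s in (0 : ℝ)..t, Complex.exp (-omega α₁ k * (t - s)) * ψ 0 s with hYdef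
  have hlin : ∀ a b : ℂ, ∫ s in (0 : ℝ)..t, Complex.exp (-omega α₁ k * (t - s)) *
      (a * dx ψ 0 s + b * ψ 0 s) = a * X + b * Y := by
    intro a b
    rw [hXdef, hYdef, ← intervalIntegral.integral_const_mul, ← intervalIntegral.integral_const_mul,
      ← intervalIntegral.integral_add (hX.const_mul a) (hY.const_mul b)]
    refine intervalIntegral.integral_congr fun s _ => ?_
    ring
  have e0 := hlin Complex.I (-k)
  have e1 := hlin Complex.I k
  have e2 := hlin (-Complex.I) (shiftedRoot (α₁ - α₂) k)
  simp only [sub_neg_eq_add, neg_mul, ← sub_eq_add_neg] at e0 e1 e2 h1 h2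
  rw [e1] at h1
  rw [e2] at h2
  have hs := one_add_sqrt_ne_zero hδ
  have hπ : (Real.pi : ℂ) ≠ 0 := by exact_mod_cast Real.pi_ne_zero
  have hpw : planeWave α₁ x t k = Complex.exp (Complex.I * k * x) *
      Complex.exp (-(omega α₁ k * t)) := by
    rw [planeWave, ← Complex.exp_add, sub_eq_add_neg]
  have hpw0 : planeWave α₁ x 0 k = Complex.exp (Complex.I * k * x) := by simp [planeWave]
  have hK : shiftedRoot (α₁ - α₂) k = k * Complex.sqrt (1 + ((α₁ - α₂ : ℝ) : ℂ) / k ^ 2) := rfl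
  unfold boundaryTerm scattered reflected transmitted
  simp only [neg_mul]
  rw [e0, h1, h2, hpw, hpw0, hK]
  set s := Complex.sqrt (1 + ((α₁ - α₂ : ℝ) : ℂ) / k ^ 2) with hsdef
  field_simp
  ring

/-! ### Integrals over large half-circles -/

/-- The integrals of the entire function `∫ κ s k g s ds` along a diameter and along the lower
half-circle coincide. -/
lemma integral_diameter_eq_halfCircle {κ : ℝ → ℂ → ℂ} (hκ : Continuous (Function.uncurry κ))
    (hd : ∀ s, Differentiable ℂ (κ s)) {g : ℝ → ℂ} (hg : IntegrableOn g (Set.Icc 0 t)) (r : ℝ) :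
    IntervalIntegrable (fun k : ℝ => ∫ s in Set.Icc 0 t, κ s k * g s) volume (-r) r ∧
    IntervalIntegrable (fun θ : ℝ => (∫ s in Set.Icc 0 t, κ s (circleMap 0 r θ) * g s) *
      (circleMap 0 r θ * Complex.I)) volume Real.pi (2 * Real.pi) ∧
    ∫ k in (-r)..r, (∫ s in Set.Icc 0 t, κ s k * g s) =
      ∫ θ in Real.pi..(2 * Real.pi), (∫ s in Set.Icc 0 t, κ s (circleMap 0 r θ) * g s) *
        (circleMap 0 r θ * Complex.I) := by
  have h1 : Continuous (Function.uncurry fun s k : ℝ => κ s k) :=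
    hκ.comp (f := fun p : ℝ × ℝ => (p.1, (p.2 : ℂ))) (by fun_prop)
  have h2 : Continuous (Function.uncurry fun s θ : ℝ => κ s (circleMap 0 r θ) *
      (circleMap 0 r θ * Complex.I)) := by
    have hc : Continuous fun p : ℝ × ℝ => circleMap 0 r p.2 :=
      (continuous_circleMap 0 r).comp continuous_snd
    exact (hκ.comp (f := fun p : ℝ × ℝ => (p.1, circleMap 0 r p.2)) (by fun_prop)).mul
      (hc.mul continuous_const)
  obtain ⟨M₁, hM₁⟩ := ((isCompact_Icc (a := 0) (b := t)).prod
    (isCompact_uIcc (a := -r) (b := r))).exists_bound_of_continuousOn h1.continuousOn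
  obtain ⟨M₂, hM₂⟩ := ((isCompact_Icc (a := 0) (b := t)).prod
    (isCompact_uIcc (a := Real.pi) (b := 2 * Real.pi))).exists_bound_of_continuousOn h2.continuousOn
  obtain ⟨i1, -, s1⟩ := integral_swap measurableSet_Icc h1.continuousOn
    (fun y hy u hu => hM₁ (y, u) ⟨hy, hu⟩) hg
  obtain ⟨i2, -, s2⟩ := integral_swap measurableSet_Icc h2.continuousOn
    (fun y hy u hu => hM₂ (y, u) ⟨hy, hu⟩) hg
  have e : ∀ θ : ℝ, (∫ s in Set.Icc 0 t, κ s (circleMap 0 r θ) * g s) *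
      (circleMap 0 r θ * Complex.I) = ∫ s in Set.Icc 0 t, κ s (circleMap 0 r θ) *
        (circleMap 0 r θ * Complex.I) * g s := by
    intro θ
    rw [← integral_mul_const]
    congr 1 with s
    ring
  simp_rw [e]
  refine ⟨i1, i2, ?_⟩
  rw [s1, s2]
  congr 1 with s
  congr 1
  obtain ⟨H, hH⟩ := (hd s).isExactOn_univ
  have c1 : ∀ k : ℝ, HasDerivAt (fun k : ℝ => H k) (κ s k) k := fun k =>
    (hH k (Set.mem_univ _)).comp_ofReal
  have c2 : ∀ θ : ℝ, HasDerivAt (fun θ : ℝ => H (circleMap 0 r θ))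
      (κ s (circleMap 0 r θ) * (circleMap 0 r θ * Complex.I)) θ := fun θ =>
    (hH _ (Set.mem_univ _)).comp θ (hasDerivAt_circleMap 0 r θ)
  rw [intervalIntegral.integral_eq_sub_of_hasDerivAt (fun k _ => c1 k)
      (Continuous.intervalIntegrable (h1.comp (f := fun k : ℝ => (s, k)) (by fun_prop)) _ _),
    intervalIntegral.integral_eq_sub_of_hasDerivAt (fun θ _ => c2 θ)
      (Continuous.intervalIntegrable (h2.comp (f := fun θ : ℝ => (s, θ)) (by fun_prop)) _ _)]
  have e1 : circleMap 0 r (2 * Real.pi) = r := by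
    simp [circleMap, Complex.exp_two_pi_mul_I]
  have e2 : circleMap 0 r Real.pi = ((-r : ℝ) : ℂ) := by
    simp [circleMap, Complex.exp_pi_mul_I]
  rw [e1, e2]

lemma IsSolution.boundaryTerm_diameter (hψ : IsSolution α₁ α₂ ψ₀ ψ) (ht : 0 < t) (r : ℝ) :
    IntervalIntegrable (fun k : ℝ => boundaryTerm α₁ ψ x t k) volume (-r) r ∧
    IntervalIntegrable (fun θ : ℝ => boundaryTerm α₁ ψ x t (circleMap 0 r θ) *
      (circleMap 0 r θ * Complex.I)) volume Real.pi (2 * Real.pi) ∧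
    ∫ k in (-r)..r, boundaryTerm α₁ ψ x t k =
      ∫ θ in Real.pi..(2 * Real.pi), boundaryTerm α₁ ψ x t (circleMap 0 r θ) *
        (circleMap 0 r θ * Complex.I) := by
  set κ₁ : ℝ → ℂ → ℂ := fun s k => Complex.exp (Complex.I * k * x) *
    Complex.exp (-omega α₁ k * (t - s)) * Complex.I with hκ₁
  set κ₂ : ℝ → ℂ → ℂ := fun s k => Complex.exp (Complex.I * k * x) *
    Complex.exp (-omega α₁ k * (t - s)) * (-k) with hκ₂
  have hX := hψ.integrableOn_Icc_trace_dx ht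
  have hY := hψ.integrableOn_Icc_trace (t := t)
  obtain ⟨a1, a2, a3⟩ := integral_diameter_eq_halfCircle (κ := κ₁)
    (by simp only [hκ₁, omega, Function.uncurry_def]; fun_prop)
    (fun s => by simp only [hκ₁, omega]; fun_prop) hX r
  obtain ⟨b1, b2, b3⟩ := integral_diameter_eq_halfCircle (κ := κ₂)
    (by simp only [hκ₂, omega, Function.uncurry_def]; fun_prop)
    (fun s => by simp only [hκ₂, omega]; fun_prop) hY r
  have heq : ∀ k, boundaryTerm α₁ ψ x t k = (∫ s in Set.Icc 0 t, κ₁ s k * dx ψ 0 s) +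
      ∫ s in Set.Icc 0 t, κ₂ s k * ψ 0 s := by
    intro k
    have c1 : IntegrableOn (fun s => κ₁ s k * dx ψ 0 s) (Set.Icc 0 t) :=
      hX.continuousOn_mul (Continuous.continuousOn (by simp only [hκ₁]; fun_prop)) isCompact_Icc
    have c2 : IntegrableOn (fun s => κ₂ s k * ψ 0 s) (Set.Icc 0 t) :=
      hY.continuousOn_mul (Continuous.continuousOn (by simp only [hκ₂]; fun_prop)) isCompact_Icc
    rw [← integral_add c1 c2, boundaryTerm, intervalIntegral.integral_of_le ht.le,
      ← integral_Icc_eq_integral_Ioc, ← integral_const_mul]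
    congr 1 with s
    simp only [hκ₁, hκ₂]
    ring
  simp_rw [heq, add_mul]
  refine ⟨a1.add b1, a2.add b2, ?_⟩
  rw [intervalIntegral.integral_add a1 b1, intervalIntegral.integral_add a2 b2, a3, b3]

/-- Jordan's lemma for arcs in the lower half-plane. -/
lemma tendsto_arc_zero (hx : x < 0) {a b C : ℝ} (hab : a ≤ b) (ha : Real.pi ≤ a)
    (hb : b ≤ 2 * Real.pi) {F : ℝ → ℝ → ℂ}
    (hF : ∀ᶠ r in atTop, ∀ θ ∈ Set.Icc a b, ‖F r θ‖ ≤ C * Real.exp (-(r * Real.sin θ) * x)) :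
    Tendsto (fun r => ∫ θ in a..b, F r θ) atTop (𝓝 0) := by
  have hsin : ∀ θ ∈ Set.Icc a b, Real.sin θ ≤ 0 := fun θ hθ =>
    sin_nonpos_of_lower (ha.trans hθ.1) (hθ.2.trans hb)
  have hlim : Tendsto (fun r : ℝ => ∫ θ in a..b, C * Real.exp (-(r * Real.sin θ) * x)) atTop
      (𝓝 0) := by
    have h0 : (0 : ℝ) = ∫ _ in a..b, (0 : ℝ) := by simp
    rw [h0]
    refine intervalIntegral.tendsto_integral_filter_of_dominated_convergence (fun _ => |C|)
      (Eventually.of_forall fun r => Continuous.aestronglyMeasurable (by fun_prop)) ?_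
      intervalIntegrable_const ?_
    · filter_upwards [eventually_ge_atTop 0] with r hr
      refine Eventually.of_forall fun θ hθ => ?_
      rw [Set.uIoc_of_le hab] at hθ
      have := hsin θ ⟨hθ.1.le, hθ.2⟩
      rw [norm_mul, Real.norm_eq_abs, Real.norm_of_nonneg (Real.exp_pos _).le]
      refine mul_le_of_le_one_right (abs_nonneg _) (Real.exp_le_one_iff.2 ?_)
      nlinarith [mul_nonneg hr (neg_nonneg.2 this)]
    · have hne : ∀ᵐ θ : ℝ, θ ≠ b := by
        rw [ae_iff]; simp
      filter_upwards [hne] with θ hθb hθ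
      rw [Set.uIoc_of_le hab] at hθ
      have hneg : Real.sin θ < 0 := by
        have h1 : θ < b := lt_of_le_of_ne hθ.2 hθb
        have := Real.sin_pos_of_pos_of_lt_pi (x := θ - Real.pi) (by linarith [hθ.1])
          (by linarith)
        rw [Real.sin_sub_pi] at this
        linarith
      have h2 : Tendsto (fun r : ℝ => -(r * Real.sin θ) * x) atTop atBot := by
        have h3 : ∀ r : ℝ, -(r * Real.sin θ) * x = r * (-Real.sin θ * x) := fun r => by ring
        simp_rw [h3]
        exact tendsto_id.atTop_mul_const_of_neg (mul_neg_of_pos_of_neg (by linarith) hx)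
      simpa using (Real.tendsto_exp_atBot.comp h2).const_mul C
  refine squeeze_zero_norm' ?_ hlim
  filter_upwards [hF] with r hr
  refine intervalIntegral.norm_integral_le_of_norm_le hab ?_
    (Continuous.intervalIntegrable (by fun_prop) _ _)
  exact Eventually.of_forall fun θ hθ => hr θ ⟨hθ.1.le, hθ.2⟩

lemma continuousOn_scattered {g : ℝ → ℂ} (hg : Integrable g) (τ : ℝ) {r : ℝ} (hr : 0 < r)
    (hδ : |α₁ - α₂| < r ^ 2) :
    ContinuousOn (fun k => reflected α₁ (α₁ - α₂) x τ k * fourierNeg g (-k))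
      {k | k.im ≤ 0 ∧ r ≤ ‖k‖} ∧
    ContinuousOn (fun k => transmitted α₁ (α₁ - α₂) x τ k *
      fourierPos g (shiftedRoot (α₁ - α₂) k)) {k | k.im ≤ 0 ∧ r ≤ ‖k‖} := by
  have hlt : ∀ k : ℂ, r ≤ ‖k‖ → |α₁ - α₂| < ‖k‖ ^ 2 := fun k hk =>
    hδ.trans_le (pow_le_pow_left₀ hr.le hk 2)
  constructor
  · refine ContinuousOn.mul (fun k hk =>
      (differentiableAt_reflected (hlt k hk.2)).continuousAt.continuousWithinAt) ?_
    exact (continuousOn_fourierNeg hg.integrableOn).comp continuous_neg.continuousOn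
      fun k hk => by simpa using hk.1
  · refine ContinuousOn.mul (fun k hk =>
      (differentiableAt_transmitted (hlt k hk.2)).continuousAt.continuousWithinAt) ?_
    exact (continuousOn_fourierPos hg.integrableOn).comp (fun k hk =>
      (differentiableAt_shiftedRoot (hlt k hk.2)).continuousAt.continuousWithinAt)
      fun k hk => shiftedRoot_im_nonpos (hlt k hk.2) hk.1

/-- The scattered waves are `O(1 / |k|)` relative to the plane wave, since the data have an
integrable derivative. -/
lemma norm_scattered_le {g : ℝ → ℂ} (hg : Integrable g) (hd : Differentiable ℝ g)
    (hg' : Integrable (deriv g)) {τ : ℝ} {k : ℂ} (hk : k.im ≤ 0)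
    (hδ : 2 * |α₁ - α₂| < ‖k‖ ^ 2) :
    ‖scattered α₁ α₂ x τ g k‖ * ‖k‖ ≤
      3 * (‖g 0‖ + ∫ y, ‖deriv g y‖) * ‖planeWave α₁ x τ k‖ := by
  have hδ' : |α₁ - α₂| < ‖k‖ ^ 2 := by linarith [abs_nonneg (α₁ - α₂)]
  set C := ‖g 0‖ + ∫ y, ‖deriv g y‖ with hC
  have h1 := norm_mul_fourierNeg_le hg hd hg' (k := -k) (by simpa using hk)
  have h2 := norm_mul_fourierPos_le hg hd hg' (shiftedRoot_im_nonpos hδ' hk)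
  rw [norm_neg] at h1
  have hroot : ‖k‖ ≤ 2 * ‖shiftedRoot (α₁ - α₂) k‖ := by
    have := shiftedRoot_norm_sq_ge (δ := α₁ - α₂) (ne_zero_of_abs_lt hδ')
    refine le_of_sq_le_sq ?_ (by positivity)
    rw [mul_pow]
    linarith [sq_nonneg ‖k‖]
  have h3 := norm_reflected_le' (α := α₁) (x := x) (t := τ) hδ'
  have h4 := norm_transmitted_le (α := α₁) (x := x) (t := τ) hδ'
  set p := ‖planeWave α₁ x τ k‖ with hp
  have hp0 : 0 ≤ p := norm_nonneg _
  have h5 : ‖k‖ * ‖fourierPos g (shiftedRoot (α₁ - α₂) k)‖ ≤ 2 * C := by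
    have := mul_le_mul_of_nonneg_right hroot (norm_nonneg (fourierPos g (shiftedRoot (α₁ - α₂) k)))
    linarith
  calc ‖scattered α₁ α₂ x τ g k‖ * ‖k‖
      ≤ (p * ‖fourierNeg g (-k)‖ + p * ‖fourierPos g (shiftedRoot (α₁ - α₂) k)‖) * ‖k‖ := by
        refine mul_le_mul_of_nonneg_right ((norm_add_le _ _).trans ?_) (norm_nonneg _)
        rw [norm_mul, norm_mul]
        exact add_le_add (mul_le_mul_of_nonneg_right h3 (norm_nonneg _))
          (mul_le_mul_of_nonneg_right h4 (norm_nonneg _))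
    _ = p * (‖k‖ * ‖fourierNeg g (-k)‖ + ‖k‖ * ‖fourierPos g (shiftedRoot (α₁ - α₂) k)‖) := by ring
    _ ≤ p * (C + 2 * C) := mul_le_mul_of_nonneg_left (add_le_add h1 h5) hp0
    _ = 3 * C * p := by ring

/-- The same bound on an arc of a large circle, where the plane wave is dominated by `|e^{ikx}|`:
either at `τ = 0`, or in the fourth quadrant, where the time exponential is bounded. -/
lemma norm_scattered_arc_le {g : ℝ → ℂ} (hg : Integrable g) (hd : Differentiable ℝ g)
    (hg' : Integrable (deriv g)) {τ r θ : ℝ} (hτ : 0 ≤ τ) (hr : 0 ≤ r)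
    (hδ : 2 * |α₁ - α₂| < r ^ 2) (h1 : Real.pi ≤ θ) (h2 : θ ≤ 2 * Real.pi)
    (h : τ = 0 ∨ 3 * Real.pi / 2 ≤ θ) :
    ‖scattered α₁ α₂ x τ g (circleMap 0 r θ) * (circleMap 0 r θ * Complex.I)‖ ≤
      3 * (‖g 0‖ + ∫ y, ‖deriv g y‖) * Real.exp (-(r * Real.sin θ) * x) := by
  have hre := (circleMap_re_im r θ).1
  have him := (circleMap_re_im r θ).2
  have hsin := sin_nonpos_of_lower h1 h2
  have hk : (circleMap 0 r θ).im ≤ 0 := by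
    rw [him]; exact mul_nonpos_of_nonneg_of_nonpos hr hsin
  have hn := norm_circleMap_zero' hr θ
  rw [norm_mul, norm_mul, Complex.norm_I, mul_one]
  refine (norm_scattered_le hg hd hg' hk (by rwa [hn])).trans ?_
  refine mul_le_mul_of_nonneg_left ?_
    (mul_nonneg (by norm_num) (add_nonneg (norm_nonneg _)
      (integral_nonneg fun _ => norm_nonneg _)))
  rw [norm_planeWave, him]
  refine Real.exp_le_exp.2 ?_
  have : (circleMap 0 r θ).re * (r * Real.sin θ) * τ ≤ 0 := by
    rcases h with h | h
    · rw [h, mul_zero]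
    · have hcos : 0 ≤ Real.cos θ := by
        have := Real.cos_nonneg_of_neg_pi_div_two_le_of_le (x := θ - 2 * Real.pi) (by linarith)
          (by linarith [Real.pi_pos])
        rwa [Real.cos_sub_two_pi] at this
      rw [hre]
      exact mul_nonpos_of_nonpos_of_nonneg (mul_nonpos_of_nonneg_of_nonpos (mul_nonneg hr hcos)
        (mul_nonpos_of_nonneg_of_nonpos hr hsin)) hτ
  linarith

/-- The integral of the boundary term over the real line is that of the scattered initial data over
the boundary of the third quadrant. On the fourth-quadrant part of a large half-circle everything is
negligible, on the third-quadrant part everything but the scattered initial data. -/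
lemma IsSolution.tendsto_boundaryTerm (hψ₀ : Integrable ψ₀) (hψ₀d : Differentiable ℝ ψ₀)
    (hψ₀' : Integrable (deriv ψ₀)) (hψ : IsSolution α₁ α₂ ψ₀ ψ) (hx : x < 0) (ht : 0 < t)
    {R : ℝ} {I₁ I₂ : ℂ} (hR : √(2 * max |α₁| |α₂|) < R)
    (h₁ : HasContourIntegral 3 R
      (fun k => reflected α₁ (α₁ - α₂) x t k * fourierNeg ψ₀ (-k)) I₁)
    (h₂ : HasContourIntegral 3 R
      (fun k => transmitted α₁ (α₁ - α₂) x t k * fourierPos ψ₀ (shiftedRoot (α₁ - α₂) k)) I₂) :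
    Tendsto (fun r : ℝ => ∫ k in (-r)..r, boundaryTerm α₁ ψ x t k) atTop
      (𝓝 (-(2 * Real.pi * (I₁ + I₂)))) := by
  have hπ := Real.pi_pos
  obtain ⟨ρ, q1, q2, q3⟩ := exists_threshold hR
  have hδρ := (abs_le_of_max q3).2.2
  set W₀ : ℂ → ℂ := scattered α₁ α₂ x t ψ₀ with hW₀
  set W₁ : ℂ → ℂ := scattered α₁ α₂ x 0 (fun y => ψ y t) with hW₁
  have hψt := hψ.integrable t ht
  have hψtd : Differentiable ℝ fun y => ψ y t := fun y => hψ.differentiableAt_x y t ht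
  have hψt' : Integrable (deriv fun y => ψ y t) := hψ.integrable_dx t ht
  set C₀ := 3 * (‖ψ₀ 0‖ + ∫ y, ‖deriv ψ₀ y‖) with hC₀
  set C₁ := 3 * (‖ψ 0 t‖ + ∫ y, ‖deriv (fun y => ψ y t) y‖) with hC₁
  have hev : ∀ᶠ r : ℝ in atTop, 0 < r ∧ ρ < r ∧ 2 * |α₁ - α₂| < r ^ 2 := by
    filter_upwards [eventually_gt_atTop 0, eventually_gt_atTop ρ,
      (tendsto_pow_atTop two_ne_zero).eventually_gt_atTop (2 * |α₁ - α₂|)] with r a b c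
    exact ⟨a, b, c⟩
  have hB : ∀ r : ℝ, 0 < r → 2 * |α₁ - α₂| < r ^ 2 → ∀ θ ∈ Set.Icc Real.pi (2 * Real.pi),
      boundaryTerm α₁ ψ x t (circleMap 0 r θ) =
        2 * Real.pi * (W₀ (circleMap 0 r θ) - W₁ (circleMap 0 r θ)) := by
    intro r hr hδ θ hθ
    refine hψ.boundaryTerm_eq hψ₀ ht ?_ ?_
    · rw [(circleMap_re_im r θ).2]
      exact mul_nonpos_of_nonneg_of_nonpos hr.le (sin_nonpos_of_lower hθ.1 hθ.2)
    · rw [norm_circleMap_zero' hr.le]; linarith [abs_nonneg (α₁ - α₂)]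
  have h2π : ‖(2 * Real.pi : ℂ)‖ = 2 * Real.pi := by
    rw [norm_mul, Complex.norm_real, Real.norm_of_nonneg hπ.le]; simp
  -- the arc in the fourth quadrant
  have arc4 : Tendsto (fun r : ℝ => ∫ θ in (3 * Real.pi / 2)..(2 * Real.pi),
      boundaryTerm α₁ ψ x t (circleMap 0 r θ) * (circleMap 0 r θ * Complex.I)) atTop (𝓝 0) := by
    refine tendsto_arc_zero hx (C := 2 * Real.pi * (C₀ + C₁)) (by linarith) (by linarith) le_rfl ?_
    filter_upwards [hev] with r hr θ hθ
    have hθ' : Real.pi ≤ θ := by linarith [hθ.1]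
    rw [hB r hr.1 hr.2.2 θ ⟨hθ', hθ.2⟩, mul_assoc, norm_mul, h2π, sub_mul,
      mul_assoc (2 * Real.pi) (C₀ + C₁)]
    refine mul_le_mul_of_nonneg_left ((norm_sub_le _ _).trans ?_)
      (mul_nonneg zero_le_two hπ.le)
    rw [add_mul]
    exact add_le_add (norm_scattered_arc_le hψ₀ hψ₀d hψ₀' ht.le hr.1.le hr.2.2 hθ' hθ.2
        (Or.inr hθ.1))
      (norm_scattered_arc_le hψt hψtd hψt' le_rfl hr.1.le hr.2.2 hθ' hθ.2 (Or.inl rfl))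
  -- the arc in the third quadrant
  have arc3 : Tendsto (fun r : ℝ => ∫ θ in Real.pi..(3 * Real.pi / 2),
      (boundaryTerm α₁ ψ x t (circleMap 0 r θ) * (circleMap 0 r θ * Complex.I) -
        2 * Real.pi * (W₀ (circleMap 0 r θ) * (circleMap 0 r θ * Complex.I)))) atTop (𝓝 0) := by
    refine tendsto_arc_zero hx (C := 2 * Real.pi * C₁) (by linarith) le_rfl (by linarith) ?_
    filter_upwards [hev] with r hr θ hθ
    have hθ' : θ ≤ 2 * Real.pi := by linarith [hθ.2]
    have e : boundaryTerm α₁ ψ x t (circleMap 0 r θ) * (circleMap 0 r θ * Complex.I) -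
        2 * Real.pi * (W₀ (circleMap 0 r θ) * (circleMap 0 r θ * Complex.I)) =
        -(2 * Real.pi * (W₁ (circleMap 0 r θ) * (circleMap 0 r θ * Complex.I))) := by
      rw [hB r hr.1 hr.2.2 θ ⟨hθ.1, hθ'⟩]; ring
    rw [e, norm_neg, norm_mul, h2π, mul_assoc (2 * Real.pi)]
    exact mul_le_mul_of_nonneg_left (norm_scattered_arc_le hψt hψtd hψt' le_rfl hr.1.le hr.2.2
      hθ.1 hθ' (Or.inl rfl)) (by positivity)
  -- the scattered initial data on the arc in the third quadrant
  have hdiag : Tendsto (fun r : ℝ => (r, r)) atTop (atTop ×ˢ atTop) :=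
    tendsto_id.prodMk tendsto_id
  have arcW : Tendsto (fun r : ℝ => ∫ θ in Real.pi..(3 * Real.pi / 2),
      W₀ (circleMap 0 r θ) * (circleMap 0 r θ * Complex.I)) atTop (𝓝 (-(I₁ + I₂))) := by
    refine (((h₁.comp hdiag).add (h₂.comp hdiag)).neg).congr' ?_
    filter_upwards [hev] with r hr
    have hpr := isTransformPair_reflected (x := x) (t := t) q1 hδρ
    have hpt := isTransformPair_transmitted (x := x) (t := t) q1 hδρ
    have t1 : truncatedContourIntegral 3 R
        (fun k => reflected α₁ (α₁ - α₂) x t k * fourierNeg ψ₀ (-k)) r r =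
        truncatedContourIntegral 3 r
          (fun k => reflected α₁ (α₁ - α₂) x t k * fourierNeg ψ₀ (-k)) r r :=
      hpr.truncated_radius measurableSet_Iio hψ₀.integrableOn q1 q2 hr.2.1 hr.2.1 hr.2.1
    have t2 : truncatedContourIntegral 3 R (fun k => transmitted α₁ (α₁ - α₂) x t k *
        fourierPos ψ₀ (shiftedRoot (α₁ - α₂) k)) r r =
        truncatedContourIntegral 3 r (fun k => transmitted α₁ (α₁ - α₂) x t k *
          fourierPos ψ₀ (shiftedRoot (α₁ - α₂) k)) r r :=
      hpt.truncated_radius measurableSet_Ioi hψ₀.integrableOn q1 q2 hr.2.1 hr.2.1 hr.2.1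
    simp only [Function.comp_apply]
    rw [t1, t2, truncatedContourIntegral_self, truncatedContourIntegral_self]
    have e2 : (((3 : ℕ) - 1 : ℝ) * Real.pi / 2 : ℝ) = Real.pi := by push_cast; ring
    have e3 : (((3 : ℕ) : ℝ) * Real.pi / 2 : ℝ) = 3 * Real.pi / 2 := by push_cast; ring
    obtain ⟨k1, k2⟩ := continuousOn_scattered (x := x) hψ₀ t hr.1
      (by linarith [abs_nonneg (α₁ - α₂), hr.2.2] : |α₁ - α₂| < r ^ 2)
    have hint : ∀ f : ℂ → ℂ, ContinuousOn f {k | k.im ≤ 0 ∧ r ≤ ‖k‖} →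
        IntervalIntegrable (fun θ => f (circleMap 0 r θ) * (circleMap 0 r θ * Complex.I)) volume
          (3 * Real.pi / 2) Real.pi := by
      intro f hf
      refine ContinuousOn.intervalIntegrable ((hf.comp (continuous_circleMap 0 r).continuousOn
        fun θ hθ => ?_).mul (by fun_prop))
      rw [Set.uIcc_of_ge (by linarith)] at hθ
      have := circleMap_mem_thirdQuadrant hr.1.le le_rfl hθ.1 hθ.2
      exact ⟨this.2.1, this.2.2⟩
    rw [e2, e3, ← intervalIntegral.integral_add (hint _ k1) (hint _ k2),
      ← intervalIntegral.integral_symm]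
    refine intervalIntegral.integral_congr fun θ _ => ?_
    simp only [hW₀, scattered]
    ring
  have hlim := (arc3.add (arcW.const_mul (2 * Real.pi : ℂ))).add arc4
  have hval : (0 : ℂ) + 2 * Real.pi * -(I₁ + I₂) + 0 = -(2 * Real.pi * (I₁ + I₂)) := by ring
  rw [hval] at hlim
  refine hlim.congr' ?_
  filter_upwards [hev] with r hr
  obtain ⟨-, i2, i3⟩ := hψ.boundaryTerm_diameter (x := x) ht r
  have j1 : IntervalIntegrable (fun θ : ℝ => boundaryTerm α₁ ψ x t (circleMap 0 r θ) *
      (circleMap 0 r θ * Complex.I)) volume Real.pi (3 * Real.pi / 2) :=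
    i2.mono_set (by
      rw [Set.uIcc_of_le (by linarith), Set.uIcc_of_le (by linarith)]
      exact Set.Icc_subset_Icc_right (by linarith))
  have j2 : IntervalIntegrable (fun θ : ℝ => boundaryTerm α₁ ψ x t (circleMap 0 r θ) *
      (circleMap 0 r θ * Complex.I)) volume (3 * Real.pi / 2) (2 * Real.pi) :=
    i2.mono_set (by
      rw [Set.uIcc_of_le (by linarith), Set.uIcc_of_le (by linarith)]
      exact Set.Icc_subset_Icc_left (by linarith))
  have j3 : IntervalIntegrable (fun θ : ℝ => W₀ (circleMap 0 r θ) *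
      (circleMap 0 r θ * Complex.I)) volume Real.pi (3 * Real.pi / 2) := by
    obtain ⟨k1, k2⟩ := continuousOn_scattered (x := x) hψ₀ t hr.1
      (by linarith [abs_nonneg (α₁ - α₂), hr.2.2] : |α₁ - α₂| < r ^ 2)
    refine ContinuousOn.intervalIntegrable (((k1.add k2).comp
      (continuous_circleMap 0 r).continuousOn fun θ hθ => ?_).mul (by fun_prop))
    rw [Set.uIcc_of_le (by linarith)] at hθ
    have := circleMap_mem_thirdQuadrant hr.1.le le_rfl hθ.1 hθ.2
    exact ⟨this.2.1, this.2.2⟩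
  rw [i3, ← intervalIntegral.integral_add_adjacent_intervals j1 j2,
    intervalIntegral.integral_sub j1 (j3.const_mul _), intervalIntegral.integral_const_mul,
    sub_add_cancel]

/-- The solution on the left half-line, in terms of the free evolution and the reflected and the
transmitted wave: inversion of the transform in the global relation. -/
lemma IsSolution.eq_of_integrals (hψ₀ : Integrable ψ₀) (hψ₀d : Differentiable ℝ ψ₀)
    (hψ₀' : Integrable (deriv ψ₀)) (hψ : IsSolution α₁ α₂ ψ₀ ψ) (hx : x < 0) (ht : 0 < t)
    {R : ℝ} {I₀ I₁ I₂ : ℂ} (hR : √(2 * max |α₁| |α₂|) < R)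
    (h₀ : HasLineIntegral (fun k => planeWave α₁ x t k * fourierNeg ψ₀ k) I₀)
    (h₁ : HasContourIntegral 3 R
      (fun k => reflected α₁ (α₁ - α₂) x t k * fourierNeg ψ₀ (-k)) I₁)
    (h₂ : HasContourIntegral 3 R
      (fun k => transmitted α₁ (α₁ - α₂) x t k * fourierPos ψ₀ (shiftedRoot (α₁ - α₂) k)) I₂) :
    ψ x t = 1 / (2 * Real.pi) * I₀ - I₁ - I₂ := by
  have hπ : (Real.pi : ℂ) ≠ 0 := by exact_mod_cast Real.pi_ne_zero
  have hinv := tendsto_integral_fourierNeg (hψ.integrable t ht) hx (hψ.differentiableAt_x x t ht)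
  have hB := hψ.tendsto_boundaryTerm hψ₀ hψ₀d hψ₀' hx ht hR h₁ h₂
  have hline : Tendsto (fun r : ℝ => ∫ k in (-r)..r, planeWave α₁ x t (k : ℂ) * fourierNeg ψ₀ k)
      atTop (𝓝 I₀) :=
    Tendsto.comp (g := fun p : ℝ × ℝ => ∫ k in p.1..p.2,
      planeWave α₁ x t (k : ℂ) * fourierNeg ψ₀ k) h₀
      (tendsto_neg_atTop_atBot.prodMk tendsto_id)
  have hsum : Tendsto (fun r : ℝ => ∫ k in (-r)..r, Complex.exp (Complex.I * k * x) *
      fourierNeg (fun y => ψ y t) k) atTop (𝓝 (I₀ + -(2 * Real.pi * (I₁ + I₂)))) := by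
    refine (hline.add hB).congr fun r => ?_
    have c1 : Continuous fun k : ℝ => planeWave α₁ x t (k : ℂ) * fourierNeg ψ₀ k := by
      refine ((differentiable_planeWave α₁ x t).continuous.comp Complex.continuous_ofReal).mul ?_
      exact continuousOn_univ.1 ((continuousOn_fourierNeg hψ₀.integrableOn).comp
        Complex.continuous_ofReal.continuousOn fun k _ => by simp)
    rw [← intervalIntegral.integral_add (c1.intervalIntegrable _ _)
      (hψ.boundaryTerm_diameter ht r).1]
    refine intervalIntegral.integral_congr fun k _ => ?_
    have hrel := hψ.global_relation hψ₀ (k := (k : ℂ)) (by simp) ht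
    rw [hrel, boundaryTerm, planeWave, sub_eq_add_neg, Complex.exp_add]
    ring_nf
  have := tendsto_nhds_unique hinv hsum
  field_simp
  linear_combination this

end Elimination

/-! ### The solution formulas -/

section Formulas

variable {α₁ α₂ x t : ℝ}

/-- Multiplication by `i` carries a contour integral over the boundary of one quadrant to that of
the next. -/
lemma HasContourIntegral.succ {j : ℕ} {R : ℝ} {f g : ℂ → ℂ} {l : ℂ}
    (h : HasContourIntegral j R f l) (hfg : ∀ k, g (Complex.I * k) * Complex.I = f k) :
    HasContourIntegral (j + 1) R g l := by
  refine Tendsto.congr (fun p => ?_) h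
  rw [truncatedContourIntegral_succ]
  simp only [hfg]

lemma truncatedContourIntegral_neg (j : ℕ) (R : ℝ) (f : ℂ → ℂ) (A B : ℝ) :
    truncatedContourIntegral j R (fun k => -f k) A B = -truncatedContourIntegral j R f A B := by
  simp only [truncatedContourIntegral, neg_mul, intervalIntegral.integral_neg]
  ring

lemma HasContourIntegral.neg {j : ℕ} {R : ℝ} {f : ℂ → ℂ} {l : ℂ}
    (h : HasContourIntegral j R f l) : HasContourIntegral j R (fun k => -f k) (-l) := by
  refine Tendsto.congr (fun p => ?_) (Tendsto.neg h)
  rw [truncatedContourIntegral_neg]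

/-- The reflection `k ↦ -k` carries the boundary of the third quadrant to that of the first. -/
lemma HasContourIntegral.reflect {R : ℝ} {f g : ℂ → ℂ} {l : ℂ}
    (h : HasContourIntegral 3 R f l) (hfg : ∀ k, f (-k) = g k) :
    HasContourIntegral 1 R g (-l) := by
  refine Tendsto.congr (fun p => ?_) (Tendsto.neg h)
  have e : (fun k => f (Complex.I * (Complex.I * k)) * Complex.I * Complex.I) = fun k => -g k := by
    ext k
    rw [← mul_assoc, mul_assoc (f _), Complex.I_mul_I, neg_one_mul, hfg, mul_neg_one]
  rw [truncatedContourIntegral_succ 2, truncatedContourIntegral_succ 1, e,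
    truncatedContourIntegral_neg, neg_neg]

lemma HasLineIntegral.reflect {f g : ℂ → ℂ} {l : ℂ} (h : HasLineIntegral f l)
    (hfg : ∀ k, f (-k) = g k) : HasLineIntegral g l := by
  have hneg : Tendsto (fun p : ℝ × ℝ => (-p.2, -p.1)) (atBot ×ˢ atTop) (atBot ×ˢ atTop) :=
    (tendsto_neg_atTop_atBot.comp tendsto_snd).prodMk (tendsto_neg_atBot_atTop.comp tendsto_fst)
  refine Tendsto.congr (fun p => ?_) (Tendsto.comp h hneg)
  simp only [Function.comp_apply]
  rw [← intervalIntegral.integral_comp_neg]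
  simp only [Complex.ofReal_neg, hfg]

/-- The coefficient of the transmitted wave under `κ = i k`, with `ν⁽¹⁾ = -A` and `ν⁽²⁾ = -B`. -/
lemma coeff_transmittedNu (A B : ℂ) (k : ℂ) :
    Complex.I * k / (Real.pi * (-A + -B)) * Complex.I = k / (Real.pi * (A + B)) := by
  rw [show (Real.pi : ℂ) * (-A + -B) = -(Real.pi * (A + B)) by ring, div_neg, neg_mul,
    div_mul_eq_mul_div, ← neg_div]
  congr 1
  linear_combination (-k) * Complex.I_mul_I

/-- The coefficient of the reflected wave under `κ = i k`, with `ν⁽¹⁾ = -A` and `ν⁽²⁾ = -B`. -/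
lemma coeff_reflectedNu (A B : ℂ) (k : ℂ) :
    Complex.I * k * (-A - -B) / (2 * Real.pi * -A * (-A + -B)) * Complex.I =
      k * (A - B) / (2 * Real.pi * A * (A + B)) := by
  rw [show (2 * Real.pi : ℂ) * -A * (-A + -B) = 2 * Real.pi * A * (A + B) by ring,
    div_mul_eq_mul_div]
  congr 1
  linear_combination (-k * (A - B)) * Complex.I_mul_I

lemma exponent_nu (A : ℂ) (x t : ℝ) (k : ℂ) :
    -Complex.I * -A * x + Complex.I * (Complex.I * k) ^ 2 * t =
      Complex.I * A * x - Complex.I * k ^ 2 * t := by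
  rw [mul_pow, Complex.I_sq]; ring

lemma exponent_nu' (A : ℂ) (x t : ℝ) (k : ℂ) :
    Complex.I * -A * x + Complex.I * (Complex.I * k) ^ 2 * t =
      Complex.I * A * (-x : ℝ) - Complex.I * k ^ 2 * t := by
  rw [mul_pow, Complex.I_sq]; push_cast; ring

end Formulas

end StepPotential

open StepPotential Complex in
theorem mainTheorem1 (α₁ α₂ : ℝ) (ψ₀ : ℝ → ℂ) (hψ₀ : IsInitialDatum ψ₀)
    (ψ : ℝ → ℝ → ℂ) (hψ : IsSolution α₁ α₂ ψ₀ ψ) :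
    -- the solution for `x < 0`
    (∀ x t : ℝ, x < 0 → 0 < t → ∃ I₀ I₁ I₂ : ℂ,
      HasLineIntegral (fun k => exp (I * k * x - omega α₁ k * t) * fourierNeg ψ₀ k) I₀ ∧
      (∀ R : ℝ, √(2 * max |α₁| |α₂|) < R →
        -- the form on the boundary of `D_R^{(4)}`
        HasContourIntegral 4 R (fun κ =>
          κ * (nu α₁ κ - nu α₂ κ) / (2 * Real.pi * nu α₁ κ * (nu α₁ κ + nu α₂ κ)) *
            exp (-I * nu α₁ κ * x + I * κ ^ 2 * t) * fourierNeg ψ₀ (nu α₁ κ)) I₁ ∧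
        HasContourIntegral 4 R (fun κ =>
          κ / (Real.pi * (nu α₁ κ + nu α₂ κ)) *
            exp (-I * nu α₁ κ * x + I * κ ^ 2 * t) * fourierPos ψ₀ (-nu α₂ κ)) I₂ ∧
        -- the equivalent form on the boundary of `D_R^{(3)}`
        HasContourIntegral 3 R (fun k =>
          (1 - sqrt (1 + (α₁ - α₂) / k ^ 2)) /
              (2 * Real.pi * (1 + sqrt (1 + (α₁ - α₂) / k ^ 2))) *
            exp (I * k * x - omega α₁ k * t) * fourierNeg ψ₀ (-k)) I₁ ∧
        HasContourIntegral 3 R (fun k =>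
          1 / (Real.pi * (1 + sqrt (1 + (α₁ - α₂) / k ^ 2))) *
            exp (I * k * x - omega α₁ k * t) *
            fourierPos ψ₀ (k * sqrt (1 + (α₁ - α₂) / k ^ 2))) I₂) ∧
      ψ x t = 1 / (2 * Real.pi) * I₀ - I₁ - I₂) ∧
    -- the solution for `x > 0`
    (∀ x t : ℝ, 0 < x → 0 < t → ∃ I₀ I₁ I₂ : ℂ,
      HasLineIntegral (fun k => exp (I * k * x - omega α₂ k * t) * fourierPos ψ₀ k) I₀ ∧
      (∀ R : ℝ, √(2 * max |α₁| |α₂|) < R →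
        -- the form on the boundary of `D_R^{(4)}`
        HasContourIntegral 4 R (fun κ =>
          κ / (Real.pi * (nu α₁ κ + nu α₂ κ)) *
            exp (I * nu α₂ κ * x + I * κ ^ 2 * t) * fourierNeg ψ₀ (nu α₁ κ)) I₁ ∧
        HasContourIntegral 4 R (fun κ =>
          κ * (nu α₁ κ - nu α₂ κ) / (2 * Real.pi * nu α₂ κ * (nu α₁ κ + nu α₂ κ)) *
            exp (I * nu α₂ κ * x + I * κ ^ 2 * t) * fourierPos ψ₀ (-nu α₂ κ)) I₂ ∧
        -- the equivalent form on the boundary of `D_R^{(1)}`;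
        -- the substitution changes the sign of the first integral
        HasContourIntegral 1 R (fun k =>
          1 / (Real.pi * (1 + sqrt (1 - (α₁ - α₂) / k ^ 2))) *
            exp (I * k * x - omega α₂ k * t) *
            fourierNeg ψ₀ (k * sqrt (1 - (α₁ - α₂) / k ^ 2))) (-I₁) ∧
        HasContourIntegral 1 R (fun k =>
          (1 - sqrt (1 - (α₁ - α₂) / k ^ 2)) /
              (2 * Real.pi * (1 + sqrt (1 - (α₁ - α₂) / k ^ 2))) *
            exp (I * k * x - omega α₂ k * t) * fourierPos ψ₀ (-k)) I₂) ∧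
      ψ x t = 1 / (2 * Real.pi) * I₀ - I₁ + I₂) := by
  have hd : deriv (fun x => ψ₀ (-x)) = fun x => -deriv ψ₀ (-x) := by
    ext x
    exact deriv_comp_neg ψ₀ x
  refine ⟨fun x t hx ht => ?_, fun x t hx ht => ?_⟩
  · obtain ⟨I₀, h₀⟩ := exists_hasLineIntegral hψ₀.integrable α₁ x ht
    obtain ⟨I₁, h₁⟩ := exists_reflected_integral (α₁ := α₁) (α₂ := α₂) hψ₀.integrable hx ht
    obtain ⟨I₂, h₂⟩ := exists_transmitted_integral (α₁ := α₁) (α₂ := α₂) hψ₀.integrable hx ht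
    have hR := lt_add_one √(2 * max |α₁| |α₂|)
    refine ⟨I₀, I₁, I₂, h₀, fun R hR => ⟨?_, ?_, ?_, ?_⟩,
      hψ.eq_of_integrals hψ₀.integrable hψ₀.differentiable hψ₀.integrable_deriv hx ht hR h₀
        (h₁ _ hR).1 (h₂ _ hR).1⟩
    · refine (h₁ R hR).2.succ fun k => ?_
      simp only [nu_I_mul]
      rw [exponent_nu, mul_right_comm, mul_right_comm _ _ I, coeff_reflectedNu]
      rfl
    · refine (h₂ R hR).2.succ fun k => ?_
      simp only [nu_I_mul]
      rw [exponent_nu, mul_right_comm, mul_right_comm _ _ I, coeff_transmittedNu, neg_neg]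
      rfl
    · have h := (h₁ R hR).1
      simp only [reflected, ofReal_sub] at h
      exact h
    · have h := (h₂ R hR).1
      simp only [transmitted, shiftedRoot, ofReal_sub] at h
      exact h
  · -- the reflected solution, on the left half-line, with the potentials exchanged
    have hx' : -x < 0 := neg_lt_zero.2 hx
    have hi : Integrable fun x => ψ₀ (-x) := hψ₀.integrable.comp_neg
    obtain ⟨I₀, h₀⟩ := exists_hasLineIntegral hi α₂ (-x) ht
    obtain ⟨I₂, h₂⟩ := exists_reflected_integral (α₁ := α₂) (α₂ := α₁) hi hx' ht
    obtain ⟨I₁, h₁⟩ := exists_transmitted_integral (α₁ := α₂) (α₂ := α₁) hi hx' ht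
    have hR := lt_add_one √(2 * max |α₂| |α₁|)
    have hrad : ∀ k : ℂ, 1 + ((α₂ : ℂ) - α₁) / (-k) ^ 2 = 1 - (α₁ - α₂) / k ^ 2 := fun k => by
      rw [neg_sq]; ring
    have hwave : ∀ k : ℂ, planeWave α₂ (-x) t (-k) = exp (I * k * x - omega α₂ k * t) := fun k => by
      rw [planeWave, omega_neg]; push_cast; ring_nf
    have heq := hψ.reflect.eq_of_integrals hi
      (hψ₀.differentiable.comp differentiable_neg)
      (by rw [hd]; exact hψ₀.integrable_deriv.comp_neg.neg) hx' ht hR h₀ (h₂ _ hR).1 (h₁ _ hR).1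
    refine ⟨I₀, I₁, -I₂, h₀.reflect fun k => ?_, fun R hR => ?_, ?_⟩
    · rw [hwave, ← fourierPos_eq_fourierNeg]
    · rw [max_comm] at hR
      refine ⟨?_, ?_, ?_, ?_⟩
      · refine (h₁ R hR).2.succ fun k => ?_
        simp only [nu_I_mul]
        rw [exponent_nu', mul_right_comm, mul_right_comm _ _ I, coeff_transmittedNu,
          fourierNeg_eq_fourierPos, neg_neg, add_comm (shiftedRoot (-α₁) k)]
        rfl
      · refine (h₂ R hR).2.neg.succ fun k => ?_
        simp only [nu_I_mul]
        rw [exponent_nu', neg_neg, fourierPos_eq_fourierNeg, reflectedNu,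
          ← coeff_reflectedNu]
        ring
      · refine (h₁ R hR).1.reflect fun k => ?_
        simp only [transmitted, shiftedRoot, ofReal_sub, hwave, hrad]
        rw [fourierNeg_eq_fourierPos, neg_mul]
      · refine (h₂ R hR).1.reflect fun k => ?_
        simp only [reflected, ofReal_sub, hwave, hrad]
        rw [fourierPos_eq_fourierNeg]
    · simp only [neg_neg] at heq
      rw [heq]; ring
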